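/- Let $m_1,m_2,m_3>0$, $m=m_1+m_2+m_3$ and $\mu\in\mathbb R$. Triples in $\mathbb C^3$ of relative quantities are indexed by $12,31,23$, covectors are identified with vectors through the pairing $\langle P,Q\rangle=\sum\bar P_{ij}Q_{ij}$ (whose real part is the real pairing), and $\mathbb C^3$ carries the Hermitian mass metric $\langle V,W\rangle=\frac1m\sum m_im_j\bar V_{ij}W_{ij}$ with norm $|X|$; $X^*=\frac1m(m_im_jX_{ij})$ is the covector dual to $X$. Put $$K(P)=\frac{|P_{12}-P_{31}|^2}{2m_1}+\frac{|P_{23}-P_{12}|^2}{2m_2}+\frac{|P_{31}-P_{23}|^2}{2m_3},\quad U(Q)=\sum\frac{m_im_j}{|Q_{ij}|},\quad H_{rel}(Q,P)=K(P)-U(Q),\quad V(X)=|X|\,U(X).$$ On $T^*\mathbb R^+\times T^*\mathbb C^3_0=\{(r,p_r,X,Z)\}$ let $H_\mu$ be $H_{rel}$ written in radial-homogeneous coordinates and composed with the momentum shift: $$H_\mu(r,p_r,X,Z)=H_{rel}\Big(\frac{rX}{|X|},\ \frac{p_r}{|X|}X^*+\frac{|X|}{r}Y\Big),\qquad Y=Z+\mu\frac{iX^*}{|X|^2}.$$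 Let $\Omega$ be the standard symplectic form, $\Omega_{FS}(V,W)=\operatorname{Im}\dfrac{\langle V,W\rangle\langle X,X\rangle-\langle V,X\rangle\langle X,W\rangle}{\langle X,X\rangle^2}$ the Fubini–Study form in the $X$ variables, and $\Omega_\mu=\Omega-2\mu\,\Omega_{FS}$. Collision configurations ($X_{ij}=0$, $Q_{ij}=0$ or $q_i=q_j$ for some $i\neq j$) are removed from all phase spaces. Reductions are taken in the sense of symplectic reduction: an invariant level set modulo a group that preserves the form, the Hamiltonian and the level set and acts freely on it, where the form restricted to the level set has exactly the orbit directions as kernel. Two reduced systems are called equivalent (their flows conjugate) if there are smooth maps between the unreduced systems, each taking level set to level set and orbits into orbits and preserving the restricted symplectic forms and the Hamiltonians, that are mutually inverse modulo the groups, so that the induced homeomorphism of the reduced spaces conjugates the quotient flows with the same time. **Theorem.** The form $\Omega_\mu$ is symplectic and is the pull-back of $\Omega$ under the momentum shift $(r,p_r,X,Z)\mapsto(r,p_r,X,Y)$. For the Hamiltonian flow of $H_\mu$ with respect to $\Omega_\mu$: 1. The set $\{\langle Z,X\rangle=0\}$ is invariant, and its quotient by complex scaling $k\cdot(r,p_r,X,Z)=(r,p_r,kX,Z/\bar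 k)$, $k\in\mathbb C\setminus0$, with the symplectic structure induced by $\Omega_\mu$, is a reduction with well-defined quotient flow. It is equivalent to the reduction of $H_{rel}$ on $T^*\mathbb C^3_0$ (with its standard form) by rotations, $S^1$, at angular momentum $-\operatorname{Im}\langle P,Q\rangle=\mu$. 2. The set $\{\langle Z,X\rangle=0,\ X_{12}+X_{31}+X_{23}=0\}$ is also invariant; on it $$H_\mu=\tfrac12\Big(p_r^2+\frac{\mu^2}{r^2}\Big)+\frac{|X|^2}{r^2}K(Z)-\frac1rV(X).$$ Its quotient by complex scaling and by the translations $Z\mapsto Z+(c,c,c)$, $c\in\mathbb C$, is a reduction with well-defined quotient flow. This flow is conjugate (the reduced systems are equivalent) to the flow of the planar three-body problem with masses $m_1,m_2,m_3$, zero total momentum and angular momentum $\mu$, reduced by translations and rotations. The invariance and reduction statements in 1 and 2, and the conjugacy in 2, hold as well for the Hamiltonian which is given on the whole of $T^*\mathbb R^+\times T^*\mathbb C^3_0$ by the explicit expression in 2. -/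

import Mathlib

open scoped Topology ContDiff ComplexConjugate

noncomputable section

namespace ThreeBody

/-! ### Hamiltonian systems with symmetry and their reduction -/

/-- A Hamiltonian system with symmetry on an open subset `dom` of a real normed space `E`:
a two-form `form` (`form x u v` is its value at `x` on the tangent vectors `u`, `v`), a Hamiltonian
`ham`, an action `act` of a group `G`, and a level set `level` of the conserved quantities. The
properties which these data should have are collected in `IsReduction`. -/
structure SymHamSystem (E G : Type) [NormedAddCommGroup E] [NormedSpace ℝ E] [Group G] where
  dom : Set E
  form : E → E → E → ℝ
  ham : E → ℝ
  level : Set E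
  act : G →* Function.End E

/-- `Ω` is a symplectic form on `U`: a smooth, closed, nondegenerate alternating two-form. -/
structure IsSymplecticOn {E : Type} [NormedAddCommGroup E] [NormedSpace ℝ E]
    (Ω : E → E → E → ℝ) (U : Set E) : Prop where
  linear : ∀ x ∈ U, ∀ u, IsLinearMap ℝ (Ω x u)
  antisymm : ∀ x ∈ U, ∀ u v, Ω x u v = -Ω x v u
  smooth : ∀ u v, ContDiffOn ℝ ∞ (fun x => Ω x u v) U
  closed : ∀ x ∈ U, ∀ u v w, fderiv ℝ (fun y => Ω y v w) x u +
    fderiv ℝ (fun y => Ω y w u) x v + fderiv ℝ (fun y => Ω y u v) x w = 0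
  nondegenerate : ∀ x ∈ U, ∀ u, (∀ v, Ω x u v = 0) → u = 0

/-- The tangent space at `x` of a subset `L` of a normed space: the velocities at `x` of curves
which run in `L`. -/
def tangentAt {E : Type} [NormedAddCommGroup E] [NormedSpace ℝ E] (L : Set E) (x : E) : Set E :=
  {v | ∃ γ : ℝ → E, γ 0 = x ∧ HasDerivAt γ v 0 ∧ ∀ᶠ t in 𝓝 (0 : ℝ), γ t ∈ L}

namespace SymHamSystem

variable {E G : Type} [NormedAddCommGroup E] [NormedSpace ℝ E] [Group G]

/-- `v` is the value at `x` of the Hamiltonian vector field: `v ⌟ Ω = dH`. -/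
def IsHamVec (S : SymHamSystem E G) (x v : E) : Prop :=
  ∀ w, S.form x v w = fderiv ℝ S.ham x w

/-- The graph of the (in general incomplete) Hamiltonian flow: `S.FlowTo t x y` says that the
solution with initial value `x` exists in `dom` up to the (positive or negative) time `t`, and
is then at `y`. -/
def FlowTo (S : SymHamSystem E G) (t : ℝ) (x y : E) : Prop :=
  ∃ γ : ℝ → E, γ 0 = x ∧ γ t = y ∧ ∀ s ∈ Set.uIcc 0 t, γ s ∈ S.dom ∧
    ∃ v, HasDerivWithinAt γ v (Set.uIcc 0 t) s ∧ S.IsHamVec (γ s) v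

/-- The group orbit through `x`. -/
def orbit (S : SymHamSystem E G) (x : E) : Set E := Set.range fun g => S.act g x

/-- Two points of the level set are equivalent if they are in the same group orbit. -/
def orbitSetoid (S : SymHamSystem E G) : Setoid S.level where
  r x y := ∃ g, S.act g x = y
  iseqv :=
    { refl := fun x => ⟨1, by rw [map_one]; rfl⟩
      symm := by
        rintro x y ⟨g, hg⟩
        refine ⟨g⁻¹, ?_⟩
        have h : (S.act g⁻¹ * S.act g) (x : E) = x := by
          rw [← map_mul, inv_mul_cancel, map_one]; rfl
        rw [← hg]
        exact h
      trans := by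
        rintro x y z ⟨g, hg⟩ ⟨k, hk⟩
        refine ⟨k * g, ?_⟩
        rw [map_mul, ← hk, ← hg]
        rfl }

/-- The reduced phase space: level set modulo group orbits, with the quotient topology. -/
abbrev RedSpace (S : SymHamSystem E G) : Type := Quotient S.orbitSetoid

/-- The projection of the level set to the reduced phase space. -/
def proj (S : SymHamSystem E G) (x : S.level) : S.RedSpace := Quotient.mk S.orbitSetoid x

/-- The graph of the quotient flow on the reduced phase space. -/
def RedFlow (S : SymHamSystem E G) (t : ℝ) (a b : S.RedSpace) : Prop :=
  ∃ x y : S.level, S.proj x = a ∧ S.proj y = b ∧ S.FlowTo t x y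

/-- The data define a reduction: the form is symplectic and the Hamiltonian smooth on the open set
`dom`; the group acts by symplectic diffeomorphisms of `dom` which preserve the Hamiltonian and
the level set, freely on the level set; the level set is invariant under the flow; the form,
restricted to the level set, has the tangent spaces of the orbits as kernel (so that it induces
a symplectic structure on the quotient); and the flow induces a well-defined quotient flow. -/
structure IsReduction (S : SymHamSystem E G) : Prop where
  isOpen_dom : IsOpen S.dom
  symplectic : IsSymplecticOn S.form S.dom
  ham_smooth : ContDiffOn ℝ ∞ S.ham S.dom
  level_subset : S.level ⊆ S.dom
  act_smooth : ∀ g, ContDiffOn ℝ ∞ (S.act g) S.dom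
  act_dom : ∀ g, ∀ x ∈ S.dom, S.act g x ∈ S.dom
  act_level : ∀ g, ∀ x ∈ S.level, S.act g x ∈ S.level
  act_free : ∀ g, ∀ x ∈ S.level, S.act g x = x → g = 1
  act_form : ∀ g, ∀ x ∈ S.dom, ∀ u v,
    S.form (S.act g x) (fderiv ℝ (S.act g) x u) (fderiv ℝ (S.act g) x v) = S.form x u v
  act_ham : ∀ g, ∀ x ∈ S.dom, S.ham (S.act g x) = S.ham x
  level_invariant : ∀ t x y, x ∈ S.level → S.FlowTo t x y → y ∈ S.level
  kernel : ∀ x ∈ S.level, ∀ u ∈ tangentAt S.level x,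
    (∀ v ∈ tangentAt S.level x, S.form x u v = 0) ↔ u ∈ tangentAt (S.orbit x) x
  redFlow_unique : ∀ t a b b', S.RedFlow t a b → S.RedFlow t a b' → b = b'
  redFlow_lift : ∀ t a b, S.RedFlow t a b → ∀ x : S.level, S.proj x = a →
    ∃ y : S.level, S.proj y = b ∧ S.FlowTo t x y

variable {E₁ G₁ E₂ G₂ : Type} [NormedAddCommGroup E₁] [NormedSpace ℝ E₁] [Group G₁]
  [NormedAddCommGroup E₂] [NormedSpace ℝ E₂] [Group G₂]

/-- A smooth map between the phase spaces which maps level set to level set, orbits into orbits,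
and preserves the restrictions of the symplectic forms to the level sets. -/
structure PartiallySymplectic (S₁ : SymHamSystem E₁ G₁) (S₂ : SymHamSystem E₂ G₂)
    (F : E₁ → E₂) : Prop where
  smooth : ContDiffOn ℝ ∞ F S₁.dom
  mapsTo : ∀ x ∈ S₁.level, F x ∈ S₂.level
  orbits : ∀ x ∈ S₁.level, ∀ g, ∃ k, F (S₁.act g x) = S₂.act k (F x)
  form : ∀ x ∈ S₁.level, ∀ u ∈ tangentAt S₁.level x, ∀ v ∈ tangentAt S₁.level x,
    S₂.form (F x) (fderiv ℝ F x u) (fderiv ℝ F x v) = S₁.form x u v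

/-- The reduced systems are equivalent: there are partially symplectic maps `F` and `F'` between
the two systems, inverse to each other modulo the groups and compatible with the
Hamiltonians, and the homeomorphism `e` of the reduced phase spaces induced by them conjugates
the quotient flows (with the same time parameter). -/
def Equivalent (S₁ : SymHamSystem E₁ G₁) (S₂ : SymHamSystem E₂ G₂) : Prop :=
  ∃ (F : E₁ → E₂) (F' : E₂ → E₁) (hF : PartiallySymplectic S₁ S₂ F)
    (hF' : PartiallySymplectic S₂ S₁ F') (e : S₁.RedSpace ≃ₜ S₂.RedSpace),
    (∀ x : S₁.level, e (S₁.proj x) = S₂.proj ⟨F x, hF.mapsTo x x.2⟩) ∧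
    (∀ y : S₂.level, e.symm (S₂.proj y) = S₁.proj ⟨F' y, hF'.mapsTo y y.2⟩) ∧
    (∀ x ∈ S₁.level, S₂.ham (F x) = S₁.ham x) ∧
    (∀ y ∈ S₂.level, S₁.ham (F' y) = S₂.ham y) ∧
    ∀ t a b, S₁.RedFlow t a b ↔ S₂.RedFlow t (e a) (e b)

end SymHamSystem

/-! ### Functions of the relative coordinates -/

/-- Triples of complex numbers, for vectors and covectors. Triples of relative quantities are
indexed by the pairs `12, 31, 23`, in this order. -/
abbrev C3 : Type := Fin 3 → ℂ

/-- The products `m₁ m₂, m₃ m₁, m₂ m₃`. -/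
def pairMass (m : Fin 3 → ℝ) : Fin 3 → ℝ := ![m 0 * m 1, m 2 * m 0, m 1 * m 2]

/-- The total mass. -/
def totalMass (m : Fin 3 → ℝ) : ℝ := ∑ i, m i

/-- The Hermitian evaluation pairing of a covector and a vector. -/
def pairing (P Q : C3) : ℂ := ∑ i, conj (P i) * Q i

/-- The Hermitian mass metric. -/
def massMetric (m : Fin 3 → ℝ) (V W : C3) : ℂ :=
  ∑ i, ((pairMass m i / totalMass m : ℝ) : ℂ) * (conj (V i) * W i)

/-- The mass norm. -/
def massNorm (m : Fin 3 → ℝ) (X : C3) : ℝ := √(massMetric m X X).re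

/-- The covector dual to `X` with respect to the mass metric. -/
def dualCovector (m : Fin 3 → ℝ) (X : C3) : C3 :=
  fun i => ((pairMass m i / totalMass m : ℝ) : ℂ) * X i

/-- The kinetic energy as a function of the relative momenta. -/
def kinetic (m : Fin 3 → ℝ) (P : C3) : ℝ :=
  ‖P 0 - P 1‖ ^ 2 / (2 * m 0) + ‖P 2 - P 0‖ ^ 2 / (2 * m 1) + ‖P 1 - P 2‖ ^ 2 / (2 * m 2)

/-- The negative potential energy as a function of the relative positions. -/
def potential (m : Fin 3 → ℝ) (Q : C3) : ℝ := ∑ i, pairMass m i / ‖Q i‖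

/-- The Hamiltonian in relative coordinates. -/
def hamRel (m : Fin 3 → ℝ) (x : C3 × C3) : ℝ := kinetic m x.2 - potential m x.1

/-- The three-body Hamiltonian. -/
def hamThreeBody (m : Fin 3 → ℝ) (x : C3 × C3) : ℝ :=
  ∑ i, ‖x.2 i‖ ^ 2 / (2 * m i) -
    (m 0 * m 1 / ‖x.1 0 - x.1 1‖ + m 2 * m 0 / ‖x.1 2 - x.1 0‖ + m 1 * m 2 / ‖x.1 1 - x.1 2‖)

/-- The standard symplectic form `dQ ∧ dP` on `T*ℂ³`. -/
def stdForm (_x u v : C3 × C3) : ℝ := (pairing v.2 u.1).re - (pairing u.2 v.1).re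

/-! ### Radial-homogeneous coordinates -/

/-- The ambient space of `T*ℝ⁺ × T*ℂ³₀`, with coordinates `(r, p_r, X, Z)`. -/
abbrev RadialPhase : Type := ℝ × ℝ × C3 × C3

/-- The map `(r, p_r, X, Y) ↦ (Q, P)`. -/
def fromRadial (m : Fin 3 → ℝ) : RadialPhase → C3 × C3 := fun ⟨r, p, X, Y⟩ =>
  ((r / massNorm m X) • X, (p / massNorm m X) • dualCovector m X + (massNorm m X / r) • Y)

/-- The momentum shift map `(r, p_r, X, Z) ↦ (r, p_r, X, Z + μ i X^* / |X|²)`. -/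
def momentumShift (m : Fin 3 → ℝ) (μ : ℝ) : RadialPhase → RadialPhase := fun ⟨r, p, X, Z⟩ =>
  (r, p, X, Z + ((μ / massNorm m X ^ 2 : ℝ) * Complex.I) • dualCovector m X)

/-- The Hamiltonian `H_μ`: the relative Hamiltonian in radial-homogeneous coordinates, composed with
the momentum shift. -/
def hamMu (m : Fin 3 → ℝ) (μ : ℝ) (x : RadialPhase) : ℝ :=
  hamRel m (fromRadial m (momentumShift m μ x))

/-- The explicit expression
`(p_r² + μ² / r²) / 2 + |X|² K(Z) / r² - V(X) / r`, where `V(X) = |X| U(X)`. -/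
def hamMuExplicit (m : Fin 3 → ℝ) (μ : ℝ) : RadialPhase → ℝ := fun ⟨r, p, X, Z⟩ =>
  1 / 2 * (p ^ 2 + μ ^ 2 / r ^ 2) + massNorm m X ^ 2 / r ^ 2 * kinetic m Z -
    1 / r * (massNorm m X * potential m X)

/-- The standard symplectic form `dr ∧ dp_r + dX ∧ dZ`. -/
def stdFormRadial (_x u v : RadialPhase) : ℝ :=
  u.1 * v.2.1 - u.2.1 * v.1 + ((pairing v.2.2.2 u.2.2.1).re - (pairing u.2.2.2 v.2.2.1).re)

/-- The Fubini-Study metric at `X` of the mass metric on `ℂ³`. -/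
def fubiniStudy (m : Fin 3 → ℝ) (X V W : C3) : ℂ :=
  (massMetric m V W * massMetric m X X - massMetric m V X * massMetric m X W) /
    massMetric m X X ^ 2

/-- The Fubini-Study two-form. -/
def fubiniStudyForm (m : Fin 3 → ℝ) (X V W : C3) : ℝ := (fubiniStudy m X V W).im

/-- The standard form minus `2 μ` times the Fubini-Study form of the `X` variables. -/
def twistedForm (m : Fin 3 → ℝ) (μ : ℝ) (x u v : RadialPhase) : ℝ :=
  stdFormRadial x u v - 2 * μ * fubiniStudyForm m x.2.2.1 u.2.2.1 v.2.2.1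

/-- `T*ℝ⁺ × T*ℂ³₀` without the singular set of the potential. -/
def radialDom : Set RadialPhase := {x | 0 < x.1 ∧ ∀ i, x.2.2.1 i ≠ 0}

/-! ### The symmetry groups -/

/-- Complex scaling `k · (r, p_r, X, Z) = (r, p_r, k X, Z / conj k)`. -/
def scaleAct : ℂˣ →* Function.End RadialPhase where
  toFun k := fun ⟨r, p, X, Z⟩ => (r, p, (k : ℂ) • X, (conj (k : ℂ))⁻¹ • Z)
  map_one' := by
    funext ⟨r, p, X, Z⟩
    show (r, p, _, _) = (r, p, X, Z)
    simp
  map_mul' k l := by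
    funext ⟨r, p, X, Z⟩
    show (r, p, _, _) = (r, p, (k : ℂ) • (l : ℂ) • X, (conj (k : ℂ))⁻¹ • (conj (l : ℂ))⁻¹ • Z)
    simp only [Units.val_mul, map_mul, mul_inv, mul_smul]

/-- The group generated by complex scalings and translations of the momenta, the semidirect product
of `ℂˣ` and `ℂ`. -/
@[ext] structure ScaleTrans : Type where
  k : ℂˣ
  c : ℂ

namespace ScaleTrans

instance : Mul ScaleTrans := ⟨fun a b => ⟨a.k * b.k, (conj (a.k : ℂ))⁻¹ * b.c + a.c⟩⟩
instance : One ScaleTrans := ⟨⟨1, 0⟩⟩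
instance : Inv ScaleTrans := ⟨fun a => ⟨a.k⁻¹, -(conj (a.k : ℂ) * a.c)⟩⟩

theorem mul_def (a b : ScaleTrans) :
    a * b = ⟨a.k * b.k, (conj (a.k : ℂ))⁻¹ * b.c + a.c⟩ := rfl
theorem one_def : (1 : ScaleTrans) = ⟨1, 0⟩ := rfl
theorem inv_def (a : ScaleTrans) : a⁻¹ = ⟨a.k⁻¹, -(conj (a.k : ℂ) * a.c)⟩ := rfl

instance : Group ScaleTrans := Group.ofLeftAxioms
  (by
    intro a b c
    simp only [mul_def, mk.injEq, Units.val_mul, map_mul, mul_inv]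
    exact ⟨mul_assoc _ _ _, by ring⟩)
  (by intro a; simp [mul_def, one_def])
  (by intro a; simp [mul_def, one_def, inv_def])

/-- `(k, c) · (r, p_r, X, Z) = (r, p_r, k X, Z / conj k + (c, c, c))`. -/
def act : ScaleTrans →* Function.End RadialPhase where
  toFun g := fun ⟨r, p, X, Z⟩ =>
    (r, p, (g.k : ℂ) • X, (conj (g.k : ℂ))⁻¹ • Z + fun _ => g.c)
  map_one' := by
    funext ⟨r, p, X, Z⟩
    show (r, p, _, _) = (r, p, X, Z)
    simp only [one_def, Units.val_one, map_one, inv_one, one_smul, Prod.mk.injEq, true_and]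
    funext i
    simp
  map_mul' a b := by
    funext ⟨r, p, X, Z⟩
    show (r, p, _, _) = (r, p, (a.k : ℂ) • (b.k : ℂ) • X,
      (conj (a.k : ℂ))⁻¹ • ((conj (b.k : ℂ))⁻¹ • Z + fun _ => b.c) + fun _ => a.c)
    simp only [mul_def, Units.val_mul, map_mul, mul_inv, mul_smul, Prod.mk.injEq, true_and]
    funext i
    simp only [Pi.add_apply, Pi.smul_apply, smul_eq_mul]
    ring

end ScaleTrans

/-- Rotations `u · (Q, P) = (u Q, u P)`. -/
def rotAct : Circle →* Function.End (C3 × C3) where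
  toFun u := fun x => ((u : ℂ) • x.1, (u : ℂ) • x.2)
  map_one' := by
    funext x
    show (_, _) = x
    simp
  map_mul' u v := by
    funext x
    show (_, _) = ((u : ℂ) • (v : ℂ) • x.1, (u : ℂ) • (v : ℂ) • x.2)
    simp only [Circle.coe_mul, mul_smul]

/-- The group of orientation-preserving isometries of the plane, the semidirect product of the
circle and `ℂ`. -/
@[ext] structure RotTrans : Type where
  u : Circle
  c : ℂ

namespace RotTrans

instance : Mul RotTrans := ⟨fun a b => ⟨a.u * b.u, (a.u : ℂ) * b.c + a.c⟩⟩
instance : One RotTrans := ⟨⟨1, 0⟩⟩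
instance : Inv RotTrans := ⟨fun a => ⟨a.u⁻¹, -(((a.u⁻¹ : Circle) : ℂ) * a.c)⟩⟩

theorem mul_def (a b : RotTrans) : a * b = ⟨a.u * b.u, (a.u : ℂ) * b.c + a.c⟩ := rfl
theorem one_def : (1 : RotTrans) = ⟨1, 0⟩ := rfl
theorem inv_def (a : RotTrans) : a⁻¹ = ⟨a.u⁻¹, -(((a.u⁻¹ : Circle) : ℂ) * a.c)⟩ := rfl

instance : Group RotTrans := Group.ofLeftAxioms
  (by
    intro a b c
    simp only [mul_def, mk.injEq, Circle.coe_mul]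
    exact ⟨mul_assoc _ _ _, by ring⟩)
  (by intro a; simp [mul_def, one_def])
  (by intro a; simp [mul_def, one_def, inv_def])

/-- `(u, c) · (q, p) = (u q + (c, c, c), u p)`. -/
def act : RotTrans →* Function.End (C3 × C3) where
  toFun g := fun x => ((g.u : ℂ) • x.1 + fun _ => g.c, (g.u : ℂ) • x.2)
  map_one' := by
    funext x
    show (_, _) = x
    ext i <;> simp [one_def]
  map_mul' a b := by
    funext x
    show (_, _) = ((a.u : ℂ) • ((b.u : ℂ) • x.1 + fun _ => b.c) + fun _ => a.c,
      (a.u : ℂ) • (b.u : ℂ) • x.2)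
    simp only [mul_def, Circle.coe_mul, mul_smul, Prod.mk.injEq, and_true]
    funext i
    simp only [Pi.add_apply, Pi.smul_apply, smul_eq_mul]
    ring

end RotTrans

/-! ### The systems -/

/-- A Hamiltonian `h` on `T*ℝ⁺ × T*ℂ³₀` with the twisted form, the level set `⟨Z, X⟩ = 0` and the
group of complex scalings. -/
def projectiveSystem (m : Fin 3 → ℝ) (μ : ℝ) (h : RadialPhase → ℝ) :
    SymHamSystem RadialPhase ℂˣ where
  dom := radialDom
  form := twistedForm m μ
  ham := h
  level := {x ∈ radialDom | pairing x.2.2.2 x.2.2.1 = 0}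
  act := scaleAct

/-- The same with the level set `⟨Z, X⟩ = 0`, `X₁₂ + X₃₁ + X₂₃ = 0` and the group of
complex scalings and translations of `Z`. -/
def shapeSystem (m : Fin 3 → ℝ) (μ : ℝ) (h : RadialPhase → ℝ) :
    SymHamSystem RadialPhase ScaleTrans where
  dom := radialDom
  form := twistedForm m μ
  ham := h
  level := {x ∈ radialDom | pairing x.2.2.2 x.2.2.1 = 0 ∧ ∑ i, x.2.2.1 i = 0}
  act := ScaleTrans.act

/-- The relative Hamiltonian on `T*ℂ³₀` with angular momentum `μ` and the group of rotations. -/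
def relativeSystem (m : Fin 3 → ℝ) (μ : ℝ) : SymHamSystem (C3 × C3) Circle where
  dom := {x | ∀ i, x.1 i ≠ 0}
  form := stdForm
  ham := hamRel m
  level := {x | (∀ i, x.1 i ≠ 0) ∧ -(pairing x.2 x.1).im = μ}
  act := rotAct

/-- The planar three-body problem with zero total momentum and angular momentum `μ`, and the group
of translations and rotations. -/
def threeBodySystem (m : Fin 3 → ℝ) (μ : ℝ) : SymHamSystem (C3 × C3) RotTrans where
  dom := {x | Function.Injective x.1}
  form := stdForm
  ham := hamThreeBody m
  level := {x | Function.Injective x.1 ∧ ∑ i, x.2 i = 0 ∧ -(pairing x.2 x.1).im = μ}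
  act := RotTrans.act

end ThreeBody

end

/-! All four kinds of system fit one scheme, `HasMomentum`: a free action with generators `ξ x a`
and a map `φ` such that `Ω (ξ x a) v = b a (dφ v)`, the level set being a level of `φ`. Noether's
theorem makes the level invariant. Nondegeneracy of `Ω` makes `dφ` surjective, and linear duality
identifies the symplectic complement of `ker dφ` with the space of generators. This is the kernel
condition of a reduction (`HasMomentum.isReduction`).

If two such systems have reduced spaces of equal dimension, a partially symplectic map between them
is infinitesimally onto modulo generators, by a dimension count (`exists_tangent`). When it also
respects the Hamiltonians on the level, it carries one Hamiltonian field to the other up to a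
generator (`hamVec_sub_mem`). This drift along the orbits is removed by solving an equation in the
group (`flowTo_map`). `HasMomentum.equivalent` thus reduces a conjugacy to finding explicit maps.

In radial-homogeneous coordinates, the momentum shift adds `μ Im⟨X, dX⟩ / |X|²` to the canonical
one-form. The differential of this term is `2μ` times the Fubini–Study form, which explains the
twist. The Fubini–Study form annihilates the complex line through `X`, so scaling keeps the momentum
`⟨Z, X⟩` for every `μ`. The identity `⟨P, Q⟩ = r p_r + ⟨Z, X⟩ - iμ` (`pairing_toRelative`) takes the
level `⟨Z, X⟩ = 0` to angular momentum `μ`. The scale with `|X| = r` gives a section in the other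
direction (`ofRelative`).

Relative and absolute coordinates are exchanged by the difference matrix. It is symmetric, and its
square is three times the projection onto triples of sum zero. In terms of this matrix `D` and the
mass matrix `M`, the kinetic energy is `K(P) = ½⟨DP, M⁻¹DP⟩`, and `D M⁻¹ D X* = X` for closed
triangles (`differences_dual`). Hence `X*` and `Z` are orthogonal for `K` when `⟨Z, X⟩ = 0`, and
Pythagoras yields the explicit Hamiltonian. The abstract argument uses only the invariance of a
Hamiltonian and its values on the level, so it applies to that expression too. -/

noncomputable section

namespace ThreeBody

/-! ### Tangent vectors of level sets, integral curves and Hamiltonian vector fields. -/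

section Generic

variable {E E' : Type} [NormedAddCommGroup E] [NormedSpace ℝ E]
  [NormedAddCommGroup E'] [NormedSpace ℝ E']

theorem tangentAt_map {f : E → E'} {L : Set E} {M : Set E'} {x v : E}
    (hf : DifferentiableAt ℝ f x) (hLM : ∀ y ∈ L, f y ∈ M) (hv : v ∈ tangentAt L x) :
    fderiv ℝ f x v ∈ tangentAt M (f x) := by
  obtain ⟨γ, rfl, hγ, hL⟩ := hv
  exact ⟨f ∘ γ, rfl, hf.hasFDerivAt.comp_hasDerivAt 0 hγ, hL.mono fun t ht => hLM _ ht⟩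

/-- Functions which agree on a set have the same derivative in tangent directions. -/
theorem fderiv_eq_of_tangentAt {f g : E → E'} {L : Set E} {x v : E}
    (hf : DifferentiableAt ℝ f x) (hg : DifferentiableAt ℝ g x) (hfg : ∀ y ∈ L, f y = g y)
    (hv : v ∈ tangentAt L x) : fderiv ℝ f x v = fderiv ℝ g x v := by
  obtain ⟨γ, rfl, hγ, hL⟩ := hv
  have h₁ := hf.hasFDerivAt.comp_hasDerivAt 0 hγ
  have h₂ := hg.hasFDerivAt.comp_hasDerivAt 0 hγ
  refine h₁.unique (h₂.congr_of_eventuallyEq ?_)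
  filter_upwards [hL] with t ht using hfg _ ht

theorem mem_tangentAt_level {F : Type} [NormedAddCommGroup F] [NormedSpace ℝ F]
    [FiniteDimensional ℝ F] [CompleteSpace E] {φ : E → F} {φ' : E →L[ℝ] F} {U : Set E}
    (hU : IsOpen U) {x v : E} (hx : x ∈ U) (hφ : HasStrictFDerivAt φ φ' x)
    (hs : (φ' : E →ₗ[ℝ] F).range = ⊤) :
    v ∈ tangentAt {y | y ∈ U ∧ φ y = φ x} x ↔ φ' v = 0 := by
  constructor
  · rintro ⟨γ, rfl, hγ, hL⟩
    have h₁ := hφ.hasFDerivAt.comp_hasDerivAt 0 hγ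
    refine h₁.unique ((hasDerivAt_const (0 : ℝ) (φ (γ 0))).congr_of_eventuallyEq ?_)
    filter_upwards [hL] with t ht using ht.2
  · intro hv
    -- The implicit function parametrizes the level set by the kernel of `φ'`; the image of the line
    -- through `v` is a curve in the level with velocity `v`.
    set ψ := hφ.implicitFunction φ φ' hs (φ x) with hψ
    let w : (φ' : E →ₗ[ℝ] F).ker := ⟨v, hv⟩
    have h0 : ψ 0 = x := hφ.implicitFunction_apply_image hs
    have hline : HasDerivAt (fun t : ℝ => t • w) w 0 := by
      simpa using (hasDerivAt_id (0 : ℝ)).smul_const w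
    have hd : HasDerivAt (fun t : ℝ => ψ (t • w)) v 0 := by
      have h := (hφ.to_implicitFunction hs).hasFDerivAt
      have h' : HasFDerivAt ψ (φ' : E →ₗ[ℝ] F).ker.subtypeL ((fun t : ℝ => t • w) 0) := by
        simpa using h
      exact h'.comp_hasDerivAt (0 : ℝ) hline
    refine ⟨fun t => ψ (t • w), by simpa using h0, hd, ?_⟩
    have hc : ContinuousAt (fun t : ℝ => ψ (t • w)) 0 := hd.continuousAt
    have h1 : ∀ᶠ t : ℝ in 𝓝 0, ψ (t • w) ∈ U :=
      hc.eventually_mem (hU.mem_nhds (by simpa [h0] using hx))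
    have h2 : Filter.Tendsto (fun t : ℝ => (φ x, t • w)) (𝓝 0) (𝓝 (φ x, 0)) := by
      have : Continuous (fun t : ℝ => (φ x, t • w)) := by fun_prop
      simpa using this.tendsto 0
    filter_upwards [h1, h2.eventually (hφ.map_implicitFunction_eq hs)] with t ht ht'
    exact ⟨ht, ht'⟩

/-- Uniqueness of integral curves of a vector field which is continuously differentiable on an
open set. -/
theorem integralCurve_unique {X : E → E} {U : Set E} (hU : IsOpen U)
    (hX : ContDiffOn ℝ 1 X U) {t : ℝ} {α β : ℝ → E} (h0 : α 0 = β 0)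
    (hα : ∀ s ∈ Set.uIcc 0 t, α s ∈ U ∧ HasDerivWithinAt α (X (α s)) (Set.uIcc 0 t) s)
    (hβ : ∀ s ∈ Set.uIcc 0 t, β s ∈ U ∧ HasDerivWithinAt β (X (β s)) (Set.uIcc 0 t) s) :
    Set.EqOn α β (Set.uIcc 0 t) := by
  have hαc : ContinuousOn α (Set.uIcc 0 t) := fun s hs => (hα s hs).2.continuousWithinAt
  have hβc : ContinuousOn β (Set.uIcc 0 t) := fun s hs => (hβ s hs).2.continuousWithinAt
  -- The field is only locally Lipschitz, but both curves run in one compact subset of `U`, where a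
  -- single Lipschitz constant suffices.
  set K := α '' Set.uIcc 0 t ∪ β '' Set.uIcc 0 t with hK
  have hKc : IsCompact K :=
    (isCompact_uIcc.image_of_continuousOn hαc).union (isCompact_uIcc.image_of_continuousOn hβc)
  have hKU : K ⊆ U := by
    rintro _ (⟨s, hs, rfl⟩ | ⟨s, hs, rfl⟩)
    exacts [(hα s hs).1, (hβ s hs).1]
  have hloc : LocallyLipschitzOn K X := by
    intro x hx
    obtain ⟨C, T, hT, hl⟩ :=
      ((hX x (hKU hx)).contDiffAt (hU.mem_nhds (hKU hx))).exists_lipschitzOnWith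
    exact ⟨C, T, mem_nhdsWithin_of_mem_nhds hT, hl⟩
  obtain ⟨C, hC⟩ := hloc.exists_lipschitzOnWith_of_compact hKc
  have mα : ∀ s ∈ Set.uIcc 0 t, α s ∈ K := fun s hs => Or.inl ⟨s, hs, rfl⟩
  have mβ : ∀ s ∈ Set.uIcc 0 t, β s ∈ K := fun s hs => Or.inr ⟨s, hs, rfl⟩
  rcases le_total 0 t with ht | ht
  · rw [Set.uIcc_of_le ht] at *
    have hn : ∀ s ∈ Set.Ico 0 t, Set.Icc 0 t ∈ 𝓝[Set.Ici s] s := fun s hs =>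
      Filter.mem_of_superset (Icc_mem_nhdsGE hs.2) (Set.Icc_subset_Icc_left hs.1)
    have hi : ∀ s ∈ Set.Ico 0 t, s ∈ Set.Icc 0 t := fun s hs => Set.Ico_subset_Icc_self hs
    exact ODE_solution_unique_of_mem_Icc_right (v := fun _ => X) (s := fun _ => K)
      (fun _ _ => hC) hαc
      (fun s hs => (hα s (hi s hs)).2.mono_of_mem_nhdsWithin (hn s hs))
      (fun s hs => mα s (hi s hs)) hβc
      (fun s hs => (hβ s (hi s hs)).2.mono_of_mem_nhdsWithin (hn s hs))
      (fun s hs => mβ s (hi s hs)) h0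
  · rw [Set.uIcc_of_ge ht] at *
    have hn : ∀ s ∈ Set.Ioc t 0, Set.Icc t 0 ∈ 𝓝[Set.Iic s] s := fun s hs =>
      Filter.mem_of_superset (Icc_mem_nhdsLE hs.1) (Set.Icc_subset_Icc_right hs.2)
    have hi : ∀ s ∈ Set.Ioc t 0, s ∈ Set.Icc t 0 := fun s hs => Set.Ioc_subset_Icc_self hs
    exact ODE_solution_unique_of_mem_Icc_left (v := fun _ => X) (s := fun _ => K)
      (fun _ _ => hC) hαc
      (fun s hs => (hα s (hi s hs)).2.mono_of_mem_nhdsWithin (hn s hs))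
      (fun s hs => mα s (hi s hs)) hβc
      (fun s hs => (hβ s (hi s hs)).2.mono_of_mem_nhdsWithin (hn s hs))
      (fun s hs => mβ s (hi s hs)) h0

/-- Used to confine a whole trajectory, not only its endpoint, to an invariant level set. -/
theorem SymHamSystem.FlowTo.of_mem {G : Type} [Group G] {S : SymHamSystem E G} {t : ℝ} {γ : ℝ → E}
    (h : ∀ s ∈ Set.uIcc 0 t, γ s ∈ S.dom ∧
      ∃ v, HasDerivWithinAt γ v (Set.uIcc 0 t) s ∧ S.IsHamVec (γ s) v)
    {s : ℝ} (hs : s ∈ Set.uIcc 0 t) : S.FlowTo s (γ 0) (γ s) := by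
  have hsub : Set.uIcc 0 s ⊆ Set.uIcc 0 t := Set.uIcc_subset_uIcc_left hs
  refine ⟨γ, rfl, rfl, fun r hr => ?_⟩
  obtain ⟨h1, v, hv, hv'⟩ := h r (hsub hr)
  exact ⟨h1, v, hv.mono hsub, hv'⟩

variable [FiniteDimensional ℝ E]

/-- The form is a bare function of three arguments. As a family of continuous bilinear maps it can
be inverted and differentiated; finite dimension lets smoothness be tested on fixed vectors. Off `U`
the family is set to zero. -/
theorem IsSymplecticOn.exists_clm {Ω : E → E → E → ℝ} {U : Set E} (h : IsSymplecticOn Ω U) :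
    ∃ Φ : E → E →L[ℝ] E →L[ℝ] ℝ, (∀ x ∈ U, ∀ u v, Φ x u v = Ω x u v) ∧ ContDiffOn ℝ ∞ Φ U := by
  classical
  have hadd : ∀ x ∈ U, ∀ u u' v, Ω x (u + u') v = Ω x u v + Ω x u' v := fun x hx u u' v => by
    rw [h.antisymm x hx, (h.linear x hx v).map_add, h.antisymm x hx u, h.antisymm x hx u']; ring
  have hsmul : ∀ x ∈ U, ∀ (r : ℝ) u v, Ω x (r • u) v = r • Ω x u v := fun x hx r u v => by
    rw [h.antisymm x hx, (h.linear x hx v).map_smul, h.antisymm x hx u]; simp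
  let B : ∀ x ∈ U, E →ₗ[ℝ] E →ₗ[ℝ] ℝ := fun x hx =>
    LinearMap.mk₂ ℝ (Ω x) (hadd x hx) (hsmul x hx)
      (fun u => (h.linear x hx u).map_add) (fun r u => (h.linear x hx u).map_smul r)
  let T : (E →ₗ[ℝ] ℝ) →ₗ[ℝ] (E →L[ℝ] ℝ) := LinearMap.toContinuousLinearMap.toLinearMap
  let Φ : E → E →L[ℝ] E →L[ℝ] ℝ := fun x =>
    if hx : x ∈ U then LinearMap.toContinuousLinearMap (T ∘ₗ B x hx) else 0
  have hΦ : ∀ x ∈ U, ∀ u v, Φ x u v = Ω x u v := by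
    intro x hx u v
    simp only [Φ, dif_pos hx]
    rfl
  refine ⟨Φ, hΦ, ?_⟩
  rw [contDiffOn_clm_apply]
  intro u
  rw [contDiffOn_clm_apply]
  intro v
  exact (h.smooth u v).congr fun x hx => hΦ x hx u v

namespace SymHamSystem

variable {G : Type} [Group G]

/-- The Hamiltonian vector field exists, is unique and smooth. -/
theorem exists_hamVec {S : SymHamSystem E G} (hdom : IsOpen S.dom)
    (hΩ : IsSymplecticOn S.form S.dom) (hH : ContDiffOn ℝ ∞ S.ham S.dom) :
    ∃ X : E → E, ContDiffOn ℝ ∞ X S.dom ∧ ∀ x ∈ S.dom, ∀ v, S.IsHamVec x v ↔ v = X x := by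
  obtain ⟨Φ, hΦ, hΦs⟩ := hΩ.exists_clm
  have hfin : Module.finrank ℝ E = Module.finrank ℝ (E →L[ℝ] ℝ) := by
    rw [← (LinearMap.toContinuousLinearMap : (E →ₗ[ℝ] ℝ) ≃ₗ[ℝ] (E →L[ℝ] ℝ)).finrank_eq]
    exact (Subspace.dual_finrank_eq (K := ℝ) (V := E)).symm
  have hinj : ∀ x ∈ S.dom, Function.Injective (Φ x : E →ₗ[ℝ] E →L[ℝ] ℝ) := by
    intro x hx
    rw [injective_iff_map_eq_zero]
    intro u hu
    refine hΩ.nondegenerate x hx u fun v => ?_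
    rw [← hΦ x hx]
    exact DFunLike.congr_fun hu v
  have hequiv : ∀ x ∈ S.dom, ∃ e : E ≃L[ℝ] (E →L[ℝ] ℝ), (e : E →L[ℝ] E →L[ℝ] ℝ) = Φ x := by
    intro x hx
    refine ⟨(LinearEquiv.ofInjectiveOfFinrankEq _ (hinj x hx) hfin).toContinuousLinearEquiv, ?_⟩
    ext u v
    rfl
  -- `inverse` is total with default value zero; on `dom` it is a true inverse, by nondegeneracy and
  -- equality of dimensions, and inversion is smooth at invertible operators.
  refine ⟨fun x => (Φ x).inverse (fderiv ℝ S.ham x), ?_, ?_⟩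
  · intro x hx
    obtain ⟨e, he⟩ := hequiv x hx
    have h1 : ContDiffWithinAt ℝ ∞ (fun x => (Φ x).inverse) S.dom x := by
      have := contDiffAt_map_inverse (n := ∞) e
      rw [he] at this
      exact this.comp_contDiffWithinAt x (hΦs x hx)
    have h2 : ContDiffWithinAt ℝ ∞ (fderiv ℝ S.ham) S.dom x :=
      hH.fderiv_of_isOpen hdom (by simp) x hx
    exact h1.clm_apply h2
  · intro x hx v
    obtain ⟨e, he⟩ := hequiv x hx
    simp only
    rw [← he, ContinuousLinearMap.inverse_equiv]
    have : S.IsHamVec x v ↔ e v = fderiv ℝ S.ham x := by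
      have he' : ∀ w, S.form x v w = e v w := by
        intro w
        rw [← hΦ x hx, ← he]; rfl
      simp only [IsHamVec, he']
      exact DFunLike.ext_iff.symm
    rw [this]
    exact e.eq_symm_apply.symm

theorem FlowTo.unique {S : SymHamSystem E G} (hdom : IsOpen S.dom)
    (hΩ : IsSymplecticOn S.form S.dom) (hH : ContDiffOn ℝ ∞ S.ham S.dom) {t : ℝ} {x y z : E}
    (h : S.FlowTo t x y) (h' : S.FlowTo t x z) : y = z := by
  obtain ⟨X, hX, hX'⟩ := exists_hamVec hdom hΩ hH
  obtain ⟨α, hα0, rfl, hα⟩ := h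
  obtain ⟨β, hβ0, rfl, hβ⟩ := h'
  refine integralCurve_unique hdom (hX.of_le (by simp)) (hα0.trans hβ0.symm) ?_ ?_ Set.right_mem_uIcc
  · intro s hs
    obtain ⟨h1, v, hv, hv'⟩ := hα s hs
    exact ⟨h1, ((hX' _ h1 v).1 hv') ▸ hv⟩
  · intro s hs
    obtain ⟨h1, v, hv, hv'⟩ := hβ s hs
    exact ⟨h1, ((hX' _ h1 v).1 hv') ▸ hv⟩

end SymHamSystem

end Generic

namespace SymHamSystem

theorem act_one {E G : Type} [NormedAddCommGroup E] [NormedSpace ℝ E] [Group G]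
    (S : SymHamSystem E G) (x : E) : S.act 1 x = x := by rw [map_one]; rfl

theorem act_mul {E G : Type} [NormedAddCommGroup E] [NormedSpace ℝ E] [Group G]
    (S : SymHamSystem E G) (g k : G) (x : E) : S.act (g * k) x = S.act g (S.act k x) := by
  rw [map_mul]; rfl

theorem fderiv_act_one {E G : Type} [NormedAddCommGroup E] [NormedSpace ℝ E] [Group G]
    (S : SymHamSystem E G) (x u : E) : fderiv ℝ (S.act 1) x u = u := by
  have : S.act 1 = fun x => x := by funext x; exact S.act_one x
  rw [this]; simp

/-! ### Reduction by a symmetry group with momentum map. -/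

section Momentum

variable {E G 𝔤 F : Type} [NormedAddCommGroup E] [NormedSpace ℝ E] [Group G]
  [NormedAddCommGroup 𝔤] [NormedSpace ℝ 𝔤] [NormedAddCommGroup F] [NormedSpace ℝ F]

/-- The symmetries of `S` have the momentum map `φ`, with the infinitesimal action `ξ`, and the
level set of `S` is a level of `φ`. The group integrates time-dependent infinitesimal actions. -/
structure HasMomentum (S : SymHamSystem E G) (φ : E → F) (c : F) (ξ : E → 𝔤 →ₗ[ℝ] E)
    (b : 𝔤 →ₗ[ℝ] F →ₗ[ℝ] ℝ) : Prop where
  isOpen_dom : IsOpen S.dom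
  symplectic : IsSymplecticOn S.form S.dom
  ham_smooth : ContDiffOn ℝ ∞ S.ham S.dom
  level_eq : S.level = {x | x ∈ S.dom ∧ φ x = c}
  act_smooth : ∀ g, ContDiff ℝ ∞ (S.act g)
  act_dom : ∀ g, ∀ x ∈ S.dom, S.act g x ∈ S.dom
  act_level : ∀ g, ∀ x ∈ S.level, S.act g x ∈ S.level
  act_free : ∀ g, ∀ x ∈ S.level, S.act g x = x → g = 1
  act_form : ∀ g, ∀ x ∈ S.dom, ∀ u v,
    S.form (S.act g x) (fderiv ℝ (S.act g) x u) (fderiv ℝ (S.act g) x v) = S.form x u v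
  act_ham : ∀ g, ∀ x ∈ S.dom, S.ham (S.act g x) = S.ham x
  momentum_smooth : ContDiff ℝ ∞ φ
  pairing_surjective : Function.Surjective b
  form_infinitesimal : ∀ x ∈ S.dom, ∀ a v, S.form x (ξ x a) v = b a (fderiv ℝ φ x v)
  -- This is the equation `g⁻¹ g' = a`, expressed through the action because `G` carries no
  -- differentiable structure.
  integrate : ∀ a : ℝ → 𝔤, Continuous a → ∃ g : ℝ → G, g 0 = 1 ∧
    ∀ (γ : ℝ → E) (w : E) (I : Set ℝ) (s : ℝ), HasDerivWithinAt γ w I s →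
      HasDerivWithinAt (fun s => S.act (g s) (γ s))
        (fderiv ℝ (S.act (g s)) (γ s) (w + ξ (γ s) (a s))) I s
  orbit_tangent : ∀ x ∈ S.level, ∀ u ∈ tangentAt (S.orbit x) x, ∃ a, ξ x a = u
  -- A continuous left inverse of the generators: it gives their injectivity, and continuity of the
  -- coefficients of a continuous field of generators.
  coordinates : ∃ l : E × E → 𝔤, ContinuousOn l (S.dom ×ˢ Set.univ) ∧
    ∀ x ∈ S.dom, ∀ a, l (x, ξ x a) = a

namespace HasMomentum

variable {S : SymHamSystem E G} {φ : E → F} {c : F} {ξ : E → 𝔤 →ₗ[ℝ] E}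
    {b : 𝔤 →ₗ[ℝ] F →ₗ[ℝ] ℝ} (M : S.HasMomentum φ c ξ b)
include M

theorem level_subset : S.level ⊆ S.dom := by
  rw [M.level_eq]; exact fun x hx => hx.1

theorem exists_curve (x : E) (a : 𝔤) :
    ∃ g : ℝ → G, g 0 = 1 ∧ HasDerivAt (fun t => S.act (g t) x) (ξ x a) 0 := by
  obtain ⟨g, hg, h⟩ := M.integrate (fun _ => a) continuous_const
  refine ⟨g, hg, ?_⟩
  have := h (fun _ => x) 0 Set.univ 0 (hasDerivWithinAt_const _ _ _)
  rwa [hg, S.fderiv_act_one, zero_add, hasDerivWithinAt_univ] at this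

theorem ham_differentiableAt {x : E} (hx : x ∈ S.dom) : DifferentiableAt ℝ S.ham x :=
  (M.ham_smooth.contDiffAt (M.isOpen_dom.mem_nhds hx)).differentiableAt (by simp)

theorem fderiv_ham_infinitesimal {x : E} (hx : x ∈ S.dom) (a : 𝔤) :
    fderiv ℝ S.ham x (ξ x a) = 0 := by
  obtain ⟨g, hg, h⟩ := M.exists_curve x a
  have h0 : S.act (g 0) x = x := by rw [hg, S.act_one]
  have hH : HasFDerivAt S.ham (fderiv ℝ S.ham x) (S.act (g 0) x) := by
    rw [h0]; exact (M.ham_differentiableAt hx).hasFDerivAt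
  have h1 := hH.comp_hasDerivAt (0 : ℝ) h
  have h2 : S.ham ∘ (fun t => S.act (g t) x) = fun _ => S.ham x := by
    funext t; exact M.act_ham _ x hx
  rw [h2] at h1
  exact h1.unique (hasDerivAt_const _ _)

theorem infinitesimal_injective {x : E} (hx : x ∈ S.dom) : Function.Injective (ξ x) := by
  obtain ⟨l, -, hl⟩ := M.coordinates
  intro a a' h
  rw [← hl x hx a, h, hl x hx]

theorem infinitesimal_mem_tangentAt_orbit (x : E) (a : 𝔤) : ξ x a ∈ tangentAt (S.orbit x) x := by
  obtain ⟨g, hg, h⟩ := M.exists_curve x a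
  exact ⟨_, by simp only [hg, S.act_one], h, Filter.Eventually.of_forall fun t => ⟨g t, rfl⟩⟩

theorem fderiv_act_inv {x : E} (g : G) (u : E) :
    fderiv ℝ (S.act g) x (fderiv ℝ (S.act g⁻¹) (S.act g x) u) = u := by
  have hd : ∀ g y, DifferentiableAt ℝ (S.act g) y := fun g y =>
    ((M.act_smooth g).differentiable (by simp)) y
  have h1 : S.act g⁻¹ (S.act g x) = x := by rw [← S.act_mul, inv_mul_cancel, S.act_one]
  have h2 := fderiv_comp (S.act g x) (g := S.act g) (f := S.act g⁻¹) (hd _ _) (hd _ _)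
  have h3 : S.act g ∘ S.act g⁻¹ = fun y => y := by
    funext y
    show S.act g (S.act g⁻¹ y) = y
    rw [← S.act_mul, mul_inv_cancel, S.act_one]
  rw [h3, h1] at h2
  have := DFunLike.congr_fun h2 u
  simpa using this.symm

/-- The group maps Hamiltonian vectors to Hamiltonian vectors. -/
theorem isHamVec_act {x v : E} (hx : x ∈ S.dom) (g : G) (hv : S.IsHamVec x v) :
    S.IsHamVec (S.act g x) (fderiv ℝ (S.act g) x v) := by
  intro w
  have hd : DifferentiableAt ℝ (S.act g) x := ((M.act_smooth g).differentiable (by simp)) x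
  set w' := fderiv ℝ (S.act g⁻¹) (S.act g x) w
  have hw : fderiv ℝ (S.act g) x w' = w := M.fderiv_act_inv g w
  rw [← hw, M.act_form g x hx, hv]
  have h1 := fderiv_comp x (M.ham_differentiableAt (M.act_dom g x hx)) hd
  have h2 : S.ham ∘ S.act g =ᶠ[𝓝 x] S.ham :=
    Filter.eventually_of_mem (M.isOpen_dom.mem_nhds hx) fun y hy => M.act_ham g y hy
  rw [h2.fderiv_eq] at h1
  rw [h1]; rfl

theorem flowTo_act {t : ℝ} {x y : E} (g : G) (h : S.FlowTo t x y) :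
    S.FlowTo t (S.act g x) (S.act g y) := by
  obtain ⟨γ, rfl, rfl, h⟩ := h
  refine ⟨fun s => S.act g (γ s), rfl, rfl, fun s hs => ?_⟩
  obtain ⟨h1, v, hv, hv'⟩ := h s hs
  exact ⟨M.act_dom g _ h1, _,
    ((M.act_smooth g).differentiable (by simp) _).hasFDerivAt.comp_hasDerivWithinAt s hv,
    M.isHamVec_act h1 g hv'⟩

/-- A functional vanishing on the range has the form `b a`. Then `ξ x a` lies in the kernel of the
symplectic form, so it is zero, and so is `a`. -/
theorem range_fderiv_momentum {x : E} (hx : x ∈ S.dom) :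
    (fderiv ℝ φ x : E →ₗ[ℝ] F).range = ⊤ := by
  by_contra hne
  obtain ⟨ℓ, hℓ, hle⟩ := Submodule.exists_le_ker_of_lt_top _ (lt_top_iff_ne_top.2 hne)
  obtain ⟨a, rfl⟩ := M.pairing_surjective ℓ
  apply hℓ
  have : ξ x a = 0 := by
    refine M.symplectic.nondegenerate x hx _ fun v => ?_
    rw [M.form_infinitesimal x hx]
    exact hle (LinearMap.mem_range_self _ v)
  have : a = 0 := M.infinitesimal_injective hx (by rw [this, map_zero])
  rw [this, map_zero]

/-- The symplectic complement of the kernel of the derivative of the momentum map consists of the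
infinitesimal actions. -/
theorem orthogonal_iff [FiniteDimensional ℝ E] {x u : E} (hx : x ∈ S.dom) :
    (∀ v, fderiv ℝ φ x v = 0 → S.form x u v = 0) ↔ ∃ a, ξ x a = u := by
  constructor
  · intro h
    obtain ⟨Φ, hΦ, -⟩ := M.symplectic.exists_clm
    -- The annihilator of `ker dφ` is the range of the transpose of `dφ`. Since every functional on
    -- `F` is some `b a`, the vectors `u` and `ξ x a` have the same pairing with everything.
    have hmem : (Φ x u : E →ₗ[ℝ] ℝ) ∈
        (LinearMap.ker (fderiv ℝ φ x : E →ₗ[ℝ] F)).dualAnnihilator := by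
      rw [Submodule.mem_dualAnnihilator]
      intro v hv
      exact (hΦ x hx u v).trans (h v hv)
    rw [← LinearMap.range_dualMap_eq_dualAnnihilator_ker] at hmem
    obtain ⟨ℓ, hℓ⟩ := hmem
    obtain ⟨a, rfl⟩ := M.pairing_surjective ℓ
    refine ⟨a, ?_⟩
    rw [← sub_eq_zero]
    refine M.symplectic.nondegenerate x hx _ fun v => ?_
    rw [← hΦ x hx, map_sub, sub_apply, hΦ x hx, M.form_infinitesimal x hx]
    have := DFunLike.congr_fun hℓ v
    exact sub_eq_zero.2 this
  · rintro ⟨a, rfl⟩ v hv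
    rw [M.form_infinitesimal x hx, hv, map_zero]

variable [FiniteDimensional ℝ F]

/-- Noether's theorem: `b a (dφ v) = Ω (ξ x a) v = -dH (ξ x a) = 0`, and the functionals `b a`
separate the points of `F`. -/
theorem fderiv_momentum_hamVec {x v : E} (hx : x ∈ S.dom) (hv : S.IsHamVec x v) :
    fderiv ℝ φ x v = 0 := by
  refine (Module.forall_dual_apply_eq_zero_iff ℝ _).1 fun ℓ => ?_
  obtain ⟨a, rfl⟩ := M.pairing_surjective ℓ
  rw [← M.form_infinitesimal x hx, M.symplectic.antisymm x hx, hv, M.fderiv_ham_infinitesimal hx,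
    neg_zero]

theorem level_invariant {t : ℝ} {x y : E} (hx : x ∈ S.level) (h : S.FlowTo t x y) :
    y ∈ S.level := by
  obtain ⟨γ, rfl, rfl, h⟩ := h
  have hφ := M.momentum_smooth.differentiable (by simp)
  rw [M.level_eq] at hx ⊢
  refine ⟨(h t Set.right_mem_uIcc).1, ?_⟩
  rw [← hx.2]
  -- Along the trajectory `φ` is an integral curve of the zero field, hence equal to the constant
  -- one.
  refine integralCurve_unique (X := fun _ : F => 0) (U := Set.univ) isOpen_univ contDiffOn_const
    (α := φ ∘ γ) (β := fun _ => φ (γ 0)) rfl ?_ ?_ Set.right_mem_uIcc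
  · intro s hs
    obtain ⟨h1, v, hv, hv'⟩ := h s hs
    refine ⟨trivial, ?_⟩
    have := (hφ (γ s)).hasFDerivAt.comp_hasDerivWithinAt s hv
    rwa [M.fderiv_momentum_hamVec h1 hv'] at this
  · exact fun s _ => ⟨trivial, hasDerivWithinAt_const _ _ _⟩

variable [FiniteDimensional ℝ E]

theorem mem_tangentAt_level_iff {x v : E} (hx : x ∈ S.level) :
    v ∈ tangentAt S.level x ↔ fderiv ℝ φ x v = 0 := by
  have hd := M.level_subset hx
  have h := mem_tangentAt_level (v := v) M.isOpen_dom hd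
    (M.momentum_smooth.contDiffAt.hasStrictFDerivAt (by simp)) (M.range_fderiv_momentum hd)
  rw [← h]
  rw [M.level_eq] at hx ⊢
  rw [hx.2]

theorem fderiv_momentum_infinitesimal {x : E} (hx : x ∈ S.level) (a : 𝔤) :
    fderiv ℝ φ x (ξ x a) = 0 := by
  rw [← M.mem_tangentAt_level_iff hx]
  obtain ⟨γ, h0, hγ, hL⟩ := M.infinitesimal_mem_tangentAt_orbit x a
  refine ⟨γ, h0, hγ, hL.mono ?_⟩
  rintro t ⟨g, hg⟩
  rw [← hg]
  exact M.act_level g x hx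

theorem isReduction : S.IsReduction where
  isOpen_dom := M.isOpen_dom
  symplectic := M.symplectic
  ham_smooth := M.ham_smooth
  level_subset := M.level_subset
  act_smooth g := (M.act_smooth g).contDiffOn
  act_dom := M.act_dom
  act_level := M.act_level
  act_free := M.act_free
  act_form := M.act_form
  act_ham := M.act_ham
  level_invariant _ _ _ hx h := M.level_invariant hx h
  kernel x hx u hu := by
    simp only [M.mem_tangentAt_level_iff hx]
    rw [M.orthogonal_iff (M.level_subset hx)]
    refine ⟨?_, M.orbit_tangent x hx u⟩
    rintro ⟨a, rfl⟩
    exact M.infinitesimal_mem_tangentAt_orbit x a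
  -- The group takes trajectories to trajectories, so two lifts of one reduced initial point can be
  -- compared by uniqueness of the flow upstairs.
  redFlow_unique := by
    rintro t a b b' ⟨x, y, rfl, rfl, h⟩ ⟨x', y', hx, rfl, h'⟩
    obtain ⟨g, hg⟩ := Quotient.exact hx
    refine Quotient.sound ⟨g⁻¹, ?_⟩
    have h1 := M.flowTo_act g h'
    rw [hg] at h1
    rw [h.unique M.isOpen_dom M.symplectic M.ham_smooth h1, ← S.act_mul, inv_mul_cancel, S.act_one]
  redFlow_lift := by
    rintro t a b ⟨x, y, rfl, rfl, h⟩ x' hx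
    obtain ⟨g, hg⟩ := Quotient.exact hx
    have h1 := M.flowTo_act g⁻¹ h
    rw [← hg, ← S.act_mul, inv_mul_cancel, S.act_one] at h1
    exact ⟨⟨_, M.act_level g⁻¹ _ y.2⟩, Quotient.sound ⟨g, by
      show S.act g (S.act g⁻¹ y) = y
      rw [← S.act_mul, mul_inv_cancel, S.act_one]⟩, h1⟩

end HasMomentum

end Momentum

end SymHamSystem

namespace SymHamSystem

/-! ### Partially symplectic maps and conjugacy of reduced flows. -/

section Equivalence

variable {E₁ G₁ 𝔤₁ A₁ E₂ G₂ 𝔤₂ A₂ : Type}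
  [NormedAddCommGroup E₁] [NormedSpace ℝ E₁] [Group G₁]
  [NormedAddCommGroup 𝔤₁] [NormedSpace ℝ 𝔤₁] [NormedAddCommGroup A₁] [NormedSpace ℝ A₁]
  [NormedAddCommGroup E₂] [NormedSpace ℝ E₂] [Group G₂]
  [NormedAddCommGroup 𝔤₂] [NormedSpace ℝ 𝔤₂] [NormedAddCommGroup A₂] [NormedSpace ℝ A₂]
  [FiniteDimensional ℝ E₁] [FiniteDimensional ℝ A₁]
  [FiniteDimensional ℝ E₂] [FiniteDimensional ℝ A₂] [FiniteDimensional ℝ 𝔤₁]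
  [FiniteDimensional ℝ 𝔤₂]
  {S₁ : SymHamSystem E₁ G₁} {S₂ : SymHamSystem E₂ G₂} {F : E₁ → E₂} {F' : E₂ → E₁}
  {φ₁ : E₁ → A₁} {c₁ : A₁} {ξ₁ : E₁ → 𝔤₁ →ₗ[ℝ] E₁} {b₁ : 𝔤₁ →ₗ[ℝ] A₁ →ₗ[ℝ] ℝ}
  {φ₂ : E₂ → A₂} {c₂ : A₂} {ξ₂ : E₂ → 𝔤₂ →ₗ[ℝ] E₂} {b₂ : 𝔤₂ →ₗ[ℝ] A₂ →ₗ[ℝ] ℝ}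

open Module in
/-- If the reduced spaces have the same dimension, a partially symplectic map is, infinitesimally,
surjective modulo the group. -/
theorem PartiallySymplectic.exists_tangent (hF : PartiallySymplectic S₁ S₂ F)
    (M₁ : S₁.HasMomentum φ₁ c₁ ξ₁ b₁) (M₂ : S₂.HasMomentum φ₂ c₂ ξ₂ b₂)
    (hdim : finrank ℝ E₁ + finrank ℝ A₂ + finrank ℝ 𝔤₂ =
      finrank ℝ E₂ + finrank ℝ A₁ + finrank ℝ 𝔤₁) {x : E₁} (hx : x ∈ S₁.level) {z : E₂}
    (hz : fderiv ℝ φ₂ (F x) z = 0) :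
    ∃ u, fderiv ℝ φ₁ x u = 0 ∧ ∃ a, fderiv ℝ F x u + ξ₂ (F x) a = z := by
  have hd₁ := M₁.level_subset hx
  have hx₂ := hF.mapsTo x hx
  have hd₂ := M₂.level_subset hx₂
  have hFd : DifferentiableAt ℝ F x :=
    (hF.smooth.contDiffAt (M₁.isOpen_dom.mem_nhds hd₁)).differentiableAt (by simp)
  set T₁ := LinearMap.ker (fderiv ℝ φ₁ x : E₁ →ₗ[ℝ] A₁) with hT₁
  set T₂ := LinearMap.ker (fderiv ℝ φ₂ (F x) : E₂ →ₗ[ℝ] A₂) with hT₂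
  have hmap : ∀ u ∈ T₁, fderiv ℝ F x u ∈ T₂ := fun u hu =>
    (M₂.mem_tangentAt_level_iff hx₂).1
      (tangentAt_map hFd hF.mapsTo ((M₁.mem_tangentAt_level_iff hx).2 hu))
  have hform : ∀ u ∈ T₁, ∀ v ∈ T₁,
      S₂.form (F x) (fderiv ℝ F x u) (fderiv ℝ F x v) = S₁.form x u v := fun u hu v hv =>
    hF.form x hx u ((M₁.mem_tangentAt_level_iff hx).2 hu) v ((M₁.mem_tangentAt_level_iff hx).2 hv)
  -- If `(u, a)` is in the kernel, `dF u` is a generator of the second group, so it is orthogonal to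
  -- `dF T₁`. Then `u` is orthogonal to `T₁` and is a generator of the first group. The kernel
  -- therefore has dimension at most `dim 𝔤₁`, and `hdim` forces the range to be all of `T₂`.
  let L : T₁ × 𝔤₂ →ₗ[ℝ] E₂ := ((fderiv ℝ F x : E₁ →ₗ[ℝ] E₂) ∘ₗ T₁.subtype).coprod (ξ₂ (F x))
  have hL : ∀ p, L p = fderiv ℝ F x p.1 + ξ₂ (F x) p.2 := fun p => rfl
  have hLle : LinearMap.range L ≤ T₂ := by
    rintro _ ⟨p, rfl⟩
    rw [hL]
    exact T₂.add_mem (hmap _ p.1.2) (M₂.fderiv_momentum_infinitesimal hx₂ p.2)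
  let K : LinearMap.ker L →ₗ[ℝ] E₁ :=
    T₁.subtype ∘ₗ LinearMap.fst ℝ T₁ 𝔤₂ ∘ₗ (LinearMap.ker L).subtype
  have hK : ∀ p, K p = p.1.1 := fun p => rfl
  have hKinj : Function.Injective K := by
    rw [injective_iff_map_eq_zero]
    rintro ⟨⟨u, a⟩, hp⟩ h0
    have hu : u = 0 := Subtype.ext h0
    have : ξ₂ (F x) a = 0 := by
      have := hL (u, a)
      rw [LinearMap.mem_ker.1 hp, hu] at this
      simpa using this.symm
    have ha : a = 0 := M₂.infinitesimal_injective hd₂ (by rw [this, map_zero])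
    simp [hu, ha]
  have hKle : LinearMap.range K ≤ LinearMap.range (ξ₁ x) := by
    rintro _ ⟨⟨⟨u, a⟩, hp⟩, rfl⟩
    rw [hK]
    refine (M₁.orthogonal_iff hd₁).1 fun v hv => ?_
    have h1 := hL (u, a)
    rw [LinearMap.mem_ker.1 hp] at h1
    have h2 : fderiv ℝ F x u = ξ₂ (F x) (-a) := by
      rw [map_neg]; exact eq_neg_of_add_eq_zero_left h1.symm
    rw [← hform _ u.2 v hv, h2]
    exact (M₂.orthogonal_iff hd₂).2 ⟨_, rfl⟩ _ (hmap v hv)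
  have d1 := Submodule.finrank_mono hKle
  rw [LinearMap.finrank_range_of_inj hKinj,
    LinearMap.finrank_range_of_inj (M₁.infinitesimal_injective hd₁)] at d1
  have d2 := LinearMap.finrank_range_add_finrank_ker L
  have d3 := LinearMap.finrank_range_add_finrank_ker (fderiv ℝ φ₁ x : E₁ →ₗ[ℝ] A₁)
  have d4 := LinearMap.finrank_range_add_finrank_ker (fderiv ℝ φ₂ (F x) : E₂ →ₗ[ℝ] A₂)
  rw [M₁.range_fderiv_momentum hd₁, finrank_top] at d3
  rw [M₂.range_fderiv_momentum hd₂, finrank_top] at d4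
  rw [finrank_prod] at d2
  change _ + finrank ℝ T₁ = _ at d3
  change _ + finrank ℝ T₂ = _ at d4
  have hLeq : LinearMap.range L = T₂ := Submodule.eq_of_le_of_finrank_le hLle (by omega)
  have hz' : z ∈ LinearMap.range L := by rw [hLeq]; exact hz
  obtain ⟨p, hp⟩ := hz'
  exact ⟨p.1, p.1.2, p.2, by rw [← hp, hL]⟩

/-- A partially symplectic map takes Hamiltonian vectors to Hamiltonian vectors modulo the
group. -/
theorem PartiallySymplectic.hamVec_sub_mem (hF : PartiallySymplectic S₁ S₂ F)
    (M₁ : S₁.HasMomentum φ₁ c₁ ξ₁ b₁) (M₂ : S₂.HasMomentum φ₂ c₂ ξ₂ b₂)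
    (hdim : Module.finrank ℝ E₁ + Module.finrank ℝ A₂ + Module.finrank ℝ 𝔤₂ =
      Module.finrank ℝ E₂ + Module.finrank ℝ A₁ + Module.finrank ℝ 𝔤₁)
    (hH : ∀ x ∈ S₁.level, S₂.ham (F x) = S₁.ham x)
    {x v : E₁} {w : E₂} (hx : x ∈ S₁.level) (hv : S₁.IsHamVec x v)
    (hw : S₂.IsHamVec (F x) w) : ∃ a, ξ₂ (F x) a = fderiv ℝ F x v - w := by
  have hd₁ := M₁.level_subset hx
  have hx₂ := hF.mapsTo x hx
  have hd₂ := M₂.level_subset hx₂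
  have hFd : DifferentiableAt ℝ F x :=
    (hF.smooth.contDiffAt (M₁.isOpen_dom.mem_nhds hd₁)).differentiableAt (by simp)
  have hv₁ := (M₁.mem_tangentAt_level_iff hx).2 (M₁.fderiv_momentum_hamVec hd₁ hv)
  -- It suffices that the difference be orthogonal to `T₂`. Vectors there have the form `dF u + ξ₂
  -- a`, and both `dF v` and `w` pair with such a vector to `dH₁ u`.
  refine (M₂.orthogonal_iff hd₂).1 fun z hz => ?_
  obtain ⟨u, hu, a, rfl⟩ := hF.exists_tangent M₁ M₂ hdim hx hz
  have hu₁ := (M₁.mem_tangentAt_level_iff hx).2 hu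
  have hFv := (M₂.mem_tangentAt_level_iff hx₂).1 (tangentAt_map hFd hF.mapsTo hv₁)
  have e1 : S₂.form (F x) (fderiv ℝ F x v) (ξ₂ (F x) a) = 0 := by
    rw [M₂.symplectic.antisymm _ hd₂, (M₂.orthogonal_iff hd₂).2 ⟨a, rfl⟩ _ hFv, neg_zero]
  -- The two Hamiltonians are compared only on the level set, hence only their tangential
  -- derivatives agree.
  have e2 : fderiv ℝ S₂.ham (F x) (fderiv ℝ F x u) = fderiv ℝ S₁.ham x u := by
    have h := fderiv_comp x (M₂.ham_differentiableAt hd₂) hFd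
    rw [← fderiv_eq_of_tangentAt ((M₂.ham_differentiableAt hd₂).comp x hFd)
      (M₁.ham_differentiableAt hd₁) hH hu₁, h]
    rfl
  obtain ⟨Φ, hΦ, -⟩ := M₂.symplectic.exists_clm
  have e3 : S₂.form (F x) (fderiv ℝ F x v) (fderiv ℝ F x u + ξ₂ (F x) a) =
      S₂.form (F x) (fderiv ℝ F x v) (fderiv ℝ F x u) := by
    rw [(M₂.symplectic.linear _ hd₂ _).map_add, e1, add_zero]
  have e4 : S₂.form (F x) w (fderiv ℝ F x u + ξ₂ (F x) a) = fderiv ℝ S₁.ham x u := by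
    rw [hw, map_add, M₂.fderiv_ham_infinitesimal hd₂, add_zero, e2]
  rw [← hΦ _ hd₂, map_sub, sub_apply, hΦ _ hd₂, hΦ _ hd₂, e3, e4, hF.form x hx v hv₁ u hu₁, hv u,
    sub_self]

/-- Reconstruction: a partially symplectic map takes solutions to solutions modulo the group. -/
theorem PartiallySymplectic.flowTo_map (hF : PartiallySymplectic S₁ S₂ F)
    (M₁ : S₁.HasMomentum φ₁ c₁ ξ₁ b₁) (M₂ : S₂.HasMomentum φ₂ c₂ ξ₂ b₂)
    (hdim : Module.finrank ℝ E₁ + Module.finrank ℝ A₂ + Module.finrank ℝ 𝔤₂ =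
      Module.finrank ℝ E₂ + Module.finrank ℝ A₁ + Module.finrank ℝ 𝔤₁)
    (hH : ∀ x ∈ S₁.level, S₂.ham (F x) = S₁.ham x) {t : ℝ} {x y : E₁} (hx : x ∈ S₁.level)
    (h : S₁.FlowTo t x y) : ∃ g, S₂.FlowTo t (F x) (S₂.act g (F y)) := by
  obtain ⟨γ, rfl, rfl, h⟩ := h
  set I := Set.uIcc 0 t with hI
  have hγL : ∀ s ∈ I, γ s ∈ S₁.level := fun s hs =>
    M₁.level_invariant hx (FlowTo.of_mem h hs)
  have hγd : ∀ s ∈ I, γ s ∈ S₁.dom := fun s hs => M₁.level_subset (hγL s hs)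
  have hL₂ : ∀ s ∈ I, F (γ s) ∈ S₂.level := fun s hs => hF.mapsTo _ (hγL s hs)
  have hd₂ : ∀ s ∈ I, F (γ s) ∈ S₂.dom := fun s hs => M₂.level_subset (hL₂ s hs)
  obtain ⟨X₁, hX₁, hX₁'⟩ := exists_hamVec M₁.isOpen_dom M₁.symplectic M₁.ham_smooth
  obtain ⟨X₂, hX₂, hX₂'⟩ := exists_hamVec M₂.isOpen_dom M₂.symplectic M₂.ham_smooth
  have hFd : ∀ s ∈ I, DifferentiableAt ℝ F (γ s) := fun s hs =>
    (hF.smooth.contDiffAt (M₁.isOpen_dom.mem_nhds (hγd s hs))).differentiableAt (by simp)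
  have hγ : ∀ s ∈ I, HasDerivWithinAt γ (X₁ (γ s)) I s := by
    intro s hs
    obtain ⟨h1, v, hv, hv'⟩ := h s hs
    exact ((hX₁' _ h1 v).1 hv') ▸ hv
  have hγc : ContinuousOn γ I := fun s hs => (hγ s hs).continuousWithinAt
  have hFc : ContinuousOn (fun s => F (γ s)) I := hF.smooth.continuousOn.comp hγc hγd
  obtain ⟨l, hl, hl'⟩ := M₂.coordinates
  let d : ℝ → E₂ := fun s => fderiv ℝ F (γ s) (X₁ (γ s)) - X₂ (F (γ s))
  have hdc : ContinuousOn d I := by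
    refine ContinuousOn.sub (ContinuousOn.clm_apply ?_ (hX₁.continuousOn.comp hγc hγd))
      (hX₂.continuousOn.comp hFc hd₂)
    exact (hF.smooth.continuousOn_fderiv_of_isOpen M₁.isOpen_dom (by simp)).comp hγc hγd
  let a : ℝ → 𝔤₂ := fun s => l (F (γ s), d s)
  have hac : ContinuousOn a I :=
    hl.comp (hFc.prodMk hdc) fun s hs => ⟨hd₂ s hs, trivial⟩
  have ha : ∀ s ∈ I, ξ₂ (F (γ s)) (a s) = d s := by
    intro s hs
    obtain ⟨a', ha'⟩ := hF.hamVec_sub_mem M₁ M₂ hdim hH (hγL s hs)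
      ((hX₁' _ (hγd s hs) _).2 rfl) ((hX₂' _ (hd₂ s hs) _).2 rfl)
    have : a s = a' := by
      show l (F (γ s), fderiv ℝ F (γ s) (X₁ (γ s)) - X₂ (F (γ s))) = a'
      rw [← ha', hl' _ (hd₂ s hs)]
    rw [this, ha']
  -- Clamping the time to the interval extends the coefficient continuously to the whole line, as
  -- `integrate` requires.
  let κ : ℝ → ℝ := fun s => max (min 0 t) (min s (max 0 t))
  have hκ : ∀ s ∈ I, κ s = s := fun s hs => by
    show max _ (min _ _) = s
    rw [min_eq_left hs.2, max_eq_right hs.1]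
  have hκI : ∀ s, κ s ∈ I := fun s =>
    ⟨le_max_left _ _, max_le (min_le_max) (min_le_right _ _)⟩
  -- Driving `g` by `-a` cancels the drift of `F ∘ γ` along the orbits.
  obtain ⟨g, hg0, hg⟩ := M₂.integrate (fun s => -a (κ s))
    (hac.comp_continuous (by fun_prop) hκI).neg
  refine ⟨g t, fun s => S₂.act (g s) (F (γ s)), by simp only [hg0, S₂.act_one], rfl, fun s hs => ?_⟩
  refine ⟨M₂.act_dom _ _ (hd₂ s hs), _, hg _ _ I s
    ((hFd s hs).hasFDerivAt.comp_hasDerivWithinAt s (hγ s hs)), ?_⟩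
  have : fderiv ℝ F (γ s) (X₁ (γ s)) + ξ₂ (F (γ s)) (-a (κ s)) = X₂ (F (γ s)) := by
    rw [hκ s hs, map_neg, ha s hs]
    simp only [d]
    abel
  rw [this]
  exact M₂.isHamVec_act (hd₂ s hs) _ ((hX₂' _ (hd₂ s hs) _).2 rfl)

/-- Two reduced systems of the same dimension are equivalent if there are partially symplectic
maps between them which are inverse to each other modulo the groups and compatible with the
Hamiltonians. -/
theorem HasMomentum.equivalent (M₁ : S₁.HasMomentum φ₁ c₁ ξ₁ b₁)
    (M₂ : S₂.HasMomentum φ₂ c₂ ξ₂ b₂)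
    (hdim : Module.finrank ℝ E₁ + Module.finrank ℝ A₂ + Module.finrank ℝ 𝔤₂ =
      Module.finrank ℝ E₂ + Module.finrank ℝ A₁ + Module.finrank ℝ 𝔤₁)
    (hF : PartiallySymplectic S₁ S₂ F) (hF' : PartiallySymplectic S₂ S₁ F')
    (hH : ∀ x ∈ S₁.level, S₂.ham (F x) = S₁.ham x)
    (hinv : ∀ x ∈ S₁.level, ∃ g, S₁.act g (F' (F x)) = x)
    (hinv' : ∀ y ∈ S₂.level, ∃ g, S₂.act g (F (F' y)) = y) : S₁.Equivalent S₂ := by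
  have hH' : ∀ y ∈ S₂.level, S₁.ham (F' y) = S₂.ham y := by
    intro y hy
    obtain ⟨g, hg⟩ := hinv' y hy
    rw [← hH _ (hF'.mapsTo y hy),
      ← M₂.act_ham g _ (M₂.level_subset (hF.mapsTo _ (hF'.mapsTo y hy))), hg]
  let f : S₁.level → S₂.level := fun x => ⟨F x, hF.mapsTo x x.2⟩
  let f' : S₂.level → S₁.level := fun y => ⟨F' y, hF'.mapsTo y y.2⟩
  have hfc : Continuous f := Continuous.subtype_mk (continuousOn_iff_continuous_domRestrict.1
    (hF.smooth.continuousOn.mono M₁.level_subset)) _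
  have hfc' : Continuous f' := Continuous.subtype_mk (continuousOn_iff_continuous_domRestrict.1
    (hF'.smooth.continuousOn.mono M₂.level_subset)) _
  have hfr : ∀ x y : S₁.level, S₁.orbitSetoid x y → S₂.orbitSetoid (f x) (f y) := by
    rintro x y ⟨g, hg⟩
    obtain ⟨k, hk⟩ := hF.orbits x x.2 g
    refine ⟨k, ?_⟩
    rw [← hk, hg]
  have hfr' : ∀ x y : S₂.level, S₂.orbitSetoid x y → S₁.orbitSetoid (f' x) (f' y) := by
    rintro x y ⟨g, hg⟩
    obtain ⟨k, hk⟩ := hF'.orbits x x.2 g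
    refine ⟨k, ?_⟩
    rw [← hk, hg]
  let q : S₁.RedSpace → S₂.RedSpace := Quotient.map f hfr
  let q' : S₂.RedSpace → S₁.RedSpace := Quotient.map f' hfr'
  have hq'q : Function.LeftInverse q' q := by
    intro a
    induction a using Quotient.inductionOn with
    | h x => exact Quotient.sound (hinv x x.2)
  have hqq' : Function.RightInverse q' q := by
    intro a
    induction a using Quotient.inductionOn with
    | h x => exact Quotient.sound (hinv' x x.2)
  let e : S₁.RedSpace ≃ₜ S₂.RedSpace :=
    { toFun := q
      invFun := q'
      left_inv := hq'q
      right_inv := hqq'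
      continuous_toFun := hfc.quotient_map' hfr
      continuous_invFun := hfc'.quotient_map' hfr' }
  have hflow : ∀ t a b, S₁.RedFlow t a b → S₂.RedFlow t (q a) (q b) := by
    rintro t a b ⟨x, y, rfl, rfl, h⟩
    obtain ⟨g, hg⟩ := hF.flowTo_map M₁ M₂ hdim hH x.2 h
    refine ⟨f x, ⟨_, M₂.act_level g _ (f y).2⟩, rfl, Quotient.sound ⟨g⁻¹, ?_⟩, hg⟩
    show S₂.act g⁻¹ (S₂.act g (F y)) = F y
    rw [← S₂.act_mul, inv_mul_cancel, S₂.act_one]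
  have hflow' : ∀ t a b, S₂.RedFlow t a b → S₁.RedFlow t (q' a) (q' b) := by
    rintro t a b ⟨x, y, rfl, rfl, h⟩
    obtain ⟨g, hg⟩ := hF'.flowTo_map M₂ M₁ hdim.symm hH' x.2 h
    refine ⟨f' x, ⟨_, M₁.act_level g _ (f' y).2⟩, rfl, Quotient.sound ⟨g⁻¹, ?_⟩, hg⟩
    show S₁.act g⁻¹ (S₁.act g (F' y)) = F' y
    rw [← S₁.act_mul, inv_mul_cancel, S₁.act_one]
  refine ⟨F, F', hF, hF', e, fun _ => rfl, fun _ => rfl, hH, hH', fun t a b => ⟨hflow t a b, ?_⟩⟩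
  intro h
  have := hflow' _ _ _ h
  rwa [show q' (e a) = a from hq'q a, show q' (e b) = b from hq'q b] at this

end Equivalence

end SymHamSystem

/-! ### Algebra of the pairing and of the mass metric. -/

section Algebra

theorem pairing_add_left (P P' Q : C3) : pairing (P + P') Q = pairing P Q + pairing P' Q := by
  simp only [pairing, ← Finset.sum_add_distrib, Pi.add_apply, map_add, add_mul]

theorem pairing_add_right (P Q Q' : C3) : pairing P (Q + Q') = pairing P Q + pairing P Q' := by
  simp only [pairing, ← Finset.sum_add_distrib, Pi.add_apply, mul_add]

theorem pairing_smul_left (k : ℂ) (P Q : C3) : pairing (k • P) Q = conj k * pairing P Q := by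
  simp only [pairing, Finset.mul_sum, Pi.smul_apply, smul_eq_mul, map_mul, mul_assoc]

theorem pairing_smul_right (k : ℂ) (P Q : C3) : pairing P (k • Q) = k * pairing P Q := by
  simp only [pairing, Finset.mul_sum, Pi.smul_apply, smul_eq_mul]
  exact Finset.sum_congr rfl fun i _ => by ring

theorem real_smul_eq (r : ℝ) (P : C3) : r • P = (r : ℂ) • P := by
  funext i
  simp

theorem pairing_real_smul_left (r : ℝ) (P Q : C3) : pairing (r • P) Q = r * pairing P Q := by
  rw [real_smul_eq, pairing_smul_left, Complex.conj_ofReal]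

theorem pairing_real_smul_right (r : ℝ) (P Q : C3) : pairing P (r • Q) = r * pairing P Q := by
  rw [real_smul_eq, pairing_smul_right]

theorem pairing_conj (P Q : C3) : conj (pairing P Q) = pairing Q P := by
  simp only [pairing, map_sum, map_mul, Complex.conj_conj, mul_comm]

theorem pairing_neg_left (P Q : C3) : pairing (-P) Q = -pairing P Q := by
  simp [pairing]

theorem pairing_zero_left (Q : C3) : pairing 0 Q = 0 := by simp [pairing]

theorem pairing_zero_right (P : C3) : pairing P 0 = 0 := by simp [pairing]

theorem pairing_const_left (c : ℂ) (Q : C3) :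
    pairing (fun _ => c) Q = conj c * ∑ i, Q i := by
  simp only [pairing, Finset.mul_sum]

theorem pairing_const_right (c : ℂ) (P : C3) :
    pairing P (fun _ => c) = c * conj (∑ i, P i) := by
  simp only [pairing, Finset.mul_sum, map_sum, mul_comm]

/-- The real part of the pairing is nondegenerate. -/
theorem eq_zero_of_re_pairing {P : C3} (h : ∀ Q, (pairing P Q).re = 0) : P = 0 := by
  have h1 := h P
  simp only [pairing, Complex.re_sum, Complex.mul_re, Complex.conj_re, Complex.conj_im] at h1
  have h2 : ∀ i, (P i).re * (P i).re - -(P i).im * (P i).im = Complex.normSq (P i) := fun i => by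
    rw [Complex.normSq_apply]; ring
  simp only [h2] at h1
  rw [Finset.sum_eq_zero_iff_of_nonneg fun i _ => Complex.normSq_nonneg _] at h1
  funext i
  exact Complex.normSq_eq_zero.1 (h1 i (Finset.mem_univ i))

variable (m : Fin 3 → ℝ)

theorem pairing_dual (X V : C3) : pairing (dualCovector m X) V = massMetric m X V := by
  simp only [pairing, dualCovector, massMetric, map_mul, Complex.conj_ofReal, mul_assoc]

theorem dualCovector_smul (k : ℂ) (X : C3) :
    dualCovector m (k • X) = k • dualCovector m X := by
  funext i
  simp only [dualCovector, Pi.smul_apply, smul_eq_mul]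
  ring

theorem dualCovector_real_smul (r : ℝ) (X : C3) :
    dualCovector m (r • X) = r • dualCovector m X := by
  rw [real_smul_eq, dualCovector_smul, ← real_smul_eq]

theorem massMetric_add_right (X V V' : C3) :
    massMetric m X (V + V') = massMetric m X V + massMetric m X V' := by
  simp only [← pairing_dual, pairing_add_right]

theorem massMetric_smul_left (k : ℂ) (X V : C3) :
    massMetric m (k • X) V = conj k * massMetric m X V := by
  simp only [← pairing_dual, dualCovector_smul, pairing_smul_left]

theorem massMetric_smul_right (k : ℂ) (X V : C3) :
    massMetric m X (k • V) = k * massMetric m X V := by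
  simp only [← pairing_dual, pairing_smul_right]

theorem massMetric_conj (X V : C3) : conj (massMetric m X V) = massMetric m V X := by
  simp only [massMetric, map_sum, map_mul, Complex.conj_conj, Complex.conj_ofReal]
  exact Finset.sum_congr rfl fun i _ => by ring

theorem massMetric_re_comm (X V : C3) : (massMetric m X V).re = (massMetric m V X).re := by
  rw [← massMetric_conj, Complex.conj_re]

theorem massMetric_im_comm (X V : C3) : (massMetric m X V).im = -(massMetric m V X).im := by
  rw [← massMetric_conj, Complex.conj_im]

theorem massMetric_self_im (X : C3) : (massMetric m X X).im = 0 := by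
  have := massMetric_im_comm m X X
  linarith

theorem massMetric_self (X : C3) : massMetric m X X = ((massMetric m X X).re : ℝ) :=
  Complex.ext rfl (massMetric_self_im m X)

theorem massMetric_self_re (X : C3) :
    (massMetric m X X).re = ∑ i, pairMass m i / totalMass m * ‖X i‖ ^ 2 := by
  simp only [massMetric, Complex.re_sum, Complex.re_ofReal_mul]
  refine Finset.sum_congr rfl fun i _ => ?_
  rw [← Complex.normSq_eq_norm_sq, ← Complex.normSq_eq_conj_mul_self, Complex.ofReal_re]

variable {m} (hm : ∀ i, 0 < m i)
include hm

theorem totalMass_pos : 0 < totalMass m := Finset.sum_pos (fun i _ => hm i) Finset.univ_nonempty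

theorem pairMass_pos (i : Fin 3) : 0 < pairMass m i := by
  fin_cases i
  exacts [mul_pos (hm 0) (hm 1), mul_pos (hm 2) (hm 0), mul_pos (hm 1) (hm 2)]

theorem massMetric_self_nonneg (X : C3) : 0 ≤ (massMetric m X X).re := by
  rw [massMetric_self_re]
  exact Finset.sum_nonneg fun i _ =>
    mul_nonneg (div_pos (pairMass_pos hm i) (totalMass_pos hm)).le (sq_nonneg _)

theorem massMetric_self_pos {X : C3} (hX : X 0 ≠ 0) : 0 < (massMetric m X X).re := by
  rw [massMetric_self_re]
  refine Finset.sum_pos' (fun i _ =>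
    mul_nonneg (div_pos (pairMass_pos hm i) (totalMass_pos hm)).le (sq_nonneg _))
    ⟨0, Finset.mem_univ _, mul_pos (div_pos (pairMass_pos hm 0) (totalMass_pos hm)) ?_⟩
  positivity

theorem massNorm_sq (X : C3) : massNorm m X ^ 2 = (massMetric m X X).re :=
  Real.sq_sqrt (massMetric_self_nonneg hm X)

theorem massMetric_self_eq (X : C3) : massMetric m X X = ((massNorm m X ^ 2 : ℝ) : ℂ) := by
  rw [massNorm_sq hm, ← massMetric_self]

theorem massNorm_pos {X : C3} (hX : X 0 ≠ 0) : 0 < massNorm m X :=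
  Real.sqrt_pos.2 (massMetric_self_pos hm hX)

omit hm in
theorem massNorm_smul (k : ℂ) (X : C3) : massNorm m (k • X) = ‖k‖ * massNorm m X := by
  have h : (massMetric m (k • X) (k • X)).re = ‖k‖ ^ 2 * (massMetric m X X).re := by
    rw [massMetric_smul_left, massMetric_smul_right, ← mul_assoc,
      ← Complex.normSq_eq_conj_mul_self, Complex.normSq_eq_norm_sq, Complex.re_ofReal_mul]
  rw [massNorm, h, Real.sqrt_mul (sq_nonneg _), Real.sqrt_sq (norm_nonneg _)]
  rfl

end Algebra

/-! ### Derivatives of the pairing, the metric and the norm. -/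

section Calculus

/-- Reduces Fréchet derivatives to one-variable calculus along a line, differentiability being known
separately. -/
theorem fderiv_eq_of_line {E E' : Type} [NormedAddCommGroup E] [NormedSpace ℝ E]
    [NormedAddCommGroup E'] [NormedSpace ℝ E'] {f : E → E'} {x u : E} {c : E'}
    (hf : DifferentiableAt ℝ f x) (h : HasDerivAt (fun t : ℝ => f (x + t • u)) c 0) :
    fderiv ℝ f x u = c := by
  have hl : HasDerivAt (fun t : ℝ => x + t • u) u 0 := by
    simpa using ((hasDerivAt_id (0 : ℝ)).smul_const u).const_add x
  have hf' : HasFDerivAt f (fderiv ℝ f x) ((fun t : ℝ => x + t • u) 0) := by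
    simpa using hf.hasFDerivAt
  exact (hf'.comp_hasDerivAt (0 : ℝ) hl).unique h

theorem hasDerivAt_line {E : Type} [NormedAddCommGroup E] [NormedSpace ℝ E] (x u : E) (t : ℝ) :
    HasDerivAt (fun t : ℝ => x + t • u) u t := by
  simpa using ((hasDerivAt_id t).smul_const u).const_add x

theorem contDiff_conj : ContDiff ℝ ∞ (fun z : ℂ => conj z) := Complex.conjCLE.contDiff

theorem contDiff_pairing : ContDiff ℝ ∞ (fun x : C3 × C3 => pairing x.1 x.2) := by
  unfold pairing
  refine ContDiff.sum fun i _ => ContDiff.mul ?_ ?_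
  · exact contDiff_conj.comp (by fun_prop)
  · fun_prop

theorem hasDerivAt_pairing {P Q : ℝ → C3} {P' Q' : C3} {t : ℝ} (hP : HasDerivAt P P' t)
    (hQ : HasDerivAt Q Q' t) :
    HasDerivAt (fun t => pairing (P t) (Q t)) (pairing P' (Q t) + pairing (P t) Q') t := by
  simp only [pairing, ← Finset.sum_add_distrib]
  refine HasDerivAt.fun_sum fun i _ => ?_
  have h1 := (hasDerivAt_pi.1 hP i).star
  exact h1.mul (hasDerivAt_pi.1 hQ i)

variable (m : Fin 3 → ℝ)

theorem contDiff_dualCovector : ContDiff ℝ ∞ (dualCovector m) := by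
  unfold dualCovector
  fun_prop

theorem hasDerivAt_dualCovector {X : ℝ → C3} {V : C3} {t : ℝ} (hX : HasDerivAt X V t) :
    HasDerivAt (fun t => dualCovector m (X t)) (dualCovector m V) t := by
  rw [hasDerivAt_pi]
  exact fun i => (hasDerivAt_pi.1 hX i).const_mul _

theorem contDiff_massMetric : ContDiff ℝ ∞ (fun x : C3 × C3 => massMetric m x.1 x.2) := by
  simp only [← pairing_dual]
  exact contDiff_pairing.comp
    (((contDiff_dualCovector m).comp contDiff_fst).prodMk contDiff_snd)

theorem hasDerivAt_massMetric {X Y : ℝ → C3} {V W : C3} {t : ℝ} (hX : HasDerivAt X V t)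
    (hY : HasDerivAt Y W t) :
    HasDerivAt (fun t => massMetric m (X t) (Y t))
      (massMetric m V (Y t) + massMetric m (X t) W) t := by
  simp only [← pairing_dual]
  exact hasDerivAt_pairing (hasDerivAt_dualCovector m hX) hY

theorem hasDerivAt_re {f : ℝ → ℂ} {f' : ℂ} {t : ℝ} (h : HasDerivAt f f' t) :
    HasDerivAt (fun t => (f t).re) f'.re t :=
  Complex.reCLM.hasFDerivAt.comp_hasDerivAt t h

theorem hasDerivAt_im {f : ℝ → ℂ} {f' : ℂ} {t : ℝ} (h : HasDerivAt f f' t) :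
    HasDerivAt (fun t => (f t).im) f'.im t :=
  Complex.imCLM.hasFDerivAt.comp_hasDerivAt t h

theorem hasDerivAt_massMetric_self {X : ℝ → C3} {V : C3} {t : ℝ} (hX : HasDerivAt X V t) :
    HasDerivAt (fun t => (massMetric m (X t) (X t)).re) (2 * (massMetric m (X t) V).re) t := by
  convert hasDerivAt_re (hasDerivAt_massMetric m hX hX) using 1
  rw [Complex.add_re, massMetric_re_comm m V]
  ring

variable {m} (hm : ∀ i, 0 < m i)
include hm

theorem hasDerivAt_massNorm {X : ℝ → C3} {V : C3} {t : ℝ} (hX : HasDerivAt X V t)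
    (h0 : X t 0 ≠ 0) :
    HasDerivAt (fun t => massNorm m (X t)) ((massMetric m (X t) V).re / massNorm m (X t)) t := by
  have h := (hasDerivAt_massMetric_self m hX).sqrt (massMetric_self_pos hm h0).ne'
  rwa [mul_div_mul_left _ _ two_ne_zero] at h

theorem contDiffAt_massNorm {X : C3} (h0 : X 0 ≠ 0) : ContDiffAt ℝ ∞ (massNorm m) X := by
  have h : ContDiff ℝ ∞ (fun X : C3 => massMetric m X X) :=
    (contDiff_massMetric m).comp (f := fun X : C3 => (X, X)) (contDiff_id.prodMk contDiff_id)
  have h' : ContDiff ℝ ∞ (fun X : C3 => (massMetric m X X).re) := Complex.reCLM.contDiff.comp h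
  exact h'.contDiffAt.sqrt (massMetric_self_pos hm h0).ne'

end Calculus

/-! ### The standard and the Fubini–Study form. -/

section Forms

theorem isSymplecticOn_stdForm (U : Set (C3 × C3)) : IsSymplecticOn stdForm U where
  linear x _ u := by
    constructor
    · intro v w
      simp only [stdForm, Prod.fst_add, Prod.snd_add, pairing_add_left, pairing_add_right,
        Complex.add_re]
      ring
    · intro r v
      simp only [stdForm, Prod.smul_fst, Prod.smul_snd, pairing_real_smul_left,
        pairing_real_smul_right, Complex.re_ofReal_mul, smul_eq_mul]
      ring
  antisymm x _ u v := by simp only [stdForm]; ring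
  smooth u v := contDiffOn_const
  closed x _ u v w := by simp [stdForm]
  nondegenerate x _ u h := by
    have h1 : u.1 = 0 := by
      refine eq_zero_of_re_pairing fun P => ?_
      have := h (0, P)
      simp only [stdForm, pairing_zero_right, Complex.zero_re, sub_zero] at this
      rw [← pairing_conj, Complex.conj_re, this]
    have h2 : u.2 = 0 := by
      refine eq_zero_of_re_pairing fun Q => ?_
      have := h (Q, 0)
      simpa only [stdForm, pairing_zero_left, Complex.zero_re, zero_sub, neg_eq_zero] using this
    exact Prod.ext h1 h2

variable (m : Fin 3 → ℝ)

/-- Separating real and imaginary parts turns the properties of the form into real rational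
identities with a power of `|X|²` as the only denominator. -/
theorem fubiniStudyForm_eq (X V W : C3) : fubiniStudyForm m X V W =
    ((massMetric m V W).im * (massMetric m X X).re
      - (massMetric m X V).re * (massMetric m X W).im
      + (massMetric m X V).im * (massMetric m X W).re) / (massMetric m X X).re ^ 2 := by
  rw [fubiniStudyForm, fubiniStudy, massMetric_self, ← Complex.ofReal_pow, Complex.div_ofReal_im,
    ← massMetric_conj m X V]
  congr 1
  simp only [Complex.sub_im, Complex.mul_im, Complex.ofReal_re, Complex.ofReal_im, Complex.conj_re,
    Complex.conj_im]
  ring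

theorem hasDerivAt_fubiniStudyForm {X U V W : C3} (hX : (massMetric m X X).re ≠ 0) :
    HasDerivAt (fun t : ℝ => fubiniStudyForm m (X + t • U) V W)
      ((((massMetric m V W).im * (2 * (massMetric m X U).re)
        - ((massMetric m U V).re * (massMetric m X W).im
          + (massMetric m X V).re * (massMetric m U W).im)
        + ((massMetric m U V).im * (massMetric m X W).re
          + (massMetric m X V).im * (massMetric m U W).re)) * (massMetric m X X).re ^ 2
        - ((massMetric m V W).im * (massMetric m X X).re
          - (massMetric m X V).re * (massMetric m X W).im
          + (massMetric m X V).im * (massMetric m X W).re)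
          * (2 * (massMetric m X X).re * (2 * (massMetric m X U).re)))
        / ((massMetric m X X).re ^ 2) ^ 2) 0 := by
  simp only [fubiniStudyForm_eq]
  have hl := hasDerivAt_line X U 0
  have h0 : X + (0 : ℝ) • U = X := by simp
  have hn : HasDerivAt (fun t : ℝ => (massMetric m (X + t • U) (X + t • U)).re)
      (2 * (massMetric m X U).re) 0 := by
    simpa [h0] using hasDerivAt_massMetric_self m hl
  have hre : ∀ V : C3, HasDerivAt (fun t : ℝ => (massMetric m (X + t • U) V).re)
      (massMetric m U V).re 0 := fun V => by
    simpa [← pairing_dual, pairing_zero_right] using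
      hasDerivAt_re (hasDerivAt_massMetric m hl (hasDerivAt_const 0 V))
  have him : ∀ V : C3, HasDerivAt (fun t : ℝ => (massMetric m (X + t • U) V).im)
      (massMetric m U V).im 0 := fun V => by
    simpa [← pairing_dual, pairing_zero_right] using
      hasDerivAt_im (hasDerivAt_massMetric m hl (hasDerivAt_const 0 V))
  have := (((hn.const_mul (massMetric m V W).im).fun_sub ((hre V).fun_mul (him W))).fun_add
    ((him V).fun_mul (hre W))).fun_div (hn.fun_pow 2) (by simpa [h0] using hX)
  refine this.congr_deriv ?_
  simp

end Forms

/-! ### The twisted form and the momentum shift. -/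

section TwistedForm

variable {m : Fin 3 → ℝ} (μ : ℝ)

theorem isOpen_radialDom : IsOpen radialDom := by
  have : radialDom = {x | 0 < x.1} ∩ ⋂ i, {x : RadialPhase | x.2.2.1 i ≠ 0} := by
    ext x; simp [radialDom]
  rw [this]
  refine (isOpen_lt continuous_const continuous_fst).inter (isOpen_iInter_of_finite fun i => ?_)
  exact isOpen_ne_fun (by fun_prop) continuous_const

section
variable (hm : ∀ i, 0 < m i)
include hm

theorem contDiffAt_fubiniStudyForm {X : C3} (h0 : X 0 ≠ 0) (V W : C3) :
    ContDiffAt ℝ ∞ (fun X => fubiniStudyForm m X V W) X := by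
  have h : ContDiff ℝ ∞ (fun X : C3 => massMetric m X X) :=
    (contDiff_massMetric m).comp (f := fun X : C3 => (X, X)) (contDiff_id.prodMk contDiff_id)
  have hn : ContDiff ℝ ∞ (fun X : C3 => (massMetric m X X).re) := Complex.reCLM.contDiff.comp h
  have h1 : ∀ V : C3, ContDiff ℝ ∞ (fun X : C3 => massMetric m X V) := fun V =>
    (contDiff_massMetric m).comp (f := fun X : C3 => (X, V)) (contDiff_id.prodMk contDiff_const)
  have hre : ∀ V : C3, ContDiff ℝ ∞ (fun X : C3 => (massMetric m X V).re) := fun V =>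
    Complex.reCLM.contDiff.comp (h1 V)
  have him : ∀ V : C3, ContDiff ℝ ∞ (fun X : C3 => (massMetric m X V).im) := fun V =>
    Complex.imCLM.contDiff.comp (h1 V)
  simp only [fubiniStudyForm_eq]
  exact (((contDiff_const.mul hn).sub ((hre V).mul (him W))).add
    ((him V).mul (hre W))).contDiffAt.div (hn.pow 2).contDiffAt
    (pow_ne_zero 2 (massMetric_self_pos hm h0).ne')

theorem fderiv_twistedForm {x : RadialPhase} (hx : x ∈ radialDom) (u v w : RadialPhase) :
    fderiv ℝ (fun y => twistedForm m μ y v w) x u =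
      -(2 * μ * fderiv ℝ (fun X => fubiniStudyForm m X v.2.2.1 w.2.2.1) x.2.2.1 u.2.2.1) := by
  have hd := (contDiffAt_fubiniStudyForm hm (hx.2 0) v.2.2.1 w.2.2.1).differentiableAt (by simp)
  let π : RadialPhase →L[ℝ] C3 := ContinuousLinearMap.fst ℝ C3 C3 ∘L
    ContinuousLinearMap.snd ℝ ℝ (C3 × C3) ∘L ContinuousLinearMap.snd ℝ ℝ (ℝ × C3 × C3)
  have h1 : HasFDerivAt (fun y : RadialPhase => fubiniStudyForm m y.2.2.1 v.2.2.1 w.2.2.1)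
      ((fderiv ℝ (fun X => fubiniStudyForm m X v.2.2.1 w.2.2.1) x.2.2.1).comp π) x :=
    HasFDerivAt.comp x (f := π) hd.hasFDerivAt π.hasFDerivAt
  have h2 : HasFDerivAt (fun y : RadialPhase => twistedForm m μ y v w) _ x :=
    (h1.const_mul (2 * μ)).const_sub (stdFormRadial 0 v w)
  rw [h2.fderiv]
  rfl

theorem isSymplecticOn_twistedForm : IsSymplecticOn (twistedForm m μ) radialDom where
  linear x _ u := by
    constructor
    · intro v w
      simp only [twistedForm, stdFormRadial, fubiniStudyForm_eq, Prod.fst_add, Prod.snd_add,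
        pairing_add_left, pairing_add_right, massMetric_add_right, Complex.add_re, Complex.add_im]
      ring
    · intro r v
      simp only [twistedForm, stdFormRadial, fubiniStudyForm_eq, Prod.smul_fst, Prod.smul_snd,
        real_smul_eq, massMetric_smul_right,
        Complex.re_ofReal_mul, Complex.im_ofReal_mul, smul_eq_mul]
      rw [pairing_smul_left, pairing_smul_right, Complex.conj_ofReal, Complex.re_ofReal_mul,
        Complex.re_ofReal_mul]
      ring
  antisymm x _ u v := by
    simp only [twistedForm, stdFormRadial, fubiniStudyForm_eq,
      massMetric_im_comm m v.2.2.1 u.2.2.1]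
    ring
  smooth u v := by
    intro x hx
    refine ContDiffAt.contDiffWithinAt ?_
    exact contDiffAt_const.sub (contDiffAt_const.mul
      (ContDiffAt.comp x (f := fun y : RadialPhase => y.2.2.1)
        (contDiffAt_fubiniStudyForm hm (hx.2 0) _ _) (by fun_prop)))
  closed x hx u v w := by
    have key : ∀ u v w : C3, fderiv ℝ (fun X => fubiniStudyForm m X v w) x.2.2.1 u = _ :=
      fun u v w => fderiv_eq_of_line
        ((contDiffAt_fubiniStudyForm hm (hx.2 0) v w).differentiableAt (by simp))
        (hasDerivAt_fubiniStudyForm m (massMetric_self_pos hm (hx.2 0)).ne')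
    simp only [fderiv_twistedForm μ hm hx, key]
    have hn := (massMetric_self_pos hm (hx.2 0)).ne'
    generalize (massMetric m x.2.2.1 x.2.2.1).re = n at *
    -- Hermitian symmetry brings all pairings of `u`, `v`, `w` to a fixed order; then the cyclic sum
    -- cancels identically.
    rw [massMetric_im_comm m v.2.2.1 u.2.2.1, massMetric_im_comm m w.2.2.1 v.2.2.1,
      massMetric_im_comm m u.2.2.1 w.2.2.1, massMetric_im_comm m w.2.2.1 u.2.2.1,
      massMetric_re_comm m v.2.2.1 u.2.2.1, massMetric_re_comm m w.2.2.1 v.2.2.1,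
      massMetric_re_comm m w.2.2.1 u.2.2.1]
    field_simp
    ring
  nondegenerate x _ u h := by
    -- Test vectors in the `Z` direction do not see the twist and force the `X` component of `u` to
    -- vanish. The twist then drops out, leaving the standard form.
    have h1 : u.2.2.1 = 0 := by
      refine eq_zero_of_re_pairing fun P => ?_
      have := h (0, 0, 0, P)
      simp only [twistedForm, stdFormRadial, fubiniStudyForm_eq, pairing_zero_right,
        ← pairing_dual, Complex.zero_re, Complex.zero_im] at this
      rw [← pairing_conj, Complex.conj_re]
      simpa using this
    have hF : ∀ v, twistedForm m μ x u v = stdFormRadial x u v := by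
      intro v
      have h0 : massMetric m (0 : C3) v.2.2.1 = 0 := by simp [massMetric]
      simp only [twistedForm, fubiniStudyForm_eq, h1, ← pairing_dual, pairing_zero_right]
      rw [pairing_dual, h0]
      simp
    simp only [hF] at h
    have h2 : u.2.2.2 = 0 := by
      refine eq_zero_of_re_pairing fun Q => ?_
      have := h (0, 0, Q, 0)
      simpa [stdFormRadial, pairing_zero_left] using this
    have h3 : u.1 = 0 := by
      have := h (0, 1, 0, 0)
      simpa [stdFormRadial, pairing_zero_left, pairing_zero_right] using this
    have h4 : u.2.1 = 0 := by
      have := h (1, 0, 0, 0)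
      simpa [stdFormRadial, pairing_zero_left, pairing_zero_right] using this
    exact Prod.ext h3 (Prod.ext h4 (Prod.ext h1 h2))

theorem contDiffAt_momentumShift {x : RadialPhase} (h0 : x.2.2.1 0 ≠ 0) :
    ContDiffAt ℝ ∞ (momentumShift m μ) x := by
  have hX : ContDiffAt ℝ ∞ (fun y : RadialPhase => y.2.2.1) x := by fun_prop
  have hn : ContDiffAt ℝ ∞ (fun y : RadialPhase => massNorm m y.2.2.1) x :=
    ContDiffAt.comp x (g := massNorm m) (contDiffAt_massNorm hm h0) hX
  have hs : ContDiffAt ℝ ∞ (fun y : RadialPhase =>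
      (((μ / massNorm m y.2.2.1 ^ 2 : ℝ) : ℂ) * Complex.I)) x :=
    (Complex.ofRealCLM.contDiff.contDiffAt.comp x
      (contDiffAt_const.div (hn.pow 2) (pow_ne_zero 2 (massNorm_pos hm h0).ne'))).mul
      contDiffAt_const
  have hd : ContDiffAt ℝ ∞ (fun y : RadialPhase => dualCovector m y.2.2.1) x :=
    ContDiffAt.comp x (contDiff_dualCovector m).contDiffAt hX
  have hZ : ContDiffAt ℝ ∞ (fun y : RadialPhase => y.2.2.2) x := by fun_prop
  exact contDiffAt_fst.prodMk (ContDiffAt.prodMk (by fun_prop)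
    (hX.prodMk (hZ.add (hs.smul hd))))

theorem fderiv_momentumShift {x : RadialPhase} (h0 : x.2.2.1 0 ≠ 0) (u : RadialPhase) :
    fderiv ℝ (momentumShift m μ) x u = (u.1, u.2.1, u.2.2.1, u.2.2.2 +
      (((μ / massNorm m x.2.2.1 ^ 2 : ℝ) * Complex.I) • dualCovector m u.2.2.1 +
      ((-(2 * μ * (massMetric m x.2.2.1 u.2.2.1).re / massNorm m x.2.2.1 ^ 4) : ℝ) * Complex.I) •
        dualCovector m x.2.2.1)) := by
  refine fderiv_eq_of_line ((contDiffAt_momentumShift μ hm h0).differentiableAt (by simp)) ?_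
  have hX := hasDerivAt_line x.2.2.1 u.2.2.1 0
  have e0 : x.2.2.1 + (0 : ℝ) • u.2.2.1 = x.2.2.1 := by simp
  have hpos := massNorm_pos hm h0
  have hn := hasDerivAt_massNorm hm hX (by rw [e0]; exact h0)
  have hs := (((hasDerivAt_const (0 : ℝ) μ).fun_div (hn.fun_pow 2)
    (by rw [e0]; exact pow_ne_zero 2 hpos.ne')).ofReal_comp.mul_const Complex.I)
  have := (hasDerivAt_line x.1 u.1 0).prodMk ((hasDerivAt_line x.2.1 u.2.1 0).prodMk
    (hX.prodMk ((hasDerivAt_line x.2.2.2 u.2.2.2 0).fun_add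
      (hs.fun_smul (hasDerivAt_dualCovector m hX)))))
  refine this.congr_deriv ?_
  simp only [e0, Prod.mk.injEq, true_and]
  congr 4
  push_cast
  have : (massNorm m x.2.2.1 : ℂ) ≠ 0 := by exact_mod_cast hpos.ne'
  field_simp
  simp

/-- The twisted form is the pull-back of the standard form under the momentum shift. -/
theorem stdFormRadial_momentumShift {x : RadialPhase} (h0 : x.2.2.1 0 ≠ 0) (u v : RadialPhase) :
    stdFormRadial (momentumShift m μ x) (fderiv ℝ (momentumShift m μ) x u)
      (fderiv ℝ (momentumShift m μ) x v) = twistedForm m μ x u v := by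
  -- The differential of `Im⟨X, dX⟩ / |X|²` is twice the Fubini–Study form; it enters with a minus
  -- sign because the standard form is minus the differential of the canonical one-form.
  rw [fderiv_momentumShift μ hm h0, fderiv_momentumShift μ hm h0]
  have hpos := (massNorm_pos hm h0).ne'
  simp only [twistedForm, stdFormRadial, fubiniStudyForm_eq, pairing_add_left, pairing_smul_left,
    pairing_dual, ← massNorm_sq hm, massMetric_im_comm m v.2.2.1 u.2.2.1,
    Complex.add_re, Complex.mul_re, Complex.mul_im, map_mul, Complex.conj_I, Complex.conj_ofReal,
    Complex.neg_re, Complex.neg_im, Complex.I_re, Complex.I_im, Complex.ofReal_re,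
    Complex.ofReal_im]
  field_simp
  ring

end

end TwistedForm

/-! ### Real pairings on parameter spaces, and invariants of orbits. -/

section Auxiliary

/-- The real pairing of `ℂ` with itself given by multiplication. -/
def rePairing : ℂ →ₗ[ℝ] ℂ →ₗ[ℝ] ℝ :=
  LinearMap.mk₂ ℝ (fun a z => (a * z).re) (fun a b z => by simp [add_mul])
    (fun r a z => by simp [mul_assoc, mul_sub]) (fun a z w => by simp [mul_add])
    (fun r a z => by
      simp only [Complex.real_smul, smul_eq_mul]
      rw [mul_left_comm, Complex.re_ofReal_mul])

theorem rePairing_apply (a z : ℂ) : rePairing a z = (a * z).re := rfl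

theorem rePairing_surjective : Function.Surjective rePairing := by
  intro ℓ
  refine ⟨⟨ℓ 1, -ℓ Complex.I⟩, LinearMap.ext fun z => ?_⟩
  have hz : z = z.re • (1 : ℂ) + z.im • Complex.I := by
    simp
  conv_rhs => rw [hz, map_add, map_smul, map_smul]
  rw [rePairing_apply, Complex.mul_re]
  simp only [smul_eq_mul]
  ring

/-- The conjugate pairing of `ℂ` with itself. -/
def conjPairing : ℂ →ₗ[ℝ] ℂ →ₗ[ℝ] ℝ := rePairing ∘ₗ Complex.conjAe.toLinearMap

theorem conjPairing_apply (a z : ℂ) : conjPairing a z = (conj a * z).re := rfl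

theorem conjPairing_surjective : Function.Surjective conjPairing :=
  rePairing_surjective.comp Complex.conjAe.surjective

/-- The sum of two pairings. -/
def sumPairing {V V' W W' : Type} [AddCommGroup V] [Module ℝ V] [AddCommGroup V'] [Module ℝ V']
    [AddCommGroup W] [Module ℝ W] [AddCommGroup W'] [Module ℝ W'] (b : V →ₗ[ℝ] W →ₗ[ℝ] ℝ)
    (b' : V' →ₗ[ℝ] W' →ₗ[ℝ] ℝ) : V × V' →ₗ[ℝ] W × W' →ₗ[ℝ] ℝ :=
  LinearMap.mk₂ ℝ (fun a z => b a.1 z.1 + b' a.2 z.2)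
    (fun a c z => by simp only [Prod.fst_add, Prod.snd_add, map_add, LinearMap.add_apply]; ring)
    (fun r a z => by simp [mul_add])
    (fun a z w => by simp only [Prod.fst_add, Prod.snd_add, map_add]; ring)
    (fun r a z => by simp [mul_add])

theorem sumPairing_apply {V V' W W' : Type} [AddCommGroup V] [Module ℝ V] [AddCommGroup V']
    [Module ℝ V'] [AddCommGroup W] [Module ℝ W] [AddCommGroup W'] [Module ℝ W']
    (b : V →ₗ[ℝ] W →ₗ[ℝ] ℝ) (b' : V' →ₗ[ℝ] W' →ₗ[ℝ] ℝ) (a : V × V') (z : W × W') :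
    sumPairing b b' a z = b a.1 z.1 + b' a.2 z.2 := rfl

theorem sumPairing_surjective {V V' W W' : Type} [AddCommGroup V] [Module ℝ V] [AddCommGroup V']
    [Module ℝ V'] [AddCommGroup W] [Module ℝ W] [AddCommGroup W'] [Module ℝ W']
    {b : V →ₗ[ℝ] W →ₗ[ℝ] ℝ} {b' : V' →ₗ[ℝ] W' →ₗ[ℝ] ℝ} (h : Function.Surjective b)
    (h' : Function.Surjective b') : Function.Surjective (sumPairing b b') := by
  intro ℓ
  obtain ⟨a, ha⟩ := h (ℓ ∘ₗ LinearMap.inl ℝ W W')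
  obtain ⟨a', ha'⟩ := h' (ℓ ∘ₗ LinearMap.inr ℝ W W')
  refine ⟨(a, a'), LinearMap.ext fun z => ?_⟩
  rw [sumPairing_apply, ha, ha']
  simp only [LinearMap.comp_apply, ← map_add]
  simp

/-- Each function constant on an orbit yields a linear equation for its tangent vectors. No
differentiability of the group parameter along the curve is needed. -/
theorem eq_zero_of_tangentAt {E E' : Type} [NormedAddCommGroup E] [NormedSpace ℝ E]
    [NormedAddCommGroup E'] [NormedSpace ℝ E'] {f : E → E'} {L : Set E} {x v : E} {c : E'}
    (hf : DifferentiableAt ℝ f x) (hL : ∀ y ∈ L, f y = f x) (hv : v ∈ tangentAt L x)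
    (h : HasDerivAt (fun t : ℝ => f (x + t • v)) c 0) : c = 0 := by
  rw [← fderiv_eq_of_line hf h,
    fderiv_eq_of_tangentAt hf (differentiableAt_const (f x)) hL hv]
  simp

theorem hasDerivAt_line_coord (X V : C3) (i : Fin 3) (t : ℝ) :
    HasDerivAt (fun t : ℝ => (X + t • V) i) (V i) t :=
  hasDerivAt_pi.1 (hasDerivAt_line X V t) i

end Auxiliary

/-! ### Complex scalings and translations of the momenta. -/

section Scale

theorem contDiff_scaleTrans (g : ScaleTrans) : ContDiff ℝ ∞ (ScaleTrans.act g) := by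
  show ContDiff ℝ ∞ (fun x : RadialPhase => (x.1, x.2.1, (g.k : ℂ) • x.2.2.1,
    (conj (g.k : ℂ))⁻¹ • x.2.2.2 + fun _ => g.c))
  fun_prop

theorem fderiv_scaleTrans (g : ScaleTrans) (x u : RadialPhase) :
    fderiv ℝ (ScaleTrans.act g) x u = scaleAct g.k u := by
  refine fderiv_eq_of_line ((contDiff_scaleTrans g).differentiable (by simp) x) ?_
  have : (fun t : ℝ => ScaleTrans.act g (x + t • u)) =
      fun t : ℝ => ScaleTrans.act g x + t • scaleAct g.k u := by
    funext t
    refine Prod.ext rfl (Prod.ext rfl (Prod.ext ?_ ?_))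
    · show (g.k : ℂ) • (x.2.2.1 + t • u.2.2.1) = (g.k : ℂ) • x.2.2.1 + t • (g.k : ℂ) • u.2.2.1
      rw [smul_add, smul_comm]
    · show (conj (g.k : ℂ))⁻¹ • (x.2.2.2 + t • u.2.2.2) + (fun _ => g.c) =
        (conj (g.k : ℂ))⁻¹ • x.2.2.2 + (fun _ => g.c) + t • (conj (g.k : ℂ))⁻¹ • u.2.2.2
      rw [smul_add, smul_comm]
      abel
  rw [this]
  exact hasDerivAt_line _ _ _

theorem scaleAct_eq (k : ℂˣ) : scaleAct k = ScaleTrans.act ⟨k, 0⟩ := by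
  funext x
  refine Prod.ext rfl (Prod.ext rfl (Prod.ext rfl ?_))
  show (conj (k : ℂ))⁻¹ • x.2.2.2 = (conj (k : ℂ))⁻¹ • x.2.2.2 + 0
  rw [add_zero]

theorem scaleTrans_mem_radialDom (g : ScaleTrans) {x : RadialPhase} (hx : x ∈ radialDom) :
    ScaleTrans.act g x ∈ radialDom :=
  ⟨hx.1, fun i => mul_ne_zero g.k.ne_zero (hx.2 i)⟩

theorem pairing_scaleAct (k : ℂˣ) (Z X : C3) :
    pairing ((conj (k : ℂ))⁻¹ • Z) ((k : ℂ) • X) = pairing Z X := by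
  rw [pairing_smul_left, pairing_smul_right, map_inv₀, Complex.conj_conj, ← mul_assoc,
    inv_mul_cancel₀ k.ne_zero, one_mul]

/-- Vectors and covectors scale inversely, so the standard part is invariant; in the Fubini–Study
part numerator and denominator both acquire `|k|⁴`. -/
theorem twistedForm_scaleAct (m : Fin 3 → ℝ) (μ : ℝ) (g : ScaleTrans) (x u v : RadialPhase) :
    twistedForm m μ (ScaleTrans.act g x) (scaleAct g.k u) (scaleAct g.k v) =
      twistedForm m μ x u v := by
  have h1 : stdFormRadial (ScaleTrans.act g x) (scaleAct g.k u) (scaleAct g.k v) =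
      stdFormRadial x u v := by
    show u.1 * v.2.1 - u.2.1 * v.1 + ((pairing ((conj (g.k : ℂ))⁻¹ • v.2.2.2)
      ((g.k : ℂ) • u.2.2.1)).re - (pairing ((conj (g.k : ℂ))⁻¹ • u.2.2.2)
      ((g.k : ℂ) • v.2.2.1)).re) = _
    rw [pairing_scaleAct, pairing_scaleAct]
    rfl
  have h2 : ∀ X V W : C3, fubiniStudyForm m ((g.k : ℂ) • X) ((g.k : ℂ) • V) ((g.k : ℂ) • W) =
      fubiniStudyForm m X V W := by
    intro X V W
    have hk : conj (g.k : ℂ) ≠ 0 := by simp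
    have hk' := g.k.ne_zero
    unfold fubiniStudyForm fubiniStudy
    congr 1
    simp only [massMetric_smul_left, massMetric_smul_right]
    rw [← mul_div_mul_left _ (massMetric m X X ^ 2)
      (mul_ne_zero (pow_ne_zero 2 hk) (pow_ne_zero 2 hk'))]
    congr 1 <;> ring
  have h3 := h2 x.2.2.1 u.2.2.1 v.2.2.1
  unfold twistedForm
  rw [h1, ← h3]
  rfl

/-- The infinitesimal action of complex scalings and translations. -/
def scaleTransInf (x : RadialPhase) : ℂ × ℂ →ₗ[ℝ] RadialPhase where
  toFun a := (0, 0, a.1 • x.2.2.1, -(conj a.1 • x.2.2.2) + fun _ => a.2)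
  map_add' a b := by
    refine Prod.ext (by simp) (Prod.ext (by simp) (Prod.ext ?_ ?_))
    · simp [add_smul]
    · funext i
      simp only [Prod.fst_add, Prod.snd_add, map_add, add_smul, Pi.add_apply, Pi.neg_apply]
      ring
  map_smul' r a := by
    refine Prod.ext (by simp) (Prod.ext (by simp) (Prod.ext ?_ ?_))
    · funext i
      simp [mul_assoc]
    · funext i
      simp [mul_assoc]

/-- The infinitesimal action of complex scalings. -/
def scaleInf (x : RadialPhase) : ℂ →ₗ[ℝ] RadialPhase := scaleTransInf x ∘ₗ LinearMap.inl ℝ ℂ ℂ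

theorem scaleTransInf_apply (x : RadialPhase) (a : ℂ × ℂ) :
    scaleTransInf x a = (0, 0, a.1 • x.2.2.1, -(conj a.1 • x.2.2.2) + fun _ => a.2) := rfl

theorem hasDerivAt_integral {V : Type} [NormedAddCommGroup V] [NormedSpace ℝ V] [CompleteSpace V]
    {f : ℝ → V} (hf : Continuous f) (s : ℝ) :
    HasDerivAt (fun s => ∫ r in (0 : ℝ)..s, f r) (f s) s :=
  intervalIntegral.integral_hasDerivAt_right (hf.intervalIntegrable _ _)
    (hf.stronglyMeasurableAtFilter _ _) hf.continuousAt

/-- The hypotheses on `k` and `c` say that the path in the semidirect product has left logarithmic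
derivative `a`. -/
theorem hasDerivWithinAt_scaleTrans {k : ℝ → ℂˣ} {c : ℝ → ℂ} {a : ℂ × ℂ} {γ : ℝ → RadialPhase}
    {w : RadialPhase} {I : Set ℝ} {s : ℝ}
    (hk : HasDerivAt (fun s => (k s : ℂ)) (k s * a.1) s)
    (hc : HasDerivAt c ((conj (k s : ℂ))⁻¹ * a.2) s) (hγ : HasDerivWithinAt γ w I s) :
    HasDerivWithinAt (fun s => ScaleTrans.act ⟨k s, c s⟩ (γ s))
      (fderiv ℝ (ScaleTrans.act ⟨k s, c s⟩) (γ s) (w + scaleTransInf (γ s) a)) I s := by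
  rw [fderiv_scaleTrans]
  have h1 := (ContinuousLinearMap.fst ℝ ℝ (ℝ × C3 × C3)).hasFDerivAt.comp_hasDerivWithinAt s hγ
  have h2 := (ContinuousLinearMap.snd ℝ ℝ (ℝ × C3 × C3)).hasFDerivAt.comp_hasDerivWithinAt s hγ
  have h3 := (ContinuousLinearMap.fst ℝ ℝ (C3 × C3)).hasFDerivAt.comp_hasDerivWithinAt s h2
  have h4 := (ContinuousLinearMap.snd ℝ ℝ (C3 × C3)).hasFDerivAt.comp_hasDerivWithinAt s h2
  have h5 := (ContinuousLinearMap.fst ℝ C3 C3).hasFDerivAt.comp_hasDerivWithinAt s h4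
  have h6 := (ContinuousLinearMap.snd ℝ C3 C3).hasFDerivAt.comp_hasDerivWithinAt s h4
  have hki := (hk.star.fun_inv (star_ne_zero.2 (k s).ne_zero))
  have hc' : HasDerivAt (fun s => (fun _ => c s : C3)) (fun _ => (conj (k s : ℂ))⁻¹ * a.2) s :=
    hasDerivAt_pi.2 fun _ => hc
  have := h1.prodMk (h3.prodMk ((hk.hasDerivWithinAt.fun_smul h5).prodMk
    ((hki.hasDerivWithinAt.fun_smul h6).fun_add hc'.hasDerivWithinAt)))
  refine this.congr_deriv ?_
  refine Prod.ext ?_ (Prod.ext ?_ (Prod.ext ?_ ?_))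
  · exact (add_zero _).symm
  · exact (add_zero _).symm
  · funext i
    show (k s : ℂ) * w.2.2.1 i + (k s * a.1) * (γ s).2.2.1 i =
      (k s : ℂ) * (w.2.2.1 i + a.1 * (γ s).2.2.1 i)
    ring
  · funext i
    show (conj (k s : ℂ))⁻¹ * w.2.2.2 i +
      -(conj (k s * a.1)) / (conj (k s : ℂ)) ^ 2 * (γ s).2.2.2 i + (conj (k s : ℂ))⁻¹ * a.2 =
      (conj (k s : ℂ))⁻¹ * (w.2.2.2 i + (-(conj a.1 * (γ s).2.2.2 i) + a.2))
    have hk0 : conj (k s : ℂ) ≠ 0 := by simp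
    rw [map_mul]
    field_simp
    ring

/-- The group `ℂˣ` is commutative, so the exponential of an integral solves the time-dependent
equation. -/
theorem exists_scaling {a : ℝ → ℂ} (ha : Continuous a) :
    ∃ k : ℝ → ℂˣ, k 0 = 1 ∧ Continuous (fun s => (k s : ℂ)) ∧
      ∀ s, HasDerivAt (fun s => (k s : ℂ)) (k s * a s) s := by
  refine ⟨fun s => Units.mk0 (Complex.exp (∫ r in (0 : ℝ)..s, a r)) (Complex.exp_ne_zero _), ?_⟩
  have h : ∀ s, HasDerivAt (fun s => Complex.exp (∫ r in (0 : ℝ)..s, a r))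
      (Complex.exp (∫ r in (0 : ℝ)..s, a r) * a s) s := fun s => (hasDerivAt_integral ha s).cexp
  exact ⟨Units.ext (by simp), continuous_iff_continuousAt.2 fun s => (h s).continuousAt, h⟩

theorem scaleTrans_orbit_tangent {x u : RadialPhase} (hx : x ∈ radialDom)
    (hu : u ∈ tangentAt (Set.range fun g => ScaleTrans.act g x) x) :
    ∃ a, scaleTransInf x a = u := by
  have h0 := hx.2 0
  have h1 : u.1 = 0 := by
    refine eq_zero_of_tangentAt (f := fun y : RadialPhase => y.1) (by fun_prop) ?_ hu
      (hasDerivAt_line x.1 u.1 0)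
    rintro _ ⟨g, rfl⟩; rfl
  have h2 : u.2.1 = 0 := by
    refine eq_zero_of_tangentAt (f := fun y : RadialPhase => y.2.1) (by fun_prop) ?_ hu
      (hasDerivAt_line x.2.1 u.2.1 0)
    rintro _ ⟨g, rfl⟩; rfl
  -- Two families of orbit invariants suffice: the ratios of the components of `X`, and `conj X₀ (Zᵢ
  -- - Z₀)`, where the scaling cancels and the translation drops out.
  have h3 : ∀ i, u.2.2.1 i * x.2.2.1 0 - u.2.2.1 0 * x.2.2.1 i = 0 := by
    intro i
    refine eq_zero_of_tangentAt
      (f := fun y : RadialPhase => y.2.2.1 i * x.2.2.1 0 - y.2.2.1 0 * x.2.2.1 i)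
      (by fun_prop) ?_ hu
      (((hasDerivAt_line_coord x.2.2.1 u.2.2.1 i 0).mul_const _).fun_sub
        ((hasDerivAt_line_coord x.2.2.1 u.2.2.1 0 0).mul_const _))
    rintro _ ⟨g, rfl⟩
    show (g.k : ℂ) * x.2.2.1 i * x.2.2.1 0 - (g.k : ℂ) * x.2.2.1 0 * x.2.2.1 i = _
    ring
  have h4 : ∀ i, conj (u.2.2.1 0) * (x.2.2.2 i - x.2.2.2 0) +
      conj (x.2.2.1 0) * (u.2.2.2 i - u.2.2.2 0) = 0 := by
    intro i
    have hd := (hasDerivAt_line_coord x.2.2.1 u.2.2.1 0 0).star.fun_mul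
      ((hasDerivAt_line_coord x.2.2.2 u.2.2.2 i 0).fun_sub
        (hasDerivAt_line_coord x.2.2.2 u.2.2.2 0 0))
    refine eq_zero_of_tangentAt
      (f := fun y : RadialPhase => star (y.2.2.1 0) * (y.2.2.2 i - y.2.2.2 0)) ?_ ?_ hu
      (hd.congr_deriv (by simp))
    · refine DifferentiableAt.mul ?_ (by fun_prop)
      exact (Complex.conjCLE.differentiableAt).comp x (by fun_prop)
    · rintro _ ⟨g, rfl⟩
      show conj ((g.k : ℂ) * x.2.2.1 0) * ((conj (g.k : ℂ))⁻¹ * x.2.2.2 i + g.c -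
        ((conj (g.k : ℂ))⁻¹ * x.2.2.2 0 + g.c)) = conj (x.2.2.1 0) * _
      have hk0 : conj (g.k : ℂ) ≠ 0 := by simp
      rw [map_mul]
      field_simp
      ring
  refine ⟨(u.2.2.1 0 / x.2.2.1 0, u.2.2.2 0 + conj (u.2.2.1 0 / x.2.2.1 0) * x.2.2.2 0), ?_⟩
  rw [scaleTransInf_apply]
  refine Prod.ext h1.symm (Prod.ext h2.symm (Prod.ext ?_ ?_))
  · funext i
    show u.2.2.1 0 / x.2.2.1 0 * x.2.2.1 i = u.2.2.1 i
    field_simp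
    linear_combination -h3 i
  · funext i
    show -(conj (u.2.2.1 0 / x.2.2.1 0) * x.2.2.2 i) + (u.2.2.2 0 +
      conj (u.2.2.1 0 / x.2.2.1 0) * x.2.2.2 0) = u.2.2.2 i
    have hk0 : conj (x.2.2.1 0) ≠ 0 := by simpa using h0
    rw [map_div₀]
    field_simp
    linear_combination -h4 i

variable {m : Fin 3 → ℝ} {μ : ℝ} (hm : ∀ i, 0 < m i)

theorem fderiv_pairing (x v : RadialPhase) :
    fderiv ℝ (fun x : RadialPhase => pairing x.2.2.2 x.2.2.1) x v =
      pairing v.2.2.2 x.2.2.1 + pairing x.2.2.2 v.2.2.1 := by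
  have hs : ContDiff ℝ ∞ (fun x : RadialPhase => pairing x.2.2.2 x.2.2.1) :=
    contDiff_pairing.comp (f := fun x : RadialPhase => (x.2.2.2, x.2.2.1)) (by fun_prop)
  refine fderiv_eq_of_line (hs.differentiable (by simp) x) ?_
  simpa using hasDerivAt_pairing (hasDerivAt_line x.2.2.2 v.2.2.2 0)
    (hasDerivAt_line x.2.2.1 v.2.2.1 0)

/-- Generators move `X` within its complex line, which the Fubini–Study form annihilates. The twist
therefore leaves the momenta `⟨Z, X⟩` and `∑ X` unchanged. -/
theorem twistedForm_scaleTransInf (x : RadialPhase) (a : ℂ × ℂ)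
    (v : RadialPhase) : twistedForm m μ x (scaleTransInf x a) v =
      (a.1 * (pairing v.2.2.2 x.2.2.1 + pairing x.2.2.2 v.2.2.1)).re -
        (conj a.2 * ∑ i, v.2.2.1 i).re := by
  have hF : fubiniStudyForm m x.2.2.1 (a.1 • x.2.2.1) v.2.2.1 = 0 := by
    unfold fubiniStudyForm fubiniStudy
    rw [massMetric_smul_left, massMetric_smul_left]
    convert Complex.zero_im
    rw [div_eq_zero_iff]
    left
    ring
  rw [scaleTransInf_apply]
  simp only [twistedForm, stdFormRadial]
  rw [hF, pairing_add_left, pairing_neg_left, pairing_smul_left, pairing_smul_right,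
    pairing_const_left, Complex.conj_conj]
  simp only [zero_mul, sub_zero, mul_add, Complex.add_re, Complex.neg_re]
  ring

include hm

/-- The sign of `conjPairing` arises because translations move `Z`, whose contribution to the form
is negative. Invariance of `h` is required on the whole domain, since Noether's argument runs off
the level as well. -/
theorem shapeSystem_hasMomentum {h : RadialPhase → ℝ} (hs : ContDiffOn ℝ ∞ h radialDom)
    (hinv : ∀ g, ∀ x ∈ radialDom, h (ScaleTrans.act g x) = h x) :
    (shapeSystem m μ h).HasMomentum
      (fun x : RadialPhase => (pairing x.2.2.2 x.2.2.1, ∑ i, x.2.2.1 i)) (0, 0) scaleTransInf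
      (sumPairing rePairing (-conjPairing)) where
  isOpen_dom := isOpen_radialDom
  symplectic := isSymplecticOn_twistedForm μ hm
  ham_smooth := hs
  level_eq := by
    ext x
    show _ ∧ _ ∧ _ ↔ _ ∧ _ = _
    rw [Prod.mk.injEq]
    exact Iff.rfl
  act_smooth := contDiff_scaleTrans
  act_dom g x hx := scaleTrans_mem_radialDom g hx
  act_level := by
    rintro g x ⟨hx, h1, h2⟩
    have h3 : ∑ i, ((g.k : ℂ) • x.2.2.1) i = 0 := by
      simp only [Pi.smul_apply, ← Finset.smul_sum, h2, smul_zero]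
    refine ⟨scaleTrans_mem_radialDom g hx, ?_, h3⟩
    show pairing ((conj (g.k : ℂ))⁻¹ • x.2.2.2 + fun _ => g.c) ((g.k : ℂ) • x.2.2.1) = 0
    rw [pairing_add_left, pairing_scaleAct, pairing_const_left, h1, h3, mul_zero, add_zero]
  act_free := by
    rintro g x ⟨hx, -⟩ hg
    have h1 : (g.k : ℂ) * x.2.2.1 0 = x.2.2.1 0 := congrFun (congrArg (fun y => y.2.2.1) hg) 0
    have hk : (g.k : ℂ) = 1 := mul_right_cancel₀ (hx.2 0) (by rw [h1, one_mul])
    have h2 : (conj (g.k : ℂ))⁻¹ * x.2.2.2 0 + g.c = x.2.2.2 0 :=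
      congrFun (congrArg (fun y => y.2.2.2) hg) 0
    rw [hk] at h2
    exact ScaleTrans.ext (Units.ext hk) (by simpa [ScaleTrans.one_def] using h2)
  act_form g x _ u v := by
    show twistedForm m μ (ScaleTrans.act g x) (fderiv ℝ (ScaleTrans.act g) x u)
      (fderiv ℝ (ScaleTrans.act g) x v) = _
    rw [fderiv_scaleTrans, fderiv_scaleTrans, twistedForm_scaleAct]
    rfl
  act_ham := hinv
  momentum_smooth := by
    refine ContDiff.prodMk (contDiff_pairing.comp
      (f := fun x : RadialPhase => (x.2.2.2, x.2.2.1)) (by fun_prop)) (by fun_prop)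
  pairing_surjective := sumPairing_surjective rePairing_surjective (by
    intro ℓ
    obtain ⟨a, ha⟩ := conjPairing_surjective (-ℓ)
    exact ⟨a, by rw [LinearMap.neg_apply, ha, neg_neg]⟩)
  form_infinitesimal x hx a v := by
    have h1 : DifferentiableAt ℝ (fun x : RadialPhase => pairing x.2.2.2 x.2.2.1) x :=
      (contDiff_pairing.comp (f := fun x : RadialPhase => (x.2.2.2, x.2.2.1))
        (by fun_prop)).differentiable (by simp) x
    have h2 : DifferentiableAt ℝ (fun x : RadialPhase => ∑ i, x.2.2.1 i) x := by fun_prop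
    have h3 : fderiv ℝ (fun x : RadialPhase => ∑ i, x.2.2.1 i) x v = ∑ i, v.2.2.1 i :=
      fderiv_eq_of_line h2 (HasDerivAt.fun_sum fun i _ => hasDerivAt_line_coord _ _ i 0)
    rw [h1.fderiv_prodMk h2]
    show twistedForm m μ x (scaleTransInf x a) v = _
    rw [twistedForm_scaleTransInf x, sumPairing_apply]
    show _ = rePairing a.1 (fderiv ℝ (fun x : RadialPhase => pairing x.2.2.2 x.2.2.1) x v) +
      -conjPairing a.2 (fderiv ℝ (fun x : RadialPhase => ∑ i, x.2.2.1 i) x v)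
    rw [fderiv_pairing, h3, rePairing_apply, conjPairing_apply]
    ring
  integrate a ha := by
    obtain ⟨k, hk0, hkc, hk⟩ := exists_scaling (continuous_fst.comp ha)
    have hc : Continuous fun s => (conj (k s : ℂ))⁻¹ * (a s).2 :=
      ((Complex.continuous_conj.comp hkc).inv₀ fun s => by simp).mul (continuous_snd.comp ha)
    refine ⟨fun s => ⟨k s, ∫ r in (0 : ℝ)..s, (conj (k r : ℂ))⁻¹ * (a r).2⟩, ?_, ?_⟩
    · exact ScaleTrans.ext hk0 intervalIntegral.integral_same
    · intro γ w I s hγ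
      exact hasDerivWithinAt_scaleTrans (hk s) (hasDerivAt_integral hc s) hγ
  orbit_tangent x hx u hu := scaleTrans_orbit_tangent hx.1 hu
  coordinates := by
    refine ⟨fun p => (p.2.2.2.1 0 / p.1.2.2.1 0,
      p.2.2.2.2 0 + conj (p.2.2.2.1 0 / p.1.2.2.1 0) * p.1.2.2.2 0), ?_, ?_⟩
    · have hq : ContinuousOn (fun p : RadialPhase × RadialPhase => p.2.2.2.1 0 / p.1.2.2.1 0)
          (radialDom ×ˢ Set.univ) :=
        ContinuousOn.div (by fun_prop) (by fun_prop) fun p hp => hp.1.2 0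
      exact hq.prodMk (ContinuousOn.add (by fun_prop)
        ((Complex.continuous_conj.comp_continuousOn hq).mul (by fun_prop)))
    · rintro x hx ⟨κ, β⟩
      have e : κ * x.2.2.1 0 / x.2.2.1 0 = κ := mul_div_cancel_right₀ _ (hx.2 0)
      show (κ * x.2.2.1 0 / x.2.2.1 0, -(conj κ * x.2.2.2 0) + β +
        conj (κ * x.2.2.1 0 / x.2.2.1 0) * x.2.2.2 0) = (κ, β)
      rw [e]
      ext <;> simp

theorem projectiveSystem_hasMomentum {h : RadialPhase → ℝ} (hs : ContDiffOn ℝ ∞ h radialDom)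
    (hinv : ∀ g, ∀ x ∈ radialDom, h (ScaleTrans.act g x) = h x) :
    (projectiveSystem m μ h).HasMomentum
      (fun x : RadialPhase => pairing x.2.2.2 x.2.2.1) 0 scaleInf rePairing where
  isOpen_dom := isOpen_radialDom
  symplectic := isSymplecticOn_twistedForm μ hm
  ham_smooth := hs
  level_eq := rfl
  act_smooth k := by
    show ContDiff ℝ ∞ (scaleAct k)
    rw [scaleAct_eq]
    exact contDiff_scaleTrans _
  act_dom k x hx := ⟨hx.1, fun i => mul_ne_zero k.ne_zero (hx.2 i)⟩
  act_level := by
    rintro k x ⟨hx, h1⟩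
    exact ⟨⟨hx.1, fun i => mul_ne_zero k.ne_zero (hx.2 i)⟩, (pairing_scaleAct k _ _).trans h1⟩
  act_free := by
    rintro k x ⟨hx, -⟩ hg
    have h1 : (k : ℂ) * x.2.2.1 0 = x.2.2.1 0 := congrFun (congrArg (fun y => y.2.2.1) hg) 0
    exact Units.ext (mul_right_cancel₀ (hx.2 0) (by rw [h1, Units.val_one, one_mul]))
  act_form k x _ u v := by
    show twistedForm m μ (scaleAct k x) (fderiv ℝ (scaleAct k) x u)
      (fderiv ℝ (scaleAct k) x v) = twistedForm m μ x u v
    have h1 : ∀ u, fderiv ℝ (scaleAct k) x u = scaleAct k u := fun u => by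
      conv_lhs => rw [scaleAct_eq]
      rw [fderiv_scaleTrans]
    rw [h1, h1, ← twistedForm_scaleAct m μ ⟨k, 0⟩ x u v, ← scaleAct_eq]
  act_ham k x hx := by
    show h (scaleAct k x) = h x
    rw [scaleAct_eq, hinv _ x hx]
  momentum_smooth := contDiff_pairing.comp
      (f := fun x : RadialPhase => (x.2.2.2, x.2.2.1)) (by fun_prop)
  pairing_surjective := rePairing_surjective
  form_infinitesimal x hx a v := by
    rw [fderiv_pairing, rePairing_apply]
    refine (twistedForm_scaleTransInf x (a, 0) v).trans ?_
    simp
  integrate a ha := by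
    obtain ⟨k, hk0, -, hk⟩ := exists_scaling ha
    refine ⟨k, hk0, fun γ w I s hγ => ?_⟩
    have := hasDerivWithinAt_scaleTrans (c := fun _ => 0) (a := (a s, 0)) (hk s)
      (by simpa using hasDerivAt_const s (0 : ℂ)) hγ
    simp only [← scaleAct_eq] at this
    exact this
  orbit_tangent x hx u hu := by
    -- The orbit lies in the larger orbit that includes translations; the invariant `conj X₀ Z₀` of
    -- pure scalings then excludes a translation part.
    have hsub : tangentAt ((projectiveSystem m μ h).orbit x) x ⊆
        tangentAt (Set.range fun g => ScaleTrans.act g x) x := by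
      rintro v ⟨γ, h0, hγ, hL⟩
      refine ⟨γ, h0, hγ, hL.mono ?_⟩
      rintro t ⟨k, hk⟩
      exact ⟨⟨k, 0⟩, by rw [← hk]; exact (congrFun (scaleAct_eq k) x).symm⟩
    obtain ⟨⟨κ, β⟩, rfl⟩ := scaleTrans_orbit_tangent hx.1 (hsub hu)
    suffices β = 0 by subst this; exact ⟨κ, rfl⟩
    have h0 : conj (x.2.2.1 0) ≠ 0 := by simpa using hx.1.2 0
    have hd := (hasDerivAt_line_coord x.2.2.1 (κ • x.2.2.1) 0 0).star.fun_mul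
      (hasDerivAt_line_coord x.2.2.2 (-(conj κ • x.2.2.2) + fun _ => β) 0 0)
    refine (mul_eq_zero.1 (eq_zero_of_tangentAt (c := conj (x.2.2.1 0) * β)
      (f := fun y : RadialPhase => star (y.2.2.1 0) * y.2.2.2 0) ?_ ?_ hu
      (hd.congr_deriv ?_))).resolve_left h0
    · refine DifferentiableAt.mul ?_ (by fun_prop)
      exact (Complex.conjCLE.differentiableAt).comp x (by fun_prop)
    · rintro _ ⟨k, rfl⟩
      show conj ((k : ℂ) * x.2.2.1 0) * ((conj (k : ℂ))⁻¹ * x.2.2.2 0) = conj (x.2.2.1 0) * _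
      have hk0 : conj (k : ℂ) ≠ 0 := by simp
      rw [map_mul]
      field_simp
    · simp
      ring
  coordinates := by
    refine ⟨fun p => p.2.2.2.1 0 / p.1.2.2.1 0,
      ContinuousOn.div (by fun_prop) (by fun_prop) fun p hp => hp.1.2 0, fun x hx κ => ?_⟩
    exact mul_div_cancel_right₀ _ (hx.2 0)

end Scale

/-! ### Rotations and translations of the plane. -/

section Rotations

theorem contDiff_rotTrans (g : RotTrans) : ContDiff ℝ ∞ (RotTrans.act g) := by
  show ContDiff ℝ ∞ (fun x : C3 × C3 => ((g.u : ℂ) • x.1 + fun _ => g.c, (g.u : ℂ) • x.2))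
  fun_prop

theorem fderiv_rotTrans (g : RotTrans) (x u : C3 × C3) :
    fderiv ℝ (RotTrans.act g) x u = rotAct g.u u := by
  refine fderiv_eq_of_line ((contDiff_rotTrans g).differentiable (by simp) x) ?_
  have : (fun t : ℝ => RotTrans.act g (x + t • u)) =
      fun t : ℝ => RotTrans.act g x + t • rotAct g.u u := by
    funext t
    refine Prod.ext ?_ ?_
    · show (g.u : ℂ) • (x.1 + t • u.1) + (fun _ => g.c) =
        (g.u : ℂ) • x.1 + (fun _ => g.c) + t • (g.u : ℂ) • u.1
      rw [smul_add, smul_comm]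
      abel
    · show (g.u : ℂ) • (x.2 + t • u.2) = (g.u : ℂ) • x.2 + t • (g.u : ℂ) • u.2
      rw [smul_add, smul_comm]
  rw [this]
  exact hasDerivAt_line _ _ _

theorem rotAct_eq (u : Circle) : rotAct u = RotTrans.act ⟨u, 0⟩ := by
  funext x
  refine Prod.ext ?_ rfl
  show (u : ℂ) • x.1 = (u : ℂ) • x.1 + 0
  rw [add_zero]

theorem pairing_rotAct (u : Circle) (P Q : C3) :
    pairing ((u : ℂ) • P) ((u : ℂ) • Q) = pairing P Q := by
  rw [pairing_smul_left, pairing_smul_right, ← mul_assoc, ← Complex.normSq_eq_conj_mul_self,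
    Circle.normSq_coe, Complex.ofReal_one, one_mul]

theorem stdForm_rotAct (g : Circle) (x y u v : C3 × C3) :
    stdForm y (rotAct g u) (rotAct g v) = stdForm x u v := by
  show (pairing ((g : ℂ) • v.2) ((g : ℂ) • u.1)).re -
    (pairing ((g : ℂ) • u.2) ((g : ℂ) • v.1)).re = _
  rw [pairing_rotAct, pairing_rotAct]
  rfl

/-- The infinitesimal action of rotations and translations. -/
def rotTransInf (x : C3 × C3) : ℝ × ℂ →ₗ[ℝ] C3 × C3 where
  toFun a := ((a.1 * Complex.I) • x.1 + fun _ => a.2, (a.1 * Complex.I) • x.2)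
  map_add' a b := by
    refine Prod.ext ?_ ?_
    · funext i
      simp only [Prod.fst_add, Prod.snd_add, Pi.add_apply, Pi.smul_apply, smul_eq_mul]
      push_cast
      ring
    · funext i
      simp only [Prod.fst_add, Prod.snd_add, Pi.add_apply, Pi.smul_apply, smul_eq_mul]
      push_cast
      ring
  map_smul' r a := by
    refine Prod.ext ?_ ?_
    · funext i
      simp [mul_assoc]
    · funext i
      simp [mul_assoc]

/-- The infinitesimal action of rotations. -/
def rotInf (x : C3 × C3) : ℝ →ₗ[ℝ] C3 × C3 := rotTransInf x ∘ₗ LinearMap.inl ℝ ℝ ℂ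

theorem rotTransInf_apply (x : C3 × C3) (a : ℝ × ℂ) :
    rotTransInf x a = ((a.1 * Complex.I) • x.1 + fun _ => a.2, (a.1 * Complex.I) • x.2) := rfl

theorem hasDerivWithinAt_rotTrans {k : ℝ → Circle} {c : ℝ → ℂ} {a : ℝ × ℂ} {γ : ℝ → C3 × C3}
    {w : C3 × C3} {I : Set ℝ} {s : ℝ}
    (hk : HasDerivAt (fun s => (k s : ℂ)) (k s * (a.1 * Complex.I)) s)
    (hc : HasDerivAt c (k s * a.2) s) (hγ : HasDerivWithinAt γ w I s) :
    HasDerivWithinAt (fun s => RotTrans.act ⟨k s, c s⟩ (γ s))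
      (fderiv ℝ (RotTrans.act ⟨k s, c s⟩) (γ s) (w + rotTransInf (γ s) a)) I s := by
  rw [fderiv_rotTrans]
  have h1 := (ContinuousLinearMap.fst ℝ C3 C3).hasFDerivAt.comp_hasDerivWithinAt s hγ
  have h2 := (ContinuousLinearMap.snd ℝ C3 C3).hasFDerivAt.comp_hasDerivWithinAt s hγ
  have hc' : HasDerivAt (fun s => (fun _ => c s : C3)) (fun _ => k s * a.2) s :=
    hasDerivAt_pi.2 fun _ => hc
  have := ((hk.hasDerivWithinAt.fun_smul h1).fun_add hc'.hasDerivWithinAt).prodMk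
    (hk.hasDerivWithinAt.fun_smul h2)
  refine this.congr_deriv ?_
  refine Prod.ext ?_ ?_
  · funext i
    show (k s : ℂ) * w.1 i + (k s * (a.1 * Complex.I)) * (γ s).1 i + k s * a.2 =
      (k s : ℂ) * (w.1 i + ((a.1 * Complex.I) * (γ s).1 i + a.2))
    ring
  · funext i
    show (k s : ℂ) * w.2 i + (k s * (a.1 * Complex.I)) * (γ s).2 i =
      (k s : ℂ) * (w.2 i + (a.1 * Complex.I) * (γ s).2 i)
    ring

theorem exists_rotation {a : ℝ → ℝ} (ha : Continuous a) :
    ∃ k : ℝ → Circle, k 0 = 1 ∧ Continuous (fun s => (k s : ℂ)) ∧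
      ∀ s, HasDerivAt (fun s => (k s : ℂ)) (k s * (a s * Complex.I)) s := by
  have h : ∀ s, HasDerivAt (fun s => (Circle.exp (∫ r in (0 : ℝ)..s, a r) : ℂ))
      (Circle.exp (∫ r in (0 : ℝ)..s, a r) * (a s * Complex.I)) s := fun s => by
    simp only [Circle.coe_exp]
    exact ((hasDerivAt_integral ha s).ofReal_comp.mul_const Complex.I).cexp
  exact ⟨_, by simp, continuous_iff_continuousAt.2 fun s => (h s).continuousAt, h⟩

/-- The infinitesimal change of a nonzero complex number under rotations is imaginary. -/
theorem ofReal_im_mul_I_of_re_eq_zero {z w : ℂ} (h : (conj w * z + conj z * w).re = 0) :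
    (((w / z).im : ℝ) : ℂ) * Complex.I = w / z := by
  have h1 : (w / z).re = 0 := by
    rw [Complex.div_re, ← add_div, div_eq_zero_iff]
    left
    simp only [Complex.add_re, Complex.mul_re, Complex.conj_re, Complex.conj_im] at h
    linarith
  apply Complex.ext <;> simp [h1]

theorem fderiv_angularMomentum (x v : C3 × C3) :
    fderiv ℝ (fun x : C3 × C3 => -(pairing x.2 x.1).im) x v =
      -(pairing v.2 x.1 + pairing x.2 v.1).im := by
  have hs : ContDiff ℝ ∞ (fun x : C3 × C3 => -(pairing x.2 x.1).im) :=
    (Complex.imCLM.contDiff.comp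
      (contDiff_pairing.comp (f := fun x : C3 × C3 => (x.2, x.1)) (by fun_prop))).neg
  refine fderiv_eq_of_line (hs.differentiable (by simp) x) ?_
  simpa using (hasDerivAt_im (hasDerivAt_pairing (hasDerivAt_line x.2 v.2 0)
    (hasDerivAt_line x.1 v.1 0))).fun_neg

/-- Identifies `-Im⟨P, Q⟩`, with this sign, as the momentum of rotations and the sum of the momenta
as that of translations. -/
theorem stdForm_rotTransInf (x : C3 × C3) (a : ℝ × ℂ) (v : C3 × C3) :
    stdForm x (rotTransInf x a) v =
      a.1 * -(pairing v.2 x.1 + pairing x.2 v.1).im + (conj a.2 * ∑ i, v.2 i).re := by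
  rw [rotTransInf_apply]
  simp only [stdForm]
  rw [pairing_add_right, pairing_smul_right, pairing_const_right, pairing_smul_left]
  simp only [map_mul, Complex.conj_ofReal, Complex.conj_I, Complex.add_re, Complex.add_im,
    Complex.mul_re, Complex.mul_im, Complex.conj_re, Complex.conj_im, Complex.ofReal_re,
    Complex.ofReal_im, Complex.I_re, Complex.I_im, Complex.neg_re, Complex.neg_im]
  ring

theorem mul_pairing_surjective : Function.Surjective (LinearMap.mul ℝ ℝ) := fun ℓ =>
  ⟨ℓ 1, LinearMap.ext fun s => by
    rw [LinearMap.mul_apply', mul_comm, ← smul_eq_mul, ← map_smul, smul_eq_mul, mul_one]⟩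

end Rotations

/-! ### Symmetry and smoothness of the Hamiltonians. -/

section Hamiltonians

/-- The map from radial-homogeneous to relative coordinates, after the momentum shift. -/
def toRelative (m : Fin 3 → ℝ) (μ : ℝ) (x : RadialPhase) : C3 × C3 :=
  fromRadial m (momentumShift m μ x)


variable {m : Fin 3 → ℝ}

theorem contDiff_kinetic : ContDiff ℝ ∞ (kinetic m) := by
  have h : ∀ i j : Fin 3, ContDiff ℝ ∞ (fun P : C3 => ‖P i - P j‖ ^ 2) := fun i j =>
    ContDiff.norm_sq ℝ (by fun_prop)
  exact (((h 0 1).div_const _).add ((h 2 0).div_const _)).add ((h 1 2).div_const _)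

theorem contDiffAt_potential {Q : C3} (hQ : ∀ i, Q i ≠ 0) : ContDiffAt ℝ ∞ (potential m) Q := by
  unfold potential
  refine ContDiffAt.sum fun i _ => contDiffAt_const.div ?_ (norm_ne_zero_iff.2 (hQ i))
  exact ContDiffAt.norm ℝ (by fun_prop) (hQ i)

theorem contDiffAt_hamRel {x : C3 × C3} (hx : ∀ i, x.1 i ≠ 0) : ContDiffAt ℝ ∞ (hamRel m) x :=
  (contDiff_kinetic.contDiffAt.comp x contDiffAt_snd).sub
    (ContDiffAt.comp x (g := potential m) (contDiffAt_potential hx) contDiffAt_fst)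

theorem kinetic_smul (c : ℂ) (P : C3) : kinetic m (c • P) = ‖c‖ ^ 2 * kinetic m P := by
  simp only [kinetic, Pi.smul_apply, ← smul_sub, norm_smul, mul_pow]
  ring

theorem kinetic_add_const (c : ℂ) (P : C3) : kinetic m (P + fun _ => c) = kinetic m P := by
  simp only [kinetic, Pi.add_apply, add_sub_add_right_eq_sub]

theorem potential_smul (c : ℂ) (Q : C3) : potential m (c • Q) = ‖c‖⁻¹ * potential m Q := by
  simp only [potential, Pi.smul_apply, norm_smul, Finset.mul_sum]
  exact Finset.sum_congr rfl fun i _ => by rw [mul_comm ‖c‖, ← div_div]; ring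

theorem norm_div_norm_self {k : ℂ} (hk : k ≠ 0) : ‖k / (‖k‖ : ℂ)‖ = 1 := by
  rw [norm_div, Complex.norm_real, norm_norm, div_self (norm_ne_zero_iff.2 hk)]

theorem hamRel_rotate {c : ℂ} (hc : ‖c‖ = 1) (d : ℂ) (x : C3 × C3) :
    hamRel m (c • x.1, c • x.2 + fun _ => d) = hamRel m x := by
  simp only [hamRel]
  rw [kinetic_add_const, kinetic_smul, potential_smul, hc]
  simp

theorem hamThreeBody_rotTrans (g : RotTrans) (x : C3 × C3) :
    hamThreeBody m (RotTrans.act g x) = hamThreeBody m x := by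
  have h1 : ∀ i, ‖(RotTrans.act g x).2 i‖ = ‖x.2 i‖ := fun i => by
    show ‖(g.u : ℂ) * x.2 i‖ = _
    rw [norm_mul, Circle.norm_coe, one_mul]
  have h2 : ∀ i j, ‖(RotTrans.act g x).1 i - (RotTrans.act g x).1 j‖ = ‖x.1 i - x.1 j‖ :=
    fun i j => by
      show ‖((g.u : ℂ) * x.1 i + g.c) - ((g.u : ℂ) * x.1 j + g.c)‖ = _
      rw [add_sub_add_right_eq_sub, ← mul_sub, norm_mul, Circle.norm_coe, one_mul]
  simp only [hamThreeBody, h1, h2]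

theorem contDiffAt_hamThreeBody {x : C3 × C3} (hx : Function.Injective x.1) :
    ContDiffAt ℝ ∞ (hamThreeBody m) x := by
  have h1 : ∀ i, ContDiffAt ℝ ∞ (fun x : C3 × C3 => ‖x.2 i‖ ^ 2) x := fun i =>
    ContDiffAt.norm_sq ℝ (by fun_prop)
  have h2 : ∀ (c : ℝ) (i j : Fin 3), i ≠ j →
      ContDiffAt ℝ ∞ (fun x : C3 × C3 => c / ‖x.1 i - x.1 j‖) x := fun c i j hij => by
    have h0 : x.1 i - x.1 j ≠ 0 := sub_ne_zero.2 fun h => hij (hx h)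
    exact contDiffAt_const.div (ContDiffAt.norm ℝ (by fun_prop) h0) (norm_ne_zero_iff.2 h0)
  refine (ContDiffAt.sum fun i _ => (h1 i).div_const _).sub
    (((h2 _ 0 1 (by decide)).add (h2 _ 2 0 (by decide))).add (h2 _ 1 2 (by decide)))

variable (hm : ∀ i, 0 < m i)
include hm

theorem contDiffAt_fromRadial {x : RadialPhase} (hr : x.1 ≠ 0) (h0 : x.2.2.1 0 ≠ 0) :
    ContDiffAt ℝ ∞ (fromRadial m) x := by
  have hX : ContDiffAt ℝ ∞ (fun y : RadialPhase => y.2.2.1) x := by fun_prop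
  have hn : ContDiffAt ℝ ∞ (fun y : RadialPhase => massNorm m y.2.2.1) x :=
    ContDiffAt.comp x (g := massNorm m) (contDiffAt_massNorm hm h0) hX
  have hd : ContDiffAt ℝ ∞ (fun y : RadialPhase => dualCovector m y.2.2.1) x :=
    ContDiffAt.comp x (contDiff_dualCovector m).contDiffAt hX
  have hn0 := (massNorm_pos hm h0).ne'
  have hp : ContDiffAt ℝ ∞ (fun y : RadialPhase => y.2.1) x := by fun_prop
  have hY : ContDiffAt ℝ ∞ (fun y : RadialPhase => y.2.2.2) x := by fun_prop
  exact ((contDiffAt_fst.div hn hn0).smul hX).prodMk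
    (((hp.div hn hn0).smul hd).add ((hn.div contDiffAt_fst hr).smul hY))

theorem fromRadial_ne_zero {x : RadialPhase} (hx : x ∈ radialDom) (i : Fin 3) :
    (fromRadial m x).1 i ≠ 0 :=
  smul_ne_zero (div_ne_zero hx.1.ne' (massNorm_pos hm (hx.2 0)).ne') (hx.2 i)

variable (μ : ℝ)

theorem contDiffAt_toRelative {x : RadialPhase} (hx : x ∈ radialDom) :
    ContDiffAt ℝ ∞ (toRelative m μ) x :=
  ContDiffAt.comp x (g := fromRadial m)
    (contDiffAt_fromRadial hm (x := momentumShift m μ x) hx.1.ne' (hx.2 0))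
    (contDiffAt_momentumShift μ hm (hx.2 0))

omit hm in
theorem toRelative_apply (x : RadialPhase) : toRelative m μ x =
    ((x.1 / massNorm m x.2.2.1) • x.2.2.1,
      (x.2.1 / massNorm m x.2.2.1) • dualCovector m x.2.2.1 + (massNorm m x.2.2.1 / x.1) •
        (x.2.2.2 + ((μ / massNorm m x.2.2.1 ^ 2 : ℝ) * Complex.I) •
          dualCovector m x.2.2.1)) := rfl

/-- The radial map forgets the modulus of `k`. Its phase rotates positions and momenta alike because
`1 / conj k = k / |k|²`. A translation survives as a constant added to `P`, which the kinetic energy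
ignores. -/
theorem toRelative_scaleTrans {x : RadialPhase} (hx : x ∈ radialDom) (g : ScaleTrans) :
    toRelative m μ (ScaleTrans.act g x) =
      (((g.k : ℂ) / (‖(g.k : ℂ)‖ : ℂ)) • (toRelative m μ x).1,
        ((g.k : ℂ) / (‖(g.k : ℂ)‖ : ℂ)) • (toRelative m μ x).2 +
          fun _ => ((‖(g.k : ℂ)‖ * massNorm m x.2.2.1 / x.1 : ℝ) : ℂ) * g.c) := by
  have hk0 := g.k.ne_zero
  have hk : ((‖(g.k : ℂ)‖ : ℝ) : ℂ) ≠ 0 := by simp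
  have hr : (x.1 : ℂ) ≠ 0 := by exact_mod_cast hx.1.ne'
  have hn : (massNorm m x.2.2.1 : ℂ) ≠ 0 := by exact_mod_cast (massNorm_pos hm (hx.2 0)).ne'
  have hkk : conj (g.k : ℂ) * g.k = (‖(g.k : ℂ)‖ : ℂ) ^ 2 := by
    rw [← Complex.normSq_eq_conj_mul_self, Complex.normSq_eq_norm_sq]
    push_cast
    rfl
  have hinv : (conj (g.k : ℂ))⁻¹ = (g.k : ℂ) / (‖(g.k : ℂ)‖ : ℂ) ^ 2 := by
    rw [← hkk, div_mul_cancel_right₀ hk0]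
  have e : ScaleTrans.act g x = (x.1, x.2.1, (g.k : ℂ) • x.2.2.1,
    (conj (g.k : ℂ))⁻¹ • x.2.2.2 + fun _ => g.c) := rfl
  rw [e, toRelative_apply, toRelative_apply]
  simp only [massNorm_smul, dualCovector_smul, hinv]
  refine Prod.ext ?_ ?_
  · funext i
    simp only [Pi.smul_apply, Complex.real_smul, smul_eq_mul]
    push_cast
    field_simp
  · funext i
    simp only [Pi.smul_apply, Pi.add_apply, Complex.real_smul, smul_eq_mul]
    push_cast
    field_simp
    ring

theorem hamMu_scaleTrans (g : ScaleTrans) {x : RadialPhase} (hx : x ∈ radialDom) :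
    hamMu m μ (ScaleTrans.act g x) = hamMu m μ x := by
  show hamRel m (toRelative m μ _) = hamRel m (toRelative m μ _)
  rw [toRelative_scaleTrans hm μ hx, hamRel_rotate (norm_div_norm_self g.k.ne_zero)]

theorem contDiffOn_hamMu : ContDiffOn ℝ ∞ (hamMu m μ) radialDom := fun x hx =>
  (ContDiffAt.comp x (g := hamRel m) (contDiffAt_hamRel
    (fromRadial_ne_zero hm (x := momentumShift m μ x) hx))
    (contDiffAt_toRelative hm μ hx)).contDiffWithinAt

omit hm in
theorem hamMuExplicit_scaleTrans (g : ScaleTrans) {x : RadialPhase} :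
    hamMuExplicit m μ (ScaleTrans.act g x) = hamMuExplicit m μ x := by
  show 1 / 2 * (x.2.1 ^ 2 + μ ^ 2 / x.1 ^ 2) + massNorm m ((g.k : ℂ) • x.2.2.1) ^ 2 / x.1 ^ 2 *
    kinetic m ((conj (g.k : ℂ))⁻¹ • x.2.2.2 + fun _ => g.c) -
    1 / x.1 * (massNorm m ((g.k : ℂ) • x.2.2.1) * potential m ((g.k : ℂ) • x.2.2.1)) =
    1 / 2 * (x.2.1 ^ 2 + μ ^ 2 / x.1 ^ 2) + massNorm m x.2.2.1 ^ 2 / x.1 ^ 2 *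
    kinetic m x.2.2.2 - 1 / x.1 * (massNorm m x.2.2.1 * potential m x.2.2.1)
  have hk : ‖(g.k : ℂ)‖ ≠ 0 := norm_ne_zero_iff.2 g.k.ne_zero
  rw [kinetic_add_const, kinetic_smul, potential_smul, massNorm_smul, norm_inv, RCLike.norm_conj]
  field_simp

theorem contDiffOn_hamMuExplicit : ContDiffOn ℝ ∞ (hamMuExplicit m μ) radialDom := by
  intro x hx
  refine ContDiffAt.contDiffWithinAt ?_
  have hX : ContDiffAt ℝ ∞ (fun y : RadialPhase => y.2.2.1) x := by fun_prop
  have hn : ContDiffAt ℝ ∞ (fun y : RadialPhase => massNorm m y.2.2.1) x :=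
    ContDiffAt.comp x (g := massNorm m) (contDiffAt_massNorm hm (hx.2 0)) hX
  have hU : ContDiffAt ℝ ∞ (fun y : RadialPhase => potential m y.2.2.1) x :=
    ContDiffAt.comp x (g := potential m) (contDiffAt_potential hx.2) hX
  have hK : ContDiffAt ℝ ∞ (fun y : RadialPhase => kinetic m y.2.2.2) x :=
    contDiff_kinetic.contDiffAt.comp x (by fun_prop)
  have hr : ContDiffAt ℝ ∞ (fun y : RadialPhase => y.1) x := by fun_prop
  have hp : ContDiffAt ℝ ∞ (fun y : RadialPhase => y.2.1) x := by fun_prop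
  have hr0 := hx.1.ne'
  exact ((contDiffAt_const.mul ((hp.pow 2).add (contDiffAt_const.div (hr.pow 2)
    (pow_ne_zero 2 hr0)))).add (((hn.pow 2).div (hr.pow 2) (pow_ne_zero 2 hr0)).mul hK)).sub
    ((contDiffAt_const.div hr hr0).mul (hn.mul hU))

end Hamiltonians

/-! ### Momentum maps of the relative and of the three-body system. -/

section RotationSystems

variable {m : Fin 3 → ℝ} {μ : ℝ}

theorem momentum_rot_smooth : ContDiff ℝ ∞ (fun x : C3 × C3 => -(pairing x.2 x.1).im) :=
  (Complex.imCLM.contDiff.comp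
    (contDiff_pairing.comp (f := fun x : C3 × C3 => (x.2, x.1)) (by fun_prop))).neg

theorem isOpen_ne_zero : IsOpen {x : C3 × C3 | ∀ i, x.1 i ≠ 0} := by
  have : {x : C3 × C3 | ∀ i, x.1 i ≠ 0} = ⋂ i, {x : C3 × C3 | x.1 i ≠ 0} := by
    ext x; simp
  rw [this]
  exact isOpen_iInter_of_finite fun i => isOpen_ne_fun (by fun_prop) continuous_const

theorem relativeSystem_hasMomentum :
    (relativeSystem m μ).HasMomentum (fun x : C3 × C3 => -(pairing x.2 x.1).im) μ rotInf
      (LinearMap.mul ℝ ℝ) where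
  isOpen_dom := isOpen_ne_zero
  symplectic := isSymplecticOn_stdForm _
  ham_smooth x hx := (contDiffAt_hamRel hx).contDiffWithinAt
  level_eq := rfl
  act_smooth k := by
    show ContDiff ℝ ∞ (rotAct k)
    rw [rotAct_eq]
    exact contDiff_rotTrans _
  act_dom k x hx i := mul_ne_zero k.coe_ne_zero (hx i)
  act_level := by
    rintro k x ⟨hx, h1⟩
    refine ⟨fun i => mul_ne_zero k.coe_ne_zero (hx i), ?_⟩
    rw [← h1]
    exact congrArg (fun z : ℂ => -z.im) (pairing_rotAct k _ _)
  act_free := by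
    rintro k x ⟨hx, -⟩ hg
    have h1 : (k : ℂ) * x.1 0 = x.1 0 := congrFun (congrArg (fun y => y.1) hg) 0
    exact Circle.ext (mul_right_cancel₀ (hx 0) (by rw [h1, Circle.coe_one, one_mul]))
  act_form k x _ u v := by
    show stdForm (rotAct k x) (fderiv ℝ (rotAct k) x u) (fderiv ℝ (rotAct k) x v) = stdForm x u v
    have h1 : ∀ u, fderiv ℝ (rotAct k) x u = rotAct k u := fun u => by
      conv_lhs => rw [rotAct_eq]
      rw [fderiv_rotTrans]
    rw [h1, h1, stdForm_rotAct]
  act_ham k x hx := by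
    have := hamRel_rotate (m := m) (Circle.norm_coe k) 0 x
    rwa [show (fun _ : Fin 3 => (0 : ℂ)) = 0 from rfl, add_zero] at this
  momentum_smooth := momentum_rot_smooth
  pairing_surjective := mul_pairing_surjective
  form_infinitesimal x hx a v := by
    rw [fderiv_angularMomentum, LinearMap.mul_apply']
    refine (stdForm_rotTransInf x (a, 0) v).trans ?_
    simp
  integrate a ha := by
    obtain ⟨k, hk0, -, hk⟩ := exists_rotation ha
    refine ⟨k, hk0, fun γ w I s hγ => ?_⟩
    have := hasDerivWithinAt_rotTrans (c := fun _ => 0) (a := (a s, 0)) (hk s)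
      (by simpa using hasDerivAt_const s (0 : ℂ)) hγ
    simp only [← rotAct_eq] at this
    exact this
  orbit_tangent := by
    intro x hx u hu
    have h0 : x.1 0 ≠ 0 := hx.1 0
    have h1 : ∀ i, u.1 i * x.1 0 - u.1 0 * x.1 i = 0 := by
      intro i
      refine eq_zero_of_tangentAt (f := fun y : C3 × C3 => y.1 i * x.1 0 - y.1 0 * x.1 i)
        (by fun_prop) ?_ hu (((hasDerivAt_line_coord x.1 u.1 i 0).mul_const _).fun_sub
        ((hasDerivAt_line_coord x.1 u.1 0 0).mul_const _))
      rintro _ ⟨k, rfl⟩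
      show (k : ℂ) * x.1 i * x.1 0 - (k : ℂ) * x.1 0 * x.1 i = _
      ring
    have h2 : ∀ i, u.2 i * x.1 0 - u.1 0 * x.2 i = 0 := by
      intro i
      refine eq_zero_of_tangentAt (f := fun y : C3 × C3 => y.2 i * x.1 0 - y.1 0 * x.2 i)
        (by fun_prop) ?_ hu (((hasDerivAt_line_coord x.2 u.2 i 0).mul_const _).fun_sub
        ((hasDerivAt_line_coord x.1 u.1 0 0).mul_const _))
      rintro _ ⟨k, rfl⟩
      show (k : ℂ) * x.2 i * x.1 0 - (k : ℂ) * x.1 0 * x.2 i = _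
      ring
    -- Constancy of `|Q₀|` makes the ratio `u₀ / x₀` imaginary, so the vector is an infinitesimal
    -- rotation rather than a scaling.
    have h3 : (conj (u.1 0) * x.1 0 + conj (x.1 0) * u.1 0).re = 0 := by
      have hd := hasDerivAt_re ((hasDerivAt_line_coord x.1 u.1 0 0).star.fun_mul
        (hasDerivAt_line_coord x.1 u.1 0 0))
      refine eq_zero_of_tangentAt (f := fun y : C3 × C3 => (star (y.1 0) * y.1 0).re) ?_ ?_ hu
        (hd.congr_deriv (by simp))
      · refine Complex.reCLM.differentiableAt.comp x (DifferentiableAt.mul ?_ (by fun_prop))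
        exact (Complex.conjCLE.differentiableAt).comp x (by fun_prop)
      · rintro _ ⟨k, rfl⟩
        show (conj ((k : ℂ) * x.1 0) * ((k : ℂ) * x.1 0)).re = (conj (x.1 0) * x.1 0).re
        rw [← Complex.normSq_eq_conj_mul_self, ← Complex.normSq_eq_conj_mul_self,
          Complex.normSq_mul, Circle.normSq_coe, one_mul]
    have h4 := ofReal_im_mul_I_of_re_eq_zero h3
    refine ⟨(u.1 0 / x.1 0).im, Prod.ext ?_ ?_⟩
    · funext i
      show (((u.1 0 / x.1 0).im : ℝ) : ℂ) * Complex.I * x.1 i + 0 = u.1 i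
      rw [h4]
      field_simp
      linear_combination -h1 i
    · funext i
      show (((u.1 0 / x.1 0).im : ℝ) : ℂ) * Complex.I * x.2 i = u.2 i
      rw [h4]
      field_simp
      linear_combination -h2 i
  coordinates := by
    refine ⟨fun p => (p.2.1 0 / p.1.1 0).im, Complex.continuous_im.comp_continuousOn
      (ContinuousOn.div (by fun_prop) (by fun_prop) fun p hp => hp.1 0), fun x hx θ => ?_⟩
    show (((θ : ℂ) * Complex.I * x.1 0 + 0) / x.1 0).im = θ
    rw [add_zero, mul_div_cancel_right₀ _ (hx 0)]
    simp

theorem isOpen_injective : IsOpen {x : C3 × C3 | Function.Injective x.1} := by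
  have : {x : C3 × C3 | Function.Injective x.1} =
      ⋂ i, ⋂ j, {x : C3 × C3 | x.1 i = x.1 j → i = j} := by
    ext x; simp [Function.Injective]
  rw [this]
  refine isOpen_iInter_of_finite fun i => isOpen_iInter_of_finite fun j => ?_
  by_cases h : i = j
  · simp [h]
  · simp only [h, imp_false]
    exact isOpen_ne_fun (by fun_prop) (by fun_prop)

theorem injective_rotTrans (g : RotTrans) {x : C3 × C3} (hx : Function.Injective x.1) :
    Function.Injective (RotTrans.act g x).1 := by
  intro i j hij
  have h : (g.u : ℂ) * x.1 i + g.c = (g.u : ℂ) * x.1 j + g.c := hij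
  exact hx (mul_left_cancel₀ g.u.coe_ne_zero (add_right_cancel h))

theorem threeBodySystem_hasMomentum :
    (threeBodySystem m μ).HasMomentum
      (fun x : C3 × C3 => (-(pairing x.2 x.1).im, ∑ i, x.2 i)) (μ, 0) rotTransInf
      (sumPairing (LinearMap.mul ℝ ℝ) conjPairing) where
  isOpen_dom := isOpen_injective
  symplectic := isSymplecticOn_stdForm _
  ham_smooth x hx := (contDiffAt_hamThreeBody hx).contDiffWithinAt
  level_eq := by
    ext x
    show _ ∧ _ ∧ _ ↔ _ ∧ _ = _
    rw [Prod.mk.injEq, and_comm (a := _ = μ)]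
    exact Iff.rfl
  act_smooth := contDiff_rotTrans
  act_dom g x hx := injective_rotTrans g hx
  act_level := by
    rintro g x ⟨hx, h1, h2⟩
    have h3 : ∑ i, ((g.u : ℂ) • x.2) i = 0 := by
      simp only [Pi.smul_apply, ← Finset.smul_sum, h1, smul_zero]
    refine ⟨injective_rotTrans g hx, h3, ?_⟩
    show -(pairing ((g.u : ℂ) • x.2) ((g.u : ℂ) • x.1 + fun _ => g.c)).im = μ
    rw [pairing_add_right, pairing_rotAct, pairing_const_right, h3, map_zero, mul_zero, add_zero, h2]
  act_free := by
    rintro g x ⟨hx, -⟩ hg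
    have h : ∀ i, (g.u : ℂ) * x.1 i + g.c = x.1 i := fun i =>
      congrFun (congrArg (fun y => y.1) hg) i
    have h0 : x.1 0 - x.1 1 ≠ 0 := sub_ne_zero.2 fun h => absurd (hx h) (by decide)
    have hu : (g.u : ℂ) = 1 := mul_right_cancel₀ h0 (by linear_combination h 0 - h 1)
    have h2 := h 0
    rw [hu, one_mul, add_eq_left] at h2
    exact RotTrans.ext (Circle.ext hu) h2
  act_form g x _ u v := by
    show stdForm (RotTrans.act g x) (fderiv ℝ (RotTrans.act g) x u)
      (fderiv ℝ (RotTrans.act g) x v) = stdForm x u v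
    rw [fderiv_rotTrans, fderiv_rotTrans, stdForm_rotAct]
  act_ham g x _ := hamThreeBody_rotTrans g x
  momentum_smooth := momentum_rot_smooth.prodMk (by fun_prop)
  pairing_surjective := sumPairing_surjective mul_pairing_surjective conjPairing_surjective
  form_infinitesimal x hx a v := by
    have h1 : DifferentiableAt ℝ (fun x : C3 × C3 => -(pairing x.2 x.1).im) x :=
      momentum_rot_smooth.differentiable (by simp) x
    have h2 : DifferentiableAt ℝ (fun x : C3 × C3 => ∑ i, x.2 i) x := by fun_prop
    have h3 : fderiv ℝ (fun x : C3 × C3 => ∑ i, x.2 i) x v = ∑ i, v.2 i :=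
      fderiv_eq_of_line h2 (HasDerivAt.fun_sum fun i _ => hasDerivAt_line_coord _ _ i 0)
    rw [h1.fderiv_prodMk h2]
    show stdForm x (rotTransInf x a) v = _
    rw [stdForm_rotTransInf, sumPairing_apply]
    show _ = a.1 * (fderiv ℝ (fun x : C3 × C3 => -(pairing x.2 x.1).im) x v) +
      conjPairing a.2 (fderiv ℝ (fun x : C3 × C3 => ∑ i, x.2 i) x v)
    rw [fderiv_angularMomentum, h3, conjPairing_apply]
  integrate a ha := by
    obtain ⟨k, hk0, hkc, hk⟩ := exists_rotation (continuous_fst.comp ha)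
    have hc : Continuous fun s => (k s : ℂ) * (a s).2 := hkc.mul (continuous_snd.comp ha)
    refine ⟨fun s => ⟨k s, ∫ r in (0 : ℝ)..s, (k r : ℂ) * (a r).2⟩, ?_, ?_⟩
    · exact RotTrans.ext hk0 intervalIntegral.integral_same
    · intro γ w I s hγ
      exact hasDerivWithinAt_rotTrans (hk s) (hasDerivAt_integral hc s) hγ
  orbit_tangent := by
    intro x hx u hu
    have h0 : x.1 0 - x.1 1 ≠ 0 := sub_ne_zero.2 fun h => absurd (hx.1 h) (by decide)
    have hl : ∀ i, HasDerivAt (fun t : ℝ => (x.1 + t • u.1) i) (u.1 i) 0 := fun i =>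
      hasDerivAt_line_coord x.1 u.1 i 0
    -- Differences of positions do not see translations; `x₀ - x₁` is a nonzero reference vector for
    -- the rotation rate `δ`.
    have h1 : ∀ i, (u.1 i - u.1 0) * (x.1 0 - x.1 1) - (u.1 0 - u.1 1) * (x.1 i - x.1 0) = 0 := by
      intro i
      refine eq_zero_of_tangentAt (f := fun y : C3 × C3 =>
        (y.1 i - y.1 0) * (x.1 0 - x.1 1) - (y.1 0 - y.1 1) * (x.1 i - x.1 0))
        (by fun_prop) ?_ hu ((((hl i).fun_sub (hl 0)).mul_const _).fun_sub
        (((hl 0).fun_sub (hl 1)).mul_const _))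
      rintro _ ⟨g, rfl⟩
      show (((g.u : ℂ) * x.1 i + g.c) - ((g.u : ℂ) * x.1 0 + g.c)) * (x.1 0 - x.1 1) -
        (((g.u : ℂ) * x.1 0 + g.c) - ((g.u : ℂ) * x.1 1 + g.c)) * (x.1 i - x.1 0) = _
      ring
    have h2 : ∀ i, u.2 i * (x.1 0 - x.1 1) - (u.1 0 - u.1 1) * x.2 i = 0 := by
      intro i
      refine eq_zero_of_tangentAt (f := fun y : C3 × C3 =>
        y.2 i * (x.1 0 - x.1 1) - (y.1 0 - y.1 1) * x.2 i)
        (by fun_prop) ?_ hu (((hasDerivAt_line_coord x.2 u.2 i 0).mul_const _).fun_sub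
        (((hl 0).fun_sub (hl 1)).mul_const _))
      rintro _ ⟨g, rfl⟩
      show (g.u : ℂ) * x.2 i * (x.1 0 - x.1 1) -
        (((g.u : ℂ) * x.1 0 + g.c) - ((g.u : ℂ) * x.1 1 + g.c)) * x.2 i = _
      ring
    have h3 : (conj (u.1 0 - u.1 1) * (x.1 0 - x.1 1) +
        conj (x.1 0 - x.1 1) * (u.1 0 - u.1 1)).re = 0 := by
      have hd := hasDerivAt_re (((hl 0).fun_sub (hl 1)).star.fun_mul ((hl 0).fun_sub (hl 1)))
      refine eq_zero_of_tangentAt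
        (f := fun y : C3 × C3 => (star (y.1 0 - y.1 1) * (y.1 0 - y.1 1)).re) ?_ ?_ hu
        (hd.congr_deriv (by simp))
      · refine Complex.reCLM.differentiableAt.comp x (DifferentiableAt.mul ?_ (by fun_prop))
        exact (Complex.conjCLE.differentiableAt).comp x (by fun_prop)
      · rintro _ ⟨g, rfl⟩
        show (conj (((g.u : ℂ) * x.1 0 + g.c) - ((g.u : ℂ) * x.1 1 + g.c)) *
          (((g.u : ℂ) * x.1 0 + g.c) - ((g.u : ℂ) * x.1 1 + g.c))).re =
          (conj (x.1 0 - x.1 1) * (x.1 0 - x.1 1)).re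
        rw [add_sub_add_right_eq_sub, ← mul_sub, ← Complex.normSq_eq_conj_mul_self,
          ← Complex.normSq_eq_conj_mul_self, Complex.normSq_mul, Circle.normSq_coe, one_mul]
    have h4 := ofReal_im_mul_I_of_re_eq_zero h3
    set δ := (u.1 0 - u.1 1) / (x.1 0 - x.1 1) with hδ
    refine ⟨(δ.im, u.1 0 - δ * x.1 0), Prod.ext ?_ ?_⟩
    · funext i
      show ((δ.im : ℝ) : ℂ) * Complex.I * x.1 i + (u.1 0 - δ * x.1 0) = u.1 i
      rw [h4, hδ]
      field_simp
      linear_combination -h1 i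
    · funext i
      show ((δ.im : ℝ) : ℂ) * Complex.I * x.2 i = u.2 i
      rw [h4, hδ]
      field_simp
      linear_combination -h2 i
  coordinates := by
    refine ⟨fun p => (((p.2.1 0 - p.2.1 1) / (p.1.1 0 - p.1.1 1)).im, p.2.1 0 -
      (((p.2.1 0 - p.2.1 1) / (p.1.1 0 - p.1.1 1)).im : ℝ) * Complex.I * p.1.1 0), ?_, ?_⟩
    · have hq : ContinuousOn (fun p : (C3 × C3) × (C3 × C3) =>
          ((p.2.1 0 - p.2.1 1) / (p.1.1 0 - p.1.1 1)).im)
          ({x | Function.Injective x.1} ×ˢ Set.univ) :=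
        Complex.continuous_im.comp_continuousOn (ContinuousOn.div (by fun_prop) (by fun_prop)
          fun p hp => sub_ne_zero.2 fun h => absurd (hp.1 h) (by decide))
      exact hq.prodMk (ContinuousOn.sub (by fun_prop)
        (((Complex.continuous_ofReal.comp_continuousOn hq).mul continuousOn_const).mul
          (by fun_prop)))
    · rintro x hx ⟨θ, c⟩
      have h0 : x.1 0 - x.1 1 ≠ 0 := sub_ne_zero.2 fun h => absurd (hx h) (by decide)
      have e : (((θ : ℂ) * Complex.I * x.1 0 + c) - ((θ : ℂ) * Complex.I * x.1 1 + c)) /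
          (x.1 0 - x.1 1) = θ * Complex.I := by
        field_simp
        ring
      show (((((θ : ℂ) * Complex.I * x.1 0 + c) - ((θ : ℂ) * Complex.I * x.1 1 + c)) /
        (x.1 0 - x.1 1)).im, ((θ : ℂ) * Complex.I * x.1 0 + c) -
        ((((((θ : ℂ) * Complex.I * x.1 0 + c) - ((θ : ℂ) * Complex.I * x.1 1 + c)) /
        (x.1 0 - x.1 1)).im : ℝ) : ℂ) * Complex.I * x.1 0) = (θ, c)
      rw [e]
      simp

end RotationSystems

theorem tangentAt_mono {E : Type} [NormedAddCommGroup E] [NormedSpace ℝ E] {L M : Set E}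
    (h : L ⊆ M) (x : E) : tangentAt L x ⊆ tangentAt M x := by
  rintro v ⟨γ, h0, hγ, hL⟩
  exact ⟨γ, h0, hγ, hL.mono fun t ht => h ht⟩

/-- A map `F'` is compatible with the forms if `F` and `F ∘ F'` are. -/
theorem SymHamSystem.PartiallySymplectic.of_comp {E₁ G₁ E₂ G₂ : Type} [NormedAddCommGroup E₁]
    [NormedSpace ℝ E₁] [Group G₁] [NormedAddCommGroup E₂] [NormedSpace ℝ E₂] [Group G₂]
    {S₁ : SymHamSystem E₁ G₁} {S₂ : SymHamSystem E₂ G₂} {F : E₁ → E₂} {F' : E₂ → E₁}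
    (hF : S₁.PartiallySymplectic S₂ F) (h₁ : IsOpen S₁.dom) (h₂ : IsOpen S₂.dom)
    (hl₁ : S₁.level ⊆ S₁.dom) (hl₂ : S₂.level ⊆ S₂.dom)
    (smooth : ContDiffOn ℝ ∞ F' S₂.dom) (mapsTo : ∀ y ∈ S₂.level, F' y ∈ S₁.level)
    (orbits : ∀ y ∈ S₂.level, ∀ g, ∃ k, F' (S₂.act g y) = S₁.act k (F' y))
    (form : ∀ y ∈ S₂.level, ∀ u ∈ tangentAt S₂.level y, ∀ v ∈ tangentAt S₂.level y,
      S₂.form (F (F' y)) (fderiv ℝ (F ∘ F') y u) (fderiv ℝ (F ∘ F') y v) = S₂.form y u v) :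
    S₂.PartiallySymplectic S₁ F' where
  smooth := smooth
  mapsTo := mapsTo
  orbits := orbits
  form y hy u hu v hv := by
    have hd' : DifferentiableAt ℝ F' y :=
      (smooth.contDiffAt (h₂.mem_nhds (hl₂ hy))).differentiableAt (by simp)
    have hd : DifferentiableAt ℝ F (F' y) :=
      (hF.smooth.contDiffAt (h₁.mem_nhds (hl₁ (mapsTo y hy)))).differentiableAt (by simp)
    rw [← form y hy u hu v hv, fderiv_comp y hd hd',
      ← hF.form (F' y) (mapsTo y hy) _ (tangentAt_map hd' mapsTo hu) _
        (tangentAt_map hd' mapsTo hv)]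
    rfl

/-! ### Radial-homogeneous and relative coordinates. -/

section RelativeMaps

variable {m : Fin 3 → ℝ} (hm : ∀ i, 0 < m i) (μ : ℝ)
/-- A section of the map to the relative coordinates. -/
def ofRelative (m : Fin 3 → ℝ) (μ : ℝ) (y : C3 × C3) : RadialPhase :=
  -- The representative with `X = Q`, hence `|X| = r`. Subtracting a complex multiple of `Q*`
  -- removes the radial and rotational parts of `P`, so that `⟨Z, X⟩ = 0` at angular momentum `μ`.
  (massNorm m y.1, (pairing y.2 y.1).re / massNorm m y.1, y.1,
    y.2 - ((((pairing y.2 y.1).re / massNorm m y.1 ^ 2 : ℝ) : ℂ) +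
      ((μ / massNorm m y.1 ^ 2 : ℝ) : ℂ) * Complex.I) • dualCovector m y.1)

theorem ofRelative_rotAct (u : Circle) (y : C3 × C3) :
    ofRelative m μ (rotAct u y) = scaleAct (Units.mk0 (u : ℂ) u.coe_ne_zero) (ofRelative m μ y) := by
  show ofRelative m μ ((u : ℂ) • y.1, (u : ℂ) • y.2) = _
  unfold ofRelative
  simp only
  rw [pairing_rotAct, massNorm_smul, Circle.norm_coe, one_mul, dualCovector_smul]
  refine Prod.ext rfl (Prod.ext rfl (Prod.ext rfl ?_))
  show _ = (conj (u : ℂ))⁻¹ • _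
  have hu : (conj (u : ℂ))⁻¹ = u := by
    rw [← Circle.coe_inv_eq_conj, ← Circle.coe_inv, inv_inv]
  rw [hu, smul_sub, smul_comm]

include hm

theorem pairing_dual_self (X : C3) :
    pairing (dualCovector m X) X = ((massNorm m X : ℝ) : ℂ) ^ 2 := by
  rw [pairing_dual, massMetric_self_eq hm]
  push_cast
  rfl

theorem pairing_momentumShift {x : RadialPhase} (hx : x ∈ radialDom) :
    pairing (momentumShift m μ x).2.2.2 (momentumShift m μ x).2.2.1 =
      pairing x.2.2.2 x.2.2.1 - μ * Complex.I := by
  show pairing (x.2.2.2 + ((μ / massNorm m x.2.2.1 ^ 2 : ℝ) * Complex.I) •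
    dualCovector m x.2.2.1) x.2.2.1 = _
  have hn : (massNorm m x.2.2.1 : ℂ) ≠ 0 := by exact_mod_cast (massNorm_pos hm (hx.2 0)).ne'
  rw [pairing_add_left, pairing_smul_left, pairing_dual_self hm, map_mul, Complex.conj_ofReal,
    Complex.conj_I]
  push_cast
  field_simp
  ring

/-- Links the two level sets: where `⟨Z, X⟩ = 0`, the imaginary part is `-μ` and the real part `r
p_r` recovers the radial momentum. -/
theorem pairing_toRelative {x : RadialPhase} (hx : x ∈ radialDom) :
    pairing (toRelative m μ x).2 (toRelative m μ x).1 =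
      x.1 * x.2.1 + pairing x.2.2.2 x.2.2.1 - μ * Complex.I := by
  have hn : (massNorm m x.2.2.1 : ℂ) ≠ 0 := by exact_mod_cast (massNorm_pos hm (hx.2 0)).ne'
  have hr : (x.1 : ℂ) ≠ 0 := by exact_mod_cast hx.1.ne'
  have h : pairing (toRelative m μ x).2 (toRelative m μ x).1 =
      ((x.1 / massNorm m x.2.2.1 : ℝ) : ℂ) * (((x.2.1 / massNorm m x.2.2.1 : ℝ) : ℂ) *
        pairing (dualCovector m x.2.2.1) x.2.2.1 + ((massNorm m x.2.2.1 / x.1 : ℝ) : ℂ) *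
        pairing (momentumShift m μ x).2.2.2 (momentumShift m μ x).2.2.1) := by
    rw [show (momentumShift m μ x).2.2.1 = x.2.2.1 from rfl, ← pairing_real_smul_left,
      ← pairing_real_smul_left, ← pairing_add_left,
      ← pairing_real_smul_right]
    rfl
  rw [h, pairing_momentumShift hm μ hx, pairing_dual_self hm]
  push_cast
  field_simp
  ring

theorem fderiv_fromRadial {x : RadialPhase} (hr : x.1 ≠ 0) (h0 : x.2.2.1 0 ≠ 0)
    (u : RadialPhase) : fderiv ℝ (fromRadial m) x u =
      ((x.1 / massNorm m x.2.2.1) • u.2.2.1 +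
        ((u.1 * massNorm m x.2.2.1 -
          x.1 * ((massMetric m x.2.2.1 u.2.2.1).re / massNorm m x.2.2.1)) /
          massNorm m x.2.2.1 ^ 2) • x.2.2.1,
      (x.2.1 / massNorm m x.2.2.1) • dualCovector m u.2.2.1 +
        ((u.2.1 * massNorm m x.2.2.1 -
          x.2.1 * ((massMetric m x.2.2.1 u.2.2.1).re / massNorm m x.2.2.1)) /
          massNorm m x.2.2.1 ^ 2) • dualCovector m x.2.2.1 +
        ((massNorm m x.2.2.1 / x.1) • u.2.2.2 +
          (((massMetric m x.2.2.1 u.2.2.1).re / massNorm m x.2.2.1 * x.1 -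
            massNorm m x.2.2.1 * u.1) / x.1 ^ 2) • x.2.2.2)) := by
  refine fderiv_eq_of_line ((contDiffAt_fromRadial hm hr h0).differentiableAt (by simp)) ?_
  have hX := hasDerivAt_line x.2.2.1 u.2.2.1 0
  have e0 : x.2.2.1 + (0 : ℝ) • u.2.2.1 = x.2.2.1 := by simp
  have hpos := massNorm_pos hm h0
  have hn := hasDerivAt_massNorm hm hX (by rw [e0]; exact h0)
  have hn0 : massNorm m (x.2.2.1 + (0 : ℝ) • u.2.2.1) ≠ 0 := by rw [e0]; exact hpos.ne'
  have hr1 := hasDerivAt_line x.1 u.1 0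
  have := (((hr1.fun_div hn hn0).fun_smul hX).prodMk
    ((((hasDerivAt_line x.2.1 u.2.1 0).fun_div hn hn0).fun_smul
      (hasDerivAt_dualCovector m hX)).fun_add
      ((hn.fun_div hr1 (by simpa using hr)).fun_smul (hasDerivAt_line x.2.2.2 u.2.2.2 0))))
  refine this.congr_deriv ?_
  simp only [zero_smul, add_zero]

/-- The change to radial-homogeneous coordinates preserves the standard forms on the set where
`Re ⟨Y, X⟩ = 0`. -/
theorem stdForm_fromRadial {x : RadialPhase} (hr : x.1 ≠ 0) (h0 : x.2.2.1 0 ≠ 0)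
    (hx : (pairing x.2.2.2 x.2.2.1).re = 0) {u v : RadialPhase}
    (hu : (pairing u.2.2.2 x.2.2.1 + pairing x.2.2.2 u.2.2.1).re = 0)
    (hv : (pairing v.2.2.2 x.2.2.1 + pairing x.2.2.2 v.2.2.1).re = 0) :
    stdForm (fromRadial m x) (fderiv ℝ (fromRadial m) x u) (fderiv ℝ (fromRadial m) x v) =
      stdFormRadial x u v := by
  rw [fderiv_fromRadial hm hr h0, fderiv_fromRadial hm hr h0]
  have hpos := (massNorm_pos hm h0).ne'
  have e1 : (massMetric m x.2.2.1 x.2.2.1).re = massNorm m x.2.2.1 ^ 2 := (massNorm_sq hm _).symm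
  -- Real dimension drops from 14 to 12, so the form can be preserved only in constrained
  -- directions; there `Re⟨Y', X⟩` is replaced by `-Re⟨Y, X'⟩`.
  rw [Complex.add_re] at hu hv
  have hu' := eq_neg_of_add_eq_zero_left hu
  have hv' := eq_neg_of_add_eq_zero_left hv
  simp only [stdForm, stdFormRadial, pairing_add_left, pairing_add_right, pairing_real_smul_left,
    pairing_real_smul_right, pairing_dual, Complex.add_re, Complex.re_ofReal_mul, e1, hx, hu', hv',
    massMetric_re_comm m u.2.2.1 x.2.2.1, massMetric_re_comm m v.2.2.1 x.2.2.1,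
    massMetric_re_comm m v.2.2.1 u.2.2.1]
  field_simp
  ring

/-- The shift pulls the standard form back to the twisted one, and the radial map preserves the
standard form where `Re⟨Y, X⟩ = 0`. The shift changes `⟨Z, X⟩` by the imaginary constant `-iμ`, so
both constraints carry over. -/
theorem stdForm_toRelative {x : RadialPhase} (hx : x ∈ radialDom)
    (h0 : pairing x.2.2.2 x.2.2.1 = 0) {u v : RadialPhase}
    (hu : pairing u.2.2.2 x.2.2.1 + pairing x.2.2.2 u.2.2.1 = 0)
    (hv : pairing v.2.2.2 x.2.2.1 + pairing x.2.2.2 v.2.2.1 = 0) :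
    stdForm (toRelative m μ x) (fderiv ℝ (toRelative m μ) x u) (fderiv ℝ (toRelative m μ) x v) =
      twistedForm m μ x u v := by
  have hds : DifferentiableAt ℝ (momentumShift m μ) x :=
    (contDiffAt_momentumShift μ hm (hx.2 0)).differentiableAt (by simp)
  have hdf : DifferentiableAt ℝ (fromRadial m) (momentumShift m μ x) :=
    (contDiffAt_fromRadial hm (x := momentumShift m μ x) hx.1.ne' (hx.2 0)).differentiableAt
      (by simp)
  have hc : fderiv ℝ (toRelative m μ) x =
      (fderiv ℝ (fromRadial m) (momentumShift m μ x)).comp (fderiv ℝ (momentumShift m μ) x) :=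
    fderiv_comp x hdf hds
  have hp : Differentiable ℝ (fun y : RadialPhase => pairing y.2.2.2 y.2.2.1) :=
    (contDiff_pairing.comp (f := fun y : RadialPhase => (y.2.2.2, y.2.2.1))
      (by fun_prop)).differentiable (by simp)
  have key : ∀ w : RadialPhase, pairing w.2.2.2 x.2.2.1 + pairing x.2.2.2 w.2.2.1 = 0 →
      (pairing (fderiv ℝ (momentumShift m μ) x w).2.2.2 (momentumShift m μ x).2.2.1 +
        pairing (momentumShift m μ x).2.2.2 (fderiv ℝ (momentumShift m μ) x w).2.2.1).re = 0 := by
    intro w hw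
    rw [← fderiv_pairing]
    have h1 := fderiv_comp x (hp _) hds
    have h2 : ((fun y : RadialPhase => pairing y.2.2.2 y.2.2.1) ∘ momentumShift m μ) =ᶠ[𝓝 x]
        fun y : RadialPhase => pairing y.2.2.2 y.2.2.1 - μ * Complex.I :=
      Filter.eventually_of_mem (isOpen_radialDom.mem_nhds hx) fun y hy =>
        pairing_momentumShift hm μ hy
    rw [h2.fderiv_eq, fderiv_sub_const] at h1
    have h3 := DFunLike.congr_fun h1 w
    rw [fderiv_pairing, hw] at h3
    rw [show fderiv ℝ (fun y : RadialPhase => pairing y.2.2.2 y.2.2.1) (momentumShift m μ x)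
      (fderiv ℝ (momentumShift m μ) x w) = 0 from h3.symm, Complex.zero_re]
  rw [hc, ← stdFormRadial_momentumShift μ hm (hx.2 0)]
  refine stdForm_fromRadial hm (x := momentumShift m μ x) hx.1.ne' (hx.2 0) ?_ (key u hu) (key v hv)
  rw [pairing_momentumShift hm μ hx, h0]
  simp

theorem contDiffAt_ofRelative {y : C3 × C3} (h0 : y.1 0 ≠ 0) :
    ContDiffAt ℝ ∞ (ofRelative m μ) y := by
  have hn : ContDiffAt ℝ ∞ (fun y : C3 × C3 => massNorm m y.1) y :=
    ContDiffAt.comp y (g := massNorm m) (contDiffAt_massNorm hm h0) contDiffAt_fst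
  have hn0 := (massNorm_pos hm h0).ne'
  have hp : ContDiffAt ℝ ∞ (fun y : C3 × C3 => (pairing y.2 y.1).re) y :=
    (Complex.reCLM.contDiff.comp
      (contDiff_pairing.comp (f := fun y : C3 × C3 => (y.2, y.1)) (by fun_prop))).contDiffAt
  have hd : ContDiffAt ℝ ∞ (fun y : C3 × C3 => dualCovector m y.1) y :=
    ContDiffAt.comp y (contDiff_dualCovector m).contDiffAt contDiffAt_fst
  have hc : ∀ {f : C3 × C3 → ℝ}, ContDiffAt ℝ ∞ f y → ContDiffAt ℝ ∞ (fun y => (f y : ℂ)) y :=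
    fun hf => Complex.ofRealCLM.contDiff.contDiffAt.comp y hf
  have hn2 := pow_ne_zero 2 hn0
  exact hn.prodMk ((hp.div hn hn0).prodMk (contDiffAt_fst.prodMk (contDiffAt_snd.sub
    (((hc (hp.div (hn.pow 2) hn2)).add
      ((hc (contDiffAt_const.div (hn.pow 2) hn2)).mul contDiffAt_const)).smul hd))))

theorem ofRelative_mem_radialDom {y : C3 × C3} (hy : ∀ i, y.1 i ≠ 0) :
    ofRelative m μ y ∈ radialDom := ⟨massNorm_pos hm (hy 0), hy⟩

theorem pairing_ofRelative {y : C3 × C3} (hy : ∀ i, y.1 i ≠ 0) (h : -(pairing y.2 y.1).im = μ) :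
    pairing (ofRelative m μ y).2.2.2 (ofRelative m μ y).2.2.1 = 0 := by
  have hn : (massNorm m y.1 : ℂ) ≠ 0 := by exact_mod_cast (massNorm_pos hm (hy 0)).ne'
  show pairing (y.2 - _) y.1 = 0
  rw [sub_eq_add_neg, pairing_add_left, pairing_neg_left, pairing_smul_left, pairing_dual_self hm]
  simp only [map_add, map_mul, Complex.conj_ofReal, Complex.conj_I]
  push_cast
  rw [← sub_eq_add_neg]
  have h2 : (((pairing y.2 y.1).re : ℂ) / (massNorm m y.1 : ℂ) ^ 2 +
      (μ : ℂ) / (massNorm m y.1 : ℂ) ^ 2 * -Complex.I) * (massNorm m y.1 : ℂ) ^ 2 =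
      (pairing y.2 y.1).re - μ * Complex.I := by
    field_simp
    ring
  rw [h2, ← h]
  apply Complex.ext <;> simp

theorem toRelative_ofRelative {y : C3 × C3} (hy : ∀ i, y.1 i ≠ 0) :
    toRelative m μ (ofRelative m μ y) = y := by
  have hn0 := (massNorm_pos hm (hy 0)).ne'
  have hn : (massNorm m y.1 : ℂ) ≠ 0 := by exact_mod_cast hn0
  rw [toRelative_apply]
  refine Prod.ext ?_ ?_
  · show (massNorm m y.1 / massNorm m y.1) • y.1 = y.1
    rw [div_self hn0, one_smul]
  · funext i
    simp only [ofRelative, Pi.add_apply, Pi.smul_apply, Pi.sub_apply, Complex.real_smul,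
      smul_eq_mul]
    push_cast
    field_simp
    ring

/-- The section normalizes `|X|` to `r`, so the round trip is scaling by `r / |X|`. -/
theorem ofRelative_toRelative {x : RadialPhase} (hx : x ∈ radialDom)
    (h0 : pairing x.2.2.2 x.2.2.1 = 0) :
    ∃ k : ℂˣ, ofRelative m μ (toRelative m μ x) = scaleAct k x := by
  have hn0 := massNorm_pos hm (hx.2 0)
  have hn : (massNorm m x.2.2.1 : ℂ) ≠ 0 := by exact_mod_cast hn0.ne'
  have hr : (x.1 : ℂ) ≠ 0 := by exact_mod_cast hx.1.ne'
  have e1 : massNorm m (toRelative m μ x).1 = x.1 := by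
    show massNorm m ((x.1 / massNorm m x.2.2.1) • x.2.2.1) = _
    rw [real_smul_eq, massNorm_smul, Complex.norm_real, Real.norm_of_nonneg (by
      have := hx.1; positivity), div_mul_cancel₀ _ hn0.ne']
  have e2 : (pairing (toRelative m μ x).2 (toRelative m μ x).1).re = x.1 * x.2.1 := by
    rw [pairing_toRelative hm μ hx, h0, ← Complex.ofReal_mul]
    simp
  refine ⟨Units.mk0 ((x.1 / massNorm m x.2.2.1 : ℝ) : ℂ) ?_, ?_⟩
  · push_cast
    exact div_ne_zero hr hn
  · unfold ofRelative
    rw [e1, e2]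
    refine Prod.ext rfl (Prod.ext ?_ (Prod.ext ?_ ?_))
    · exact mul_div_cancel_left₀ _ hx.1.ne'
    · exact real_smul_eq _ _
    · funext i
      show (toRelative m μ x).2 i - (((x.1 * x.2.1 / x.1 ^ 2 : ℝ) : ℂ) +
        ((μ / x.1 ^ 2 : ℝ) : ℂ) * Complex.I) *
          dualCovector m ((x.1 / massNorm m x.2.2.1) • x.2.2.1) i =
        (conj ((x.1 / massNorm m x.2.2.1 : ℝ) : ℂ))⁻¹ * x.2.2.2 i
      rw [toRelative_apply, Complex.conj_ofReal, dualCovector_real_smul]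
      simp only [Pi.add_apply, Pi.smul_apply, Complex.real_smul, smul_eq_mul]
      push_cast
      field_simp
      ring

theorem toRelative_partiallySymplectic (h : RadialPhase → ℝ) :
    (projectiveSystem m μ h).PartiallySymplectic (relativeSystem m μ) (toRelative m μ) where
  smooth x hx := (contDiffAt_toRelative hm μ hx).contDiffWithinAt
  mapsTo := by
    rintro x ⟨hx, h0⟩
    refine ⟨fromRadial_ne_zero hm (x := momentumShift m μ x) hx, ?_⟩
    rw [pairing_toRelative hm μ hx, h0, ← Complex.ofReal_mul]
    simp
  orbits := by
    rintro x ⟨hx, -⟩ k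
    refine ⟨⟨(k : ℂ) / (‖(k : ℂ)‖ : ℂ), mem_sphere_zero_iff_norm.2
      (norm_div_norm_self k.ne_zero)⟩, ?_⟩
    have := toRelative_scaleTrans hm μ hx ⟨k, 0⟩
    rw [← scaleAct_eq] at this
    refine this.trans (Prod.ext rfl ?_)
    funext i
    simp only [mul_zero]
    exact add_zero _
  form := by
    rintro x ⟨hx, h0⟩ u hu v hv
    have hφ : ∀ w ∈ tangentAt (projectiveSystem m μ h).level x,
        pairing w.2.2.2 x.2.2.1 + pairing x.2.2.2 w.2.2.1 = 0 := by
      intro w hw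
      rw [← fderiv_pairing]
      have hp : Differentiable ℝ (fun y : RadialPhase => pairing y.2.2.2 y.2.2.1) :=
        (contDiff_pairing.comp (f := fun y : RadialPhase => (y.2.2.2, y.2.2.1))
          (by fun_prop)).differentiable (by simp)
      rw [fderiv_eq_of_tangentAt (g := fun _ => 0) (hp x) (differentiableAt_const _)
        (fun y hy => hy.2) hw]
      simp
    exact stdForm_toRelative hm μ hx h0 (hφ u hu) (hφ v hv)

theorem ofRelative_mapsTo (h : RadialPhase → ℝ) :
    ∀ y ∈ (relativeSystem m μ).level, ofRelative m μ y ∈ (projectiveSystem m μ h).level :=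
  fun _ hy => ⟨ofRelative_mem_radialDom hm μ hy.1, pairing_ofRelative hm μ hy.1 hy.2⟩

theorem ofRelative_partiallySymplectic (h : RadialPhase → ℝ) :
    (relativeSystem m μ).PartiallySymplectic (projectiveSystem m μ h) (ofRelative m μ) := by
  refine (toRelative_partiallySymplectic hm μ h).of_comp isOpen_radialDom isOpen_ne_zero
    (fun x hx => hx.1) (fun x hx => hx.1)
    (fun y hy => (contDiffAt_ofRelative hm μ (hy 0)).contDiffWithinAt)
    (ofRelative_mapsTo hm μ h) (fun y _ u => ⟨_, ofRelative_rotAct μ u y⟩) ?_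
  rintro y ⟨hy, -⟩ u - v -
  have h2 : toRelative m μ ∘ ofRelative m μ =ᶠ[𝓝 y] fun z => z :=
    Filter.eventually_of_mem (isOpen_ne_zero.mem_nhds hy) fun z hz =>
      toRelative_ofRelative hm μ hz
  rw [h2.fderiv_eq, toRelative_ofRelative hm μ hy]
  simp

end RelativeMaps

/-! ### The difference matrix, absolute coordinates and the kinetic energy. -/

section Differences

/-- The differences of the components of a triple. This map takes positions to relative positions,
and relative momenta to momenta. -/
def differences : C3 →L[ℂ] C3 := LinearMap.toContinuousLinearMap
  { toFun := fun x => ![x 0 - x 1, x 2 - x 0, x 1 - x 2]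
    map_add' := fun x y => by
      funext i
      fin_cases i
      exacts [add_sub_add_comm _ _ _ _, add_sub_add_comm _ _ _ _, add_sub_add_comm _ _ _ _]
    map_smul' := fun k x => by
      funext i
      fin_cases i
      exacts [(mul_sub _ _ _).symm, (mul_sub _ _ _).symm, (mul_sub _ _ _).symm] }

theorem differences_zero (x : C3) : differences x 0 = x 0 - x 1 := rfl

theorem differences_one (x : C3) : differences x 1 = x 2 - x 0 := rfl

theorem differences_two (x : C3) : differences x 2 = x 1 - x 2 := rfl

theorem differences_const (c : ℂ) : differences (fun _ => c) = 0 := by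
  funext i
  fin_cases i
  exacts [sub_self c, sub_self c, sub_self c]

theorem sum_differences (x : C3) : ∑ i, differences x i = 0 := by
  rw [Fin.sum_univ_three, differences_zero, differences_one, differences_two]
  ring

/-- The order `12, 31, 23` of the pairs makes the matrix of differences symmetric. -/
theorem pairing_differences (P Q : C3) :
    pairing (differences P) Q = pairing P (differences Q) := by
  simp only [pairing, Fin.sum_univ_three, differences_zero, differences_one, differences_two,
    map_sub]
  ring

/-- The square is three times the projection removing the mean. Hence the differences and one third
of the differences are inverse to each other on triples of sum zero, which accounts for the factors
in `toAbsolute` and `ofAbsolute`. -/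
theorem differences_differences (x : C3) :
    differences (differences x) = (3 : ℂ) • x - fun _ => ∑ i, x i := by
  funext i
  fin_cases i
  · show differences (differences x) 0 = 3 * x 0 - ∑ i, x i
    rw [Fin.sum_univ_three, differences_zero, differences_zero, differences_one]
    ring
  · show differences (differences x) 1 = 3 * x 1 - ∑ i, x i
    rw [Fin.sum_univ_three, differences_one, differences_two, differences_zero]
    ring
  · show differences (differences x) 2 = 3 * x 2 - ∑ i, x i
    rw [Fin.sum_univ_three, differences_two, differences_one, differences_two]
    ring

theorem third_smul_differences (x : C3) : (1 / 3 : ℂ) • differences (differences x) =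
    x + fun _ => -((1 / 3 : ℂ) * ∑ i, x i) := by
  rw [differences_differences]
  funext i
  show (1 / 3 : ℂ) * (3 * x i - ∑ i, x i) = x i + -((1 / 3 : ℂ) * ∑ i, x i)
  ring

theorem third_smul_differences_of_sum {x : C3} (hx : ∑ i, x i = 0) :
    (1 / 3 : ℂ) • differences (differences x) = x := by
  rw [third_smul_differences, hx]
  funext i
  simp

theorem differences_ne_zero {x : C3} (hx : Function.Injective x) (i : Fin 3) :
    differences x i ≠ 0 := by
  fin_cases i
  · exact sub_ne_zero.2 fun h => absurd (hx h) (by decide)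
  · exact sub_ne_zero.2 fun h => absurd (hx h) (by decide)
  · exact sub_ne_zero.2 fun h => absurd (hx h) (by decide)

theorem injective_of_differences_ne_zero {x : C3} (hx : ∀ i, differences x i ≠ 0) :
    Function.Injective x := by
  have h0 : x 0 ≠ x 1 := sub_ne_zero.1 (hx 0)
  have h1 : x 2 ≠ x 0 := sub_ne_zero.1 (hx 1)
  have h2 : x 1 ≠ x 2 := sub_ne_zero.1 (hx 2)
  intro i j hij
  fin_cases i <;> fin_cases j
  · rfl
  · exact absurd hij h0
  · exact absurd hij.symm h1
  · exact absurd hij.symm h0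
  · rfl
  · exact absurd hij h2
  · exact absurd hij h1
  · exact absurd hij.symm h2
  · rfl

/-- From relative to absolute coordinates. -/
def toAbsolute : C3 × C3 →L[ℝ] C3 × C3 :=
  (((1 / 3 : ℂ) • differences).restrictScalars ℝ).prodMap (differences.restrictScalars ℝ)

/-- From absolute to relative coordinates. -/
def ofAbsolute : C3 × C3 →L[ℝ] C3 × C3 :=
  (differences.restrictScalars ℝ).prodMap (((1 / 3 : ℂ) • differences).restrictScalars ℝ)

theorem toAbsolute_apply (x : C3 × C3) :
    toAbsolute x = ((1 / 3 : ℂ) • differences x.1, differences x.2) := rfl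

theorem ofAbsolute_apply (x : C3 × C3) :
    ofAbsolute x = (differences x.1, (1 / 3 : ℂ) • differences x.2) := rfl

theorem pairing_toAbsolute (x : C3 × C3) (y : C3 × C3) (hx : ∑ i, x.1 i = 0) :
    pairing (toAbsolute y).2 (toAbsolute x).1 = pairing y.2 x.1 := by
  rw [toAbsolute_apply, toAbsolute_apply, pairing_differences, map_smul,
    third_smul_differences_of_sum hx]

theorem pairing_ofAbsolute (x : C3 × C3) (y : C3 × C3) (hy : ∑ i, y.2 i = 0) :
    pairing (ofAbsolute y).2 (ofAbsolute x).1 = pairing y.2 x.1 := by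
  rw [ofAbsolute_apply, ofAbsolute_apply, ← pairing_differences, map_smul,
    third_smul_differences_of_sum hy]

theorem stdForm_toAbsolute {x y u v : C3 × C3} (hu : ∑ i, u.1 i = 0) (hv : ∑ i, v.1 i = 0) :
    stdForm y (toAbsolute u) (toAbsolute v) = stdForm x u v := by
  simp only [stdForm, pairing_toAbsolute _ _ hu, pairing_toAbsolute _ _ hv]

theorem stdForm_ofAbsolute {x y u v : C3 × C3} (hu : ∑ i, u.2 i = 0) (hv : ∑ i, v.2 i = 0) :
    stdForm y (ofAbsolute u) (ofAbsolute v) = stdForm x u v := by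
  simp only [stdForm, pairing_ofAbsolute _ _ hu, pairing_ofAbsolute _ _ hv]

variable {m : Fin 3 → ℝ}

theorem hamThreeBody_eq (x : C3 × C3) : hamThreeBody m x =
    ∑ i, ‖x.2 i‖ ^ 2 / (2 * m i) - potential m (differences x.1) := by
  simp only [hamThreeBody, potential, pairMass, Fin.sum_univ_three, differences_zero,
    differences_one, differences_two]
  rfl

theorem hamThreeBody_toAbsolute {x : C3 × C3} (hx : ∑ i, x.1 i = 0) :
    hamThreeBody m (toAbsolute x) = hamRel m x := by
  rw [hamThreeBody_eq, toAbsolute_apply, map_smul, third_smul_differences_of_sum hx]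
  simp only [Fin.sum_univ_three, differences_zero, differences_one, differences_two]
  rfl

/-- The differences of `P` are the momenta of the bodies; writing the energy as momenta paired with
velocities prepares the expansion in `kinetic_add`. -/
theorem kinetic_eq (P : C3) : kinetic m P =
    1 / 2 * (pairing (differences P) (fun i => differences P i / (m i : ℂ))).re := by
  have h : ∀ i, (conj (differences P i) * (differences P i / (m i : ℂ))).re =
      ‖differences P i‖ ^ 2 / m i := fun i => by
    rw [mul_div_assoc', ← Complex.normSq_eq_conj_mul_self, Complex.normSq_eq_norm_sq,
      ← Complex.ofReal_div, Complex.ofReal_re]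
  rw [pairing, Complex.re_sum, Finset.sum_congr rfl fun i _ => h i, Fin.sum_univ_three,
    differences_zero, differences_one, differences_two, kinetic]
  ring

theorem pairing_div_mass (P Q : C3) : pairing P (fun i => Q i / (m i : ℂ)) =
    pairing (fun i => P i / (m i : ℂ)) Q := by
  simp only [pairing, map_div₀, Complex.conj_ofReal]
  exact Finset.sum_congr rfl fun i _ => by ring

variable (hm : ∀ i, 0 < m i)
include hm

/-- The velocities which belong to the dual covector of a triangle. -/
theorem differences_dual {X : C3} (hX : ∑ i, X i = 0) :
    differences (fun i => differences (dualCovector m X) i / (m i : ℂ)) = X := by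
  have h0 : (m 0 : ℂ) ≠ 0 := by exact_mod_cast (hm 0).ne'
  have h1 : (m 1 : ℂ) ≠ 0 := by exact_mod_cast (hm 1).ne'
  have h2 : (m 2 : ℂ) ≠ 0 := by exact_mod_cast (hm 2).ne'
  have ht : (m 0 : ℂ) + m 1 + m 2 ≠ 0 := by
    have := totalMass_pos hm
    rw [totalMass, Fin.sum_univ_three] at this
    exact_mod_cast this.ne'
  have hM : ((totalMass m : ℝ) : ℂ) = m 0 + m 1 + m 2 := by
    rw [totalMass, Fin.sum_univ_three]
    push_cast
    rfl
  rw [Fin.sum_univ_three] at hX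
  have d0 : dualCovector m X 0 = (m 0 * m 1 / (m 0 + m 1 + m 2) : ℂ) * X 0 := by
    rw [← hM, ← Complex.ofReal_mul, ← Complex.ofReal_div]; rfl
  have d1 : dualCovector m X 1 = (m 2 * m 0 / (m 0 + m 1 + m 2) : ℂ) * X 1 := by
    rw [← hM, ← Complex.ofReal_mul, ← Complex.ofReal_div]; rfl
  have d2 : dualCovector m X 2 = (m 1 * m 2 / (m 0 + m 1 + m 2) : ℂ) * X 2 := by
    rw [← hM, ← Complex.ofReal_mul, ← Complex.ofReal_div]; rfl
  funext i
  fin_cases i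
  · show differences (dualCovector m X) 0 / (m 0 : ℂ) - differences (dualCovector m X) 1 / (m 1 : ℂ)
      = X 0
    rw [differences_zero, differences_one, d0, d1, d2]
    field_simp
    -- After clearing denominators the defect for a pair is a multiple of `∑ X`, with the mass of
    -- the third body as coefficient.
    linear_combination (-(m 2 : ℂ)) * hX
  · show differences (dualCovector m X) 2 / (m 2 : ℂ) - differences (dualCovector m X) 0 / (m 0 : ℂ)
      = X 1
    rw [differences_two, differences_zero, d0, d1, d2]
    field_simp
    linear_combination (-(m 1 : ℂ)) * hX
  · show differences (dualCovector m X) 1 / (m 1 : ℂ) - differences (dualCovector m X) 2 / (m 2 : ℂ)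
      = X 2
    rw [differences_one, differences_two, d0, d1, d2]
    field_simp
    linear_combination (-(m 0 : ℂ)) * hX

/-- Pythagoras for the kinetic form: the relative velocities belonging to `X*` are `X` itself, by
`differences_dual`, so the mixed terms are multiples of `⟨Z, X⟩` or its conjugate. -/
theorem kinetic_add {X Z : C3} (hX : ∑ i, X i = 0) (hZ : pairing Z X = 0) (α : ℂ) (β : ℝ) :
    kinetic m (α • dualCovector m X + β • Z) =
      1 / 2 * (‖α‖ ^ 2 * massNorm m X ^ 2) + β ^ 2 * kinetic m Z := by
  set q : C3 := fun i => differences (dualCovector m X) i / (m i : ℂ) with hq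
  have hqX : differences q = X := differences_dual hm hX
  have e1 : differences (α • dualCovector m X + β • Z) =
      α • differences (dualCovector m X) + (β : ℂ) • differences Z := by
    rw [real_smul_eq, map_add, map_smul, map_smul]
  have e2 : (fun i => (α • differences (dualCovector m X) + (β : ℂ) • differences Z) i / (m i : ℂ))
      = α • q + (β : ℂ) • fun i => differences Z i / (m i : ℂ) := by
    funext i
    simp only [hq, Pi.add_apply, Pi.smul_apply, smul_eq_mul]
    ring
  have e3 : pairing (differences Z) q = 0 := by rw [pairing_differences, hqX, hZ]
  have e4 : pairing q (differences Z) = 0 := by rw [← pairing_conj, e3, map_zero]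
  have e5 : pairing (differences (dualCovector m X)) q = ((massNorm m X ^ 2 : ℝ) : ℂ) := by
    rw [pairing_differences, hqX, pairing_dual_self hm]
    push_cast
    rfl
  have h : conj α * (α * ((massNorm m X ^ 2 : ℝ) : ℂ)) =
      ((‖α‖ ^ 2 * massNorm m X ^ 2 : ℝ) : ℂ) := by
    rw [← mul_assoc, ← Complex.normSq_eq_conj_mul_self, Complex.normSq_eq_norm_sq,
      Complex.ofReal_mul]
  have key : pairing (α • differences (dualCovector m X) + (β : ℂ) • differences Z)
      (α • q + (β : ℂ) • fun i => differences Z i / (m i : ℂ)) =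
      ((‖α‖ ^ 2 * massNorm m X ^ 2 : ℝ) : ℂ) + ((β ^ 2 : ℝ) : ℂ) *
        pairing (differences Z) (fun i => differences Z i / (m i : ℂ)) := by
    simp only [pairing_add_left, pairing_add_right, pairing_smul_left, pairing_smul_right, e3, e5]
    rw [pairing_div_mass (differences (dualCovector m X)), e4, Complex.conj_ofReal,
      Complex.ofReal_pow β]
    linear_combination h
  rw [kinetic_eq, e1, e2, key, kinetic_eq, Complex.add_re, Complex.ofReal_re,
    Complex.re_ofReal_mul]
  ring

/-- Radial momentum and shift combine into the coefficient `α = (p_r + iμ / r) / |X|` of `X*`, and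
`|α|² |X|² = p_r² + μ² / r²`. -/
theorem hamMu_eq_explicit (μ : ℝ) {x : RadialPhase} (hx : x ∈ radialDom)
    (h0 : pairing x.2.2.2 x.2.2.1 = 0) (hX : ∑ i, x.2.2.1 i = 0) :
    hamMu m μ x = hamMuExplicit m μ x := by
  have hn0 := massNorm_pos hm (hx.2 0)
  have hn : (massNorm m x.2.2.1 : ℂ) ≠ 0 := by exact_mod_cast hn0.ne'
  have hr : (x.1 : ℂ) ≠ 0 := by exact_mod_cast hx.1.ne'
  have e1 : (toRelative m μ x).2 = (((x.2.1 / massNorm m x.2.2.1 : ℝ) : ℂ) +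
      ((μ / (x.1 * massNorm m x.2.2.1) : ℝ) : ℂ) * Complex.I) • dualCovector m x.2.2.1 +
        (massNorm m x.2.2.1 / x.1) • x.2.2.2 := by
    rw [toRelative_apply]
    funext i
    simp only [Pi.add_apply, Pi.smul_apply, Complex.real_smul, smul_eq_mul]
    push_cast
    field_simp
    ring
  have e2 : potential m (toRelative m μ x).1 = massNorm m x.2.2.1 / x.1 * potential m x.2.2.1 := by
    rw [toRelative_apply]
    simp only
    rw [real_smul_eq, potential_smul, Complex.norm_real, Real.norm_of_nonneg (by
      have := hx.1; positivity), inv_div]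
  show kinetic m (toRelative m μ x).2 - potential m (toRelative m μ x).1 =
    1 / 2 * (x.2.1 ^ 2 + μ ^ 2 / x.1 ^ 2) + massNorm m x.2.2.1 ^ 2 / x.1 ^ 2 *
    kinetic m x.2.2.2 - 1 / x.1 * (massNorm m x.2.2.1 * potential m x.2.2.1)
  rw [e1, e2, kinetic_add hm hX h0, ← Complex.normSq_eq_norm_sq, Complex.normSq_add_mul_I]
  have hr0 := hx.1.ne'
  have hn0' := hn0.ne'
  field_simp

end Differences

/-! ### Equivalence with the three-body problem. -/

section AbsoluteMaps

theorem finrank_C3 : Module.finrank ℝ C3 = 6 := by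
  show Module.finrank ℝ (Fin 3 → ℂ) = 6
  rw [Module.finrank_pi_fintype]
  simp [Complex.finrank_real_complex]

variable {m : Fin 3 → ℝ} (μ : ℝ)

/-- The map from radial-homogeneous coordinates to the coordinates of the three-body problem. -/
def toThreeBody (m : Fin 3 → ℝ) (μ : ℝ) (x : RadialPhase) : C3 × C3 := toAbsolute (toRelative m μ x)

/-- The map from the coordinates of the three-body problem to radial-homogeneous coordinates. -/
def ofThreeBody (m : Fin 3 → ℝ) (μ : ℝ) (y : C3 × C3) : RadialPhase := ofRelative m μ (ofAbsolute y)

/-- For `∑ Q = 0` a constant added to `P` leaves `⟨P, Q⟩` unchanged and passes directly to `Z`.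
Going to absolute coordinates and back alters `P` by such a constant. -/
theorem ofRelative_add_const (y : C3 × C3) (hy : ∑ i, y.1 i = 0) (c : ℂ) (k : ℂˣ)
    (x : RadialPhase) (hk : ofRelative m μ y = scaleAct k x) :
    ofRelative m μ (y.1, y.2 + fun _ => c) = ScaleTrans.act ⟨k, c⟩ x := by
  have h1 : ofRelative m μ (y.1, y.2 + fun _ => c) =
      ((ofRelative m μ y).1, (ofRelative m μ y).2.1, (ofRelative m μ y).2.2.1,
        (ofRelative m μ y).2.2.2 + fun _ => c) := by
    unfold ofRelative
    simp only
    rw [pairing_add_left, pairing_const_left, hy, mul_zero, add_zero]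
    refine Prod.ext rfl (Prod.ext rfl (Prod.ext rfl ?_))
    exact add_sub_right_comm _ _ _
  rw [h1, hk]
  rfl

theorem sum_toRelative {x : RadialPhase} (hX : ∑ i, x.2.2.1 i = 0) :
    ∑ i, (toRelative m μ x).1 i = 0 := by
  show ∑ i, ((x.1 / massNorm m x.2.2.1) • x.2.2.1) i = 0
  simp only [Pi.smul_apply, ← Finset.smul_sum, hX, smul_zero]

variable (hm : ∀ i, 0 < m i)
include hm

theorem toThreeBody_partiallySymplectic (h : RadialPhase → ℝ) :
    (shapeSystem m μ h).PartiallySymplectic (threeBodySystem m μ) (toThreeBody m μ) where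
  smooth x hx := (toAbsolute.contDiff.contDiffAt.comp x
    (contDiffAt_toRelative hm μ hx)).contDiffWithinAt
  mapsTo := by
    rintro x ⟨hx, h0, hX⟩
    have hs := sum_toRelative (m := m) μ hX
    obtain ⟨h1, h2⟩ := (toRelative_partiallySymplectic hm μ h).mapsTo x ⟨hx, h0⟩
    refine ⟨injective_of_differences_ne_zero fun i => ?_, sum_differences _, ?_⟩
    · show differences ((1 / 3 : ℂ) • differences (toRelative m μ x).1) i ≠ 0
      rw [map_smul, third_smul_differences_of_sum hs]
      exact h1 i
    · show -(pairing (toAbsolute _).2 (toAbsolute _).1).im = μ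
      rw [pairing_toAbsolute _ _ hs, h2]
  orbits := by
    rintro x ⟨hx, -⟩ g
    -- Taking differences kills the translation of the momenta, so only the phase of the scaling
    -- remains.
    refine ⟨⟨⟨(g.k : ℂ) / (‖(g.k : ℂ)‖ : ℂ), mem_sphere_zero_iff_norm.2
      (norm_div_norm_self g.k.ne_zero)⟩, 0⟩, ?_⟩
    refine (congrArg toAbsolute (toRelative_scaleTrans hm μ hx g)).trans ?_
    rw [toAbsolute_apply, map_add, differences_const, map_smul, map_smul]
    refine Prod.ext ?_ (add_zero _)
    exact (smul_comm _ _ _).trans (add_zero _).symm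
  form := by
    rintro x ⟨hx, h0, hX⟩ u hu v hv
    have hd : DifferentiableAt ℝ (toRelative m μ) x :=
      (contDiffAt_toRelative hm μ hx).differentiableAt (by simp)
    have hc : ∀ w, fderiv ℝ (toThreeBody m μ) x w = toAbsolute (fderiv ℝ (toRelative m μ) x w) :=
      fun w => DFunLike.congr_fun (toAbsolute.hasFDerivAt.comp x hd.hasFDerivAt).fderiv w
    have hs : ∀ w ∈ tangentAt (shapeSystem m μ h).level x,
        ∑ i, (fderiv ℝ (toRelative m μ) x w).1 i = 0 := by
      intro w hw
      have h1 : fderiv ℝ (toRelative m μ) x w ∈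
          tangentAt {y : C3 × C3 | ∑ i, y.1 i = 0} (toRelative m μ x) :=
        tangentAt_map hd (fun y hy => sum_toRelative μ hy.2.2) hw
      refine eq_zero_of_tangentAt (f := fun y : C3 × C3 => ∑ i, y.1 i) (by fun_prop) ?_ h1
        (HasDerivAt.fun_sum fun i _ => hasDerivAt_line_coord _ _ i 0)
      intro y hy
      exact Eq.trans hy (sum_toRelative μ hX).symm
    have hle : (shapeSystem m μ h).level ⊆ (projectiveSystem m μ h).level :=
      fun y hy => ⟨hy.1, hy.2.1⟩
    have hsub : ∀ w ∈ tangentAt (shapeSystem m μ h).level x,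
        w ∈ tangentAt (projectiveSystem m μ h).level x := tangentAt_mono hle x
    rw [hc, hc]
    have hx' : x ∈ (projectiveSystem m μ h).level := ⟨hx, h0⟩
    refine Eq.trans (stdForm_toAbsolute (x := toRelative m μ x) (y := toThreeBody m μ x)
      (hs u hu) (hs v hv)) ?_
    exact (toRelative_partiallySymplectic hm μ h).form x hx' u (hsub u hu) v (hsub v hv)

theorem ofThreeBody_mapsTo (h : RadialPhase → ℝ) :
    ∀ y ∈ (threeBodySystem m μ).level, ofThreeBody m μ y ∈ (shapeSystem m μ h).level := by
  rintro y ⟨hy, h1, h2⟩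
  have h3 : ∀ i, (ofAbsolute y).1 i ≠ 0 := differences_ne_zero hy
  refine ⟨ofRelative_mem_radialDom hm μ h3, pairing_ofRelative hm μ h3 ?_, sum_differences _⟩
  rw [pairing_ofAbsolute _ _ h1, h2]

theorem toThreeBody_ofThreeBody {y : C3 × C3} (hy : Function.Injective y.1) :
    toThreeBody m μ (ofThreeBody m μ y) = toAbsolute (ofAbsolute y) :=
  congrArg toAbsolute (toRelative_ofRelative hm μ (y := ofAbsolute y) (differences_ne_zero hy))

theorem ofThreeBody_partiallySymplectic (h : RadialPhase → ℝ) :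
    (threeBodySystem m μ).PartiallySymplectic (shapeSystem m μ h) (ofThreeBody m μ) := by
  refine (toThreeBody_partiallySymplectic μ hm h).of_comp isOpen_radialDom isOpen_injective
    (fun x hx => hx.1) (fun x hx => hx.1)
    (fun y hy => (ContDiffAt.comp y (g := ofRelative m μ) (f := ofAbsolute)
      (contDiffAt_ofRelative hm μ (differences_ne_zero hy 0))
      ofAbsolute.contDiff.contDiffAt).contDiffWithinAt)
    (ofThreeBody_mapsTo μ hm h) ?_ ?_
  · rintro y - g
    refine ⟨⟨Units.mk0 (g.u : ℂ) g.u.coe_ne_zero, 0⟩, ?_⟩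
    have h1 : ofAbsolute (RotTrans.act g y) = rotAct g.u (ofAbsolute y) := by
      show ofAbsolute ((g.u : ℂ) • y.1 + fun _ => g.c, (g.u : ℂ) • y.2) = _
      rw [ofAbsolute_apply, map_add, differences_const, map_smul, map_smul, add_zero, smul_comm]
      rfl
    show ofRelative m μ (ofAbsolute (RotTrans.act g y)) = ScaleTrans.act _ _
    rw [h1, ofRelative_rotAct, ← scaleAct_eq]
    rfl
  · rintro y ⟨hy, h1, h2⟩ u hu v hv
    -- The composite is not the identity but the projection removing the means of positions and
    -- momenta; it preserves the form on vectors of zero total momentum.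
    have h3 : (toThreeBody m μ ∘ ofThreeBody m μ) =ᶠ[𝓝 y] toAbsolute.comp ofAbsolute :=
      Filter.eventually_of_mem (isOpen_injective.mem_nhds hy) fun z hz =>
        toThreeBody_ofThreeBody μ hm hz
    have hs : ∀ w ∈ tangentAt (threeBodySystem m μ).level y, ∑ i, w.2 i = 0 := by
      intro w hw
      refine eq_zero_of_tangentAt (f := fun y : C3 × C3 => ∑ i, y.2 i) (by fun_prop) ?_ hw
        (HasDerivAt.fun_sum fun i _ => hasDerivAt_line_coord _ _ i 0)
      intro z hz
      exact hz.2.1.trans h1.symm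
    rw [h3.fderiv_eq, ContinuousLinearMap.fderiv]
    exact (stdForm_toAbsolute (x := y) (y := y) (sum_differences _) (sum_differences _)).trans
      (stdForm_ofAbsolute (x := y) (hs u hu) (hs v hv))

/-- Besides smoothness, only the invariance of `h` and its values on the level matter, so `H_μ` and
the explicit expression are treated at once. -/
theorem shapeSystem_equivalent {h : RadialPhase → ℝ} (hs : ContDiffOn ℝ ∞ h radialDom)
    (hinv : ∀ g, ∀ x ∈ radialDom, h (ScaleTrans.act g x) = h x)
    (hh : ∀ x ∈ (shapeSystem m μ h).level, hamMu m μ x = h x) :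
    (shapeSystem m μ h).Equivalent (threeBodySystem m μ) := by
  have M₁ := shapeSystem_hasMomentum (μ := μ) hm hs hinv
  refine M₁.equivalent threeBodySystem_hasMomentum ?_ (toThreeBody_partiallySymplectic μ hm h)
    (ofThreeBody_partiallySymplectic μ hm h) ?_ ?_ ?_
  -- Both reduced spaces have dimension six: `14 - 4 - 4 = 12 - 3 - 3`.
  · simp [finrank_C3, Complex.finrank_real_complex]
  · intro x hx
    show hamThreeBody m (toAbsolute (toRelative m μ x)) = h x
    rw [← hh x hx]
    exact hamThreeBody_toAbsolute (sum_toRelative μ hx.2.2)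
  · rintro x ⟨hx, h0, hX⟩
    obtain ⟨k, hk⟩ := ofRelative_toRelative hm μ hx h0
    have hsum := sum_toRelative (m := m) μ hX
    have e : ofAbsolute (toAbsolute (toRelative m μ x)) = ((toRelative m μ x).1,
        (toRelative m μ x).2 + fun _ => -((1 / 3 : ℂ) * ∑ i, (toRelative m μ x).2 i)) := by
      rw [toAbsolute_apply, ofAbsolute_apply]
      simp only
      rw [map_smul, third_smul_differences_of_sum hsum, third_smul_differences]
    have h2 : ofThreeBody m μ (toThreeBody m μ x) = ScaleTrans.act _ x :=
      (congrArg (ofRelative m μ) e).trans (ofRelative_add_const μ _ hsum _ k x hk)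
    -- The round trip scales by `k` and subtracts the mean of `P`; the inverse group element undoes
    -- both.
    refine ⟨(⟨k, -((1 / 3 : ℂ) * ∑ i, (toRelative m μ x).2 i)⟩ : ScaleTrans)⁻¹, ?_⟩
    rw [h2]
    show (shapeSystem m μ h).act _ ((shapeSystem m μ h).act _ x) = x
    rw [← SymHamSystem.act_mul, inv_mul_cancel, SymHamSystem.act_one]
  · rintro y ⟨hy, h1, h2⟩
    -- The round trip moves the centroid of the positions to the origin; translating by it restores
    -- them.
    refine ⟨⟨1, (1 / 3 : ℂ) * ∑ i, y.1 i⟩, ?_⟩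
    rw [toThreeBody_ofThreeBody μ hm hy, ofAbsolute_apply, toAbsolute_apply]
    simp only
    rw [map_smul, third_smul_differences_of_sum h1, third_smul_differences]
    refine Prod.ext ?_ ?_
    · funext i
      show ((1 : Circle) : ℂ) * (y.1 i + -((1 / 3 : ℂ) * ∑ i, y.1 i)) + (1 / 3 : ℂ) * ∑ i, y.1 i =
        y.1 i
      rw [Circle.coe_one]
      ring
    · funext i
      show ((1 : Circle) : ℂ) * y.2 i = y.2 i
      rw [Circle.coe_one, one_mul]

theorem projectiveSystem_equivalent :
    (projectiveSystem m μ (hamMu m μ)).Equivalent (relativeSystem m μ) := by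
  have M₁ := projectiveSystem_hasMomentum (μ := μ) hm (contDiffOn_hamMu hm μ)
    fun g _ hx => hamMu_scaleTrans hm μ g hx
  refine M₁.equivalent relativeSystem_hasMomentum ?_ (toRelative_partiallySymplectic hm μ _)
    (ofRelative_partiallySymplectic hm μ _) (fun _ _ => rfl) ?_ ?_
  -- Both reduced spaces have dimension ten: `14 - 2 - 2 = 12 - 1 - 1`.
  · simp [finrank_C3, Complex.finrank_real_complex]
  · rintro x ⟨hx, h0⟩
    obtain ⟨k, hk⟩ := ofRelative_toRelative hm μ hx h0
    refine ⟨k⁻¹, ?_⟩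
    rw [hk]
    show (projectiveSystem m μ (hamMu m μ)).act _ ((projectiveSystem m μ (hamMu m μ)).act _ x) = x
    rw [← SymHamSystem.act_mul, inv_mul_cancel, SymHamSystem.act_one]
  · rintro y ⟨hy, -⟩
    exact ⟨1, by rw [SymHamSystem.act_one, toRelative_ofRelative hm μ hy]⟩

end AbsoluteMaps

end ThreeBody

end

theorem mainTheorem2 (m : Fin 3 → ℝ) (hm : ∀ i, 0 < m i) (μ : ℝ) :
    -- the twisted form is induced by the momentum shift from the standard form
    (∀ x ∈ ThreeBody.radialDom, ∀ u v : ThreeBody.RadialPhase,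
      ThreeBody.stdFormRadial (ThreeBody.momentumShift m μ x)
        (fderiv ℝ (ThreeBody.momentumShift m μ) x u)
        (fderiv ℝ (ThreeBody.momentumShift m μ) x v) = ThreeBody.twistedForm m μ x u v) ∧
    -- the invariant set `⟨Z, X⟩ = 0` and its quotient by complex scaling
    (ThreeBody.projectiveSystem m μ (ThreeBody.hamMu m μ)).IsReduction ∧
    (ThreeBody.projectiveSystem m μ (ThreeBody.hamMuExplicit m μ)).IsReduction ∧
    (ThreeBody.relativeSystem m μ).IsReduction ∧
    (ThreeBody.projectiveSystem m μ (ThreeBody.hamMu m μ)).Equivalent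
      (ThreeBody.relativeSystem m μ) ∧
    -- the invariant set `⟨Z, X⟩ = 0`, `X₁₂ + X₃₁ + X₂₃ = 0`, and its quotient by complex scaling
    -- and translations; on this set `H_μ` has the explicit expression
    (∀ x ∈ (ThreeBody.shapeSystem m μ (ThreeBody.hamMu m μ)).level,
      ThreeBody.hamMu m μ x = ThreeBody.hamMuExplicit m μ x) ∧
    (ThreeBody.shapeSystem m μ (ThreeBody.hamMu m μ)).IsReduction ∧
    (ThreeBody.shapeSystem m μ (ThreeBody.hamMuExplicit m μ)).IsReduction ∧
    (ThreeBody.threeBodySystem m μ).IsReduction ∧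
    (ThreeBody.shapeSystem m μ (ThreeBody.hamMu m μ)).Equivalent
      (ThreeBody.threeBodySystem m μ) ∧
    (ThreeBody.shapeSystem m μ (ThreeBody.hamMuExplicit m μ)).Equivalent
      (ThreeBody.threeBodySystem m μ) := by
  refine ⟨fun x hx u v => ThreeBody.stdFormRadial_momentumShift μ hm (hx.2 0) u v,
    (ThreeBody.projectiveSystem_hasMomentum hm (ThreeBody.contDiffOn_hamMu hm μ)
      fun g x hx => ThreeBody.hamMu_scaleTrans hm μ g hx).isReduction,
    (ThreeBody.projectiveSystem_hasMomentum hm (ThreeBody.contDiffOn_hamMuExplicit hm μ)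
      fun g x _ => ThreeBody.hamMuExplicit_scaleTrans μ g).isReduction,
    ThreeBody.relativeSystem_hasMomentum.isReduction,
    ThreeBody.projectiveSystem_equivalent μ hm,
    fun x hx => ThreeBody.hamMu_eq_explicit hm μ hx.1 hx.2.1 hx.2.2,
    (ThreeBody.shapeSystem_hasMomentum hm (ThreeBody.contDiffOn_hamMu hm μ)
      fun g x hx => ThreeBody.hamMu_scaleTrans hm μ g hx).isReduction,
    (ThreeBody.shapeSystem_hasMomentum hm (ThreeBody.contDiffOn_hamMuExplicit hm μ)
      fun g x _ => ThreeBody.hamMuExplicit_scaleTrans μ g).isReduction,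
    ThreeBody.threeBodySystem_hasMomentum.isReduction,
    ThreeBody.shapeSystem_equivalent μ hm (ThreeBody.contDiffOn_hamMu hm μ)
      (fun g x hx => ThreeBody.hamMu_scaleTrans hm μ g hx) fun _ _ => rfl,
    ThreeBody.shapeSystem_equivalent μ hm (ThreeBody.contDiffOn_hamMuExplicit hm μ)
      (fun g x _ => ThreeBody.hamMuExplicit_scaleTrans μ g)
      fun x hx => ThreeBody.hamMu_eq_explicit hm μ hx.1 hx.2.1 hx.2.2⟩
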